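/- Let $\mathbb G=(C(\mathbb G),\Delta)$ be a compact quantum group: $C(\mathbb G)\neq 0$ is a unital $C^*$-algebra and $\Delta:C(\mathbb G)\to C(\mathbb G)\otimes_{\min}C(\mathbb G)$ is a coassociative unital $*$-homomorphism such that $\{\Delta(x)(y\otimes 1)\}$ and $\{\Delta(x)(1\otimes y)\}$ span dense subspaces. A (finite-dimensional) representation on $H_u=\mathbb C^{n}$ is an invertible $u=(u_{ij})\in M_n(C(\mathbb G))$ with $\Delta(u_{ij})=\sum_k u_{ik}\otimes u_{kj}$; put $\mathrm{Hom}(u,w)=\{X: w(X\otimes 1)=(X\otimes 1)u\}$, call $u,w$ equivalent ($u\cong w$) if $\mathrm{Hom}(u,w)$ contains an invertible operator, and call a nonzero unitary representation $u$ irreducible if $\mathrm{Hom}(u,u)=\mathbb C\,\mathrm{Id}$. The tensor product $u\otimes w$ has the entries $u_{ij}w_{kl}$, and $u\subseteq w$ means $u\oplus w'\cong w$ for some representation $w'$. For a unitary representation $u$ let $u^c=(u_{ij}^*)$, and let $Q_u$ be the positive invertible matrix such that $\overline u=(Q_u^{1/2}\otimes 1)u^c(Q_u^{-1/2}\otimes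 1)$ is a unitary representation and $\mathrm{Tr}(Q_u\,\cdot)=\mathrm{Tr}(Q_u^{-1}\,\cdot)$ on $\mathrm{Hom}(u^c,u^c)$. Put $d_u=\mathrm{Tr}(Q_u)$ and $\mathrm{Tr}_{Q_u}(X)=\mathrm{Tr}(Q_u^{t}X)$ for $X\in B(H_u)$ (which is $\mathrm{Tr}(Q_uX)$ if the basis of $H_u$ is chosen so that $Q_u$ is diagonal). $\mathbb G$ is of Kac type if $Q_u=\mathrm{Id}$ for every unitary representation $u$. A linear map $\Phi:B(H_u)\to B(H_w)$ is covariant if $(\Phi\otimes\mathrm{id})(u(X\otimes1)u^*)=w(\Phi(X)\otimes 1)w^*$ for all $X\in B(H_u)$. Let $\mathrm{Cov}(u,w)$ be the space of covariant maps, and $\mathrm{CPCov}(u,w)$, $\mathrm{UCPCov}(u,w)$, $\mathrm{CPTPCov}(u,w)$ the sets of those that are, respectively, completely positive, unital completely positive, and completely positive and trace-preserving. Write $\mathrm{Ext}$ for the set of extreme points. If $\alpha,\beta,\gamma$ are irreducible and $v\in\mathrm{Hom}(\alpha,\beta\otimes\gamma)$ is isometric, the associated Clebsch–Gordan map is $$\Phi^{\alpha\to\beta}_{\gamma}:B(H_\alpha)\to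 B(H_\beta),\qquad \Phi^{\alpha\to\beta}_{\gamma}(X)=(\mathrm{id}\otimes\mathrm{Tr}_{Q_\gamma})(vXv^*).$$ **Theorem.** Let $\alpha,\beta$ and $\gamma_1,\dots,\gamma_N$ be irreducible unitary representations of $\mathbb G$ such that $\overline\alpha\otimes\beta\cong\bigoplus_{j=1}^N\overline{\gamma_j}$ is a multiplicity-free irreducible decomposition (the $\overline{\gamma_j}$ are pairwise inequivalent). Then an irreducible unitary representation $\delta$ satisfies $\overline\delta\subseteq\overline\alpha\otimes\beta$ if and only if $\delta\cong\gamma_j$ for some $j$; for each $j$ there is an isometric $v_j\in\mathrm{Hom}(\alpha,\beta\otimes\gamma_j)$; and for every choice of such $v_1,\dots,v_N$ the corresponding maps $\Phi^{\alpha\to\beta}_{\gamma_j}$ satisfy: 1. $\Phi^{\alpha\to\beta}_{\gamma_1},\dots,\Phi^{\alpha\to\beta}_{\gamma_N}$ form a basis of $\mathrm{Cov}(\alpha,\beta)$. 2. $\mathrm{CPCov}(\alpha,\beta)=\{\sum_{j=1}^N a_j\Phi^{\alpha\to\beta}_{\gamma_j}: a_j\ge 0\}$. 3. $\mathrm{Ext}(\mathrm{UCPCov}(\alpha,\beta))=\{\frac{d_\beta}{d_\alpha}\Phi^{\alpha\to\beta}_{\gamma_j}:1\le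 j\le N\}$. 4. If $\mathbb G$ is of Kac type, then $\mathrm{Ext}(\mathrm{CPTPCov}(\alpha,\beta))=\{\Phi^{\alpha\to\beta}_{\gamma_j}:1\le j\le N\}$. -/

import Mathlib

open scoped TensorProduct Matrix MatrixOrder ComplexOrder

universe u

noncomputable section

/-! ### The minimal tensor product of two unital C⋆-algebras -/

/-- A (unital) ⋆-representation of a C⋆-algebra on a Hilbert space. -/
structure HilbertRep (A : Type u) [CStarAlgebra A] where
  /-- the Hilbert space -/
  H : Type u
  [normed : NormedAddCommGroup H]
  [innerProduct : InnerProductSpace ℂ H]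
  [complete : CompleteSpace H]
  /-- the ⋆-homomorphism -/
  π : A →⋆ₐ[ℂ] (H →L[ℂ] H)

attribute [instance] HilbertRep.normed HilbertRep.innerProduct HilbertRep.complete

namespace HilbertRep

variable {A B A' B' : Type u} [CStarAlgebra A] [CStarAlgebra B] [CStarAlgebra A'] [CStarAlgebra B']

/-- The underlying algebra homomorphism into all linear endomorphisms. -/
def toEnd (p : HilbertRep A) : A →ₐ[ℂ] Module.End ℂ p.H where
  toFun a := (p.π a : p.H →ₗ[ℂ] p.H)
  map_one' := by rw [map_one]; rfl
  map_mul' a b := by rw [map_mul]; rfl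
  map_zero' := by rw [map_zero]; rfl
  map_add' a b := by rw [map_add]; rfl
  commutes' c := by
    rw [AlgHomClass.commutes]
    ext x
    simp [Algebra.algebraMap_eq_smul_one]

/-- The product representation `π ⊗ ρ` of the algebraic tensor product `A ⊗ B` on the (dense)
algebraic tensor product of the two Hilbert spaces. -/
def act (p : HilbertRep A) (q : HilbertRep B) : A ⊗[ℂ] B →ₐ[ℂ] Module.End ℂ (p.H ⊗[ℂ] q.H) :=
  (Module.endTensorEndAlgHom (R := ℂ) (S := ℂ) (A := ℂ) (M := p.H) (N := q.H)).comp
    (Algebra.TensorProduct.map p.toEnd q.toEnd)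

theorem act_tmul (p : HilbertRep A) (q : HilbertRep B) (a : A) (b : B) (x : p.H) (y : q.H) :
    act p q (a ⊗ₜ b) (x ⊗ₜ y) = p.π a x ⊗ₜ q.π b y := by
  simp [act, toEnd, Module.endTensorEndAlgHom_apply]

theorem inner_act (p : HilbertRep A) (q : HilbertRep B) (t : A ⊗[ℂ] B) (x y : p.H ⊗[ℂ] q.H) :
    inner ℂ (act p q t x) y = inner ℂ x (act p q (star t) y) := by
  induction t using TensorProduct.induction_on with
  | zero => simp
  | add s t hs ht => simp [inner_add_left, inner_add_right, hs, ht]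
  | tmul a b =>
    induction x using TensorProduct.induction_on with
    | zero => simp
    | add x x' h h' => simp only [map_add, inner_add_left, h, h']
    | tmul x x' =>
      induction y using TensorProduct.induction_on with
      | zero => simp
      | add y y' h h' => simp only [map_add, inner_add_right, h, h']
      | tmul y y' =>
        simp only [TensorProduct.star_tmul, act_tmul, TensorProduct.inner_tmul, map_star]
        rw [ContinuousLinearMap.star_eq_adjoint, ContinuousLinearMap.star_eq_adjoint,
          ContinuousLinearMap.adjoint_inner_right, ContinuousLinearMap.adjoint_inner_right]

theorem norm_act_sq (p : HilbertRep A) (q : HilbertRep B) (t : A ⊗[ℂ] B) (x : p.H ⊗[ℂ] q.H) :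
    ((‖act p q t x‖ ^ 2 : ℝ) : ℂ) = inner ℂ x (act p q (star t * t) x) := by
  rw [map_mul, Module.End.mul_apply, ← inner_act]
  have h : inner ℂ (act p q t x) (act p q t x) = ((‖act p q t x‖ : ℝ) : ℂ) ^ 2 :=
    inner_self_eq_norm_sq_to_K (𝕜 := ℂ) (act p q t x)
  rw [h, Complex.ofReal_pow]

theorem exists_sq (a : A) : ∃ r : A, algebraMap ℂ A ((‖a‖ ^ 2 : ℝ) : ℂ) = star a * a + star r * r := by
  let _ := CStarAlgebra.spectralOrder A
  have := CStarAlgebra.spectralOrderedRing A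
  have h := CStarAlgebra.star_mul_le_algebraMap_norm_sq (a := a)
  obtain ⟨r, hr⟩ := CStarAlgebra.nonneg_iff_eq_star_mul_self.1 (sub_nonneg.2 h)
  refine ⟨r, ?_⟩
  rw [← hr, add_sub_cancel]
  rw [Algebra.algebraMap_eq_smul_one, Algebra.algebraMap_eq_smul_one, Complex.coe_smul]

theorem norm_act_le_of_sq (p : HilbertRep A) (q : HilbertRep B) (s r : A ⊗[ℂ] B) (c : ℝ)
    (hc : 0 ≤ c) (h : algebraMap ℂ (A ⊗[ℂ] B) ((c ^ 2 : ℝ) : ℂ) = star s * s + star r * r)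
    (x : p.H ⊗[ℂ] q.H) : ‖act p q s x‖ ≤ c * ‖x‖ := by
  have h1 := norm_act_sq p q s x
  have h2 := norm_act_sq p q r x
  have h3 : ((c ^ 2 * ‖x‖ ^ 2 : ℝ) : ℂ) = ((‖act p q s x‖ ^ 2 + ‖act p q r x‖ ^ 2 : ℝ) : ℂ) := by
    have h5 : inner ℂ x (act p q (star s * s) x) + inner ℂ x (act p q (star r * r) x)
        = inner ℂ x (act p q (star s * s) x + act p q (star r * r) x) :=
      (inner_add_right x _ _).symm
    have h6 : inner ℂ x (((c ^ 2 : ℝ) : ℂ) • x) = ((c ^ 2 : ℝ) : ℂ) * ((‖x‖ : ℝ) : ℂ) ^ 2 :=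
      (inner_smul_right x x _).trans (congrArg _ (inner_self_eq_norm_sq_to_K (𝕜 := ℂ) x))
    rw [Complex.ofReal_add, h1, h2, h5, ← LinearMap.add_apply, ← map_add, ← h,
      AlgHom.commutes, Module.algebraMap_end_apply, h6]
    push_cast
    rfl
  have h4 := Complex.ofReal_injective h3
  have : ‖act p q s x‖ ^ 2 ≤ (c * ‖x‖) ^ 2 := by nlinarith [sq_nonneg ‖act p q r x‖]
  exact le_of_sq_le_sq this (by positivity)

theorem norm_act_tmul_le (p : HilbertRep A) (q : HilbertRep B) (a : A) (b : B)
    (x : p.H ⊗[ℂ] q.H) : ‖act p q (a ⊗ₜ b) x‖ ≤ ‖a‖ * ‖b‖ * ‖x‖ := by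
  have e : a ⊗ₜ[ℂ] b = (a ⊗ₜ[ℂ] (1 : B)) * ((1 : A) ⊗ₜ[ℂ] b) := by simp
  obtain ⟨r, hr⟩ := exists_sq a
  obtain ⟨s, hs⟩ := exists_sq b
  have h1 : ∀ y, ‖act p q (a ⊗ₜ[ℂ] (1 : B)) y‖ ≤ ‖a‖ * ‖y‖ := by
    apply norm_act_le_of_sq p q _ (r ⊗ₜ[ℂ] (1 : B)) _ (norm_nonneg a)
    rw [Algebra.TensorProduct.algebraMap_apply, hr]
    simp [TensorProduct.star_tmul, TensorProduct.add_tmul]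
  have h2 : ∀ y, ‖act p q ((1 : A) ⊗ₜ[ℂ] b) y‖ ≤ ‖b‖ * ‖y‖ := by
    apply norm_act_le_of_sq p q _ ((1 : A) ⊗ₜ[ℂ] s) _ (norm_nonneg b)
    rw [Algebra.TensorProduct.algebraMap_apply', hs]
    simp [TensorProduct.star_tmul, TensorProduct.tmul_add]
  rw [e, map_mul, Module.End.mul_apply]
  calc _ ≤ ‖a‖ * ‖act p q ((1 : A) ⊗ₜ[ℂ] b) x‖ := h1 _
    _ ≤ ‖a‖ * (‖b‖ * ‖x‖) := by gcongr; exact h2 x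
    _ = _ := by ring

theorem exists_bound (t : A ⊗[ℂ] B) : ∃ C : ℝ, 0 ≤ C ∧
    ∀ (p : HilbertRep A) (q : HilbertRep B) (x : p.H ⊗[ℂ] q.H), ‖act p q t x‖ ≤ C * ‖x‖ := by
  induction t using TensorProduct.induction_on with
  | zero => exact ⟨0, le_rfl, by simp⟩
  | tmul a b => exact ⟨‖a‖ * ‖b‖, by positivity, fun p q x => norm_act_tmul_le p q a b x⟩
  | add s t hs ht =>
    obtain ⟨C, hC, h⟩ := hs
    obtain ⟨D, hD, h'⟩ := ht
    refine ⟨C + D, by positivity, fun p q x => ?_⟩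
    rw [map_add, LinearMap.add_apply, add_mul]
    exact (norm_add_le _ _).trans (add_le_add (h p q x) (h' p q x))

/-- Restriction of a representation along a ⋆-homomorphism. -/
def comp (p : HilbertRep A') (f : A →⋆ₐ[ℂ] A') : HilbertRep A where
  H := p.H
  π := p.π.comp f

end HilbertRep

/-- The algebraic tensor product `A ⊗ B`, to be equipped with the minimal C⋆-norm. -/
def AlgTensor (A B : Type u) [CStarAlgebra A] [CStarAlgebra B] : Type u := A ⊗[ℂ] B

namespace AlgTensor

open HilbertRep

variable {A B A' B' : Type u} [CStarAlgebra A] [CStarAlgebra B] [CStarAlgebra A'] [CStarAlgebra B']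

instance : Ring (AlgTensor A B) := inferInstanceAs (Ring (A ⊗[ℂ] B))
instance : Algebra ℂ (AlgTensor A B) := inferInstanceAs (Algebra ℂ (A ⊗[ℂ] B))
instance : StarRing (AlgTensor A B) := inferInstanceAs (StarRing (A ⊗[ℂ] B))
instance : StarModule ℂ (AlgTensor A B) := inferInstanceAs (StarModule ℂ (A ⊗[ℂ] B))

/-- The minimal (spatial) C⋆-norm: the supremum of the operator norms of `(π ⊗ ρ)(t)` over all
⋆-representations `π` of `A` and `ρ` of `B`, written as the least common bound of these operators. -/
def minNorm (t : A ⊗[ℂ] B) : ℝ :=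
  sInf {C : ℝ | 0 ≤ C ∧
    ∀ (p : HilbertRep A) (q : HilbertRep B) (x : p.H ⊗[ℂ] q.H), ‖act p q t x‖ ≤ C * ‖x‖}

theorem minNorm_le {t : A ⊗[ℂ] B} {C : ℝ} (hC : 0 ≤ C)
    (h : ∀ (p : HilbertRep A) (q : HilbertRep B) (x : p.H ⊗[ℂ] q.H), ‖act p q t x‖ ≤ C * ‖x‖) :
    minNorm t ≤ C :=
  csInf_le ⟨0, fun _ h => h.1⟩ ⟨hC, h⟩

theorem minNorm_nonneg (t : A ⊗[ℂ] B) : 0 ≤ minNorm t := Real.sInf_nonneg fun _ h => h.1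

theorem le_minNorm (t : A ⊗[ℂ] B) (p : HilbertRep A) (q : HilbertRep B) (x : p.H ⊗[ℂ] q.H) :
    ‖act p q t x‖ ≤ minNorm t * ‖x‖ := by
  rcases eq_or_ne x 0 with rfl | hx
  · simp
  have hx' : 0 < ‖x‖ := norm_pos_iff.2 hx
  rw [← div_le_iff₀ hx']
  exact le_csInf (exists_bound t) fun C hC => (div_le_iff₀ hx').2 (hC.2 p q x)

theorem minNorm_add (s t : A ⊗[ℂ] B) : minNorm (s + t) ≤ minNorm s + minNorm t := by
  refine minNorm_le (add_nonneg (minNorm_nonneg s) (minNorm_nonneg t)) fun p q x => ?_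
  rw [map_add, LinearMap.add_apply, add_mul]
  exact (norm_add_le _ _).trans (add_le_add (le_minNorm s p q x) (le_minNorm t p q x))

theorem minNorm_mul (s t : A ⊗[ℂ] B) : minNorm (s * t) ≤ minNorm s * minNorm t := by
  refine minNorm_le (mul_nonneg (minNorm_nonneg s) (minNorm_nonneg t)) fun p q x => ?_
  rw [map_mul, Module.End.mul_apply, mul_assoc]
  exact (le_minNorm s p q _).trans
    (mul_le_mul_of_nonneg_left (le_minNorm t p q x) (minNorm_nonneg s))

theorem minNorm_smul_le (c : ℂ) (t : A ⊗[ℂ] B) : minNorm (c • t) ≤ ‖c‖ * minNorm t := by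
  refine minNorm_le (mul_nonneg (norm_nonneg c) (minNorm_nonneg t)) fun p q x => ?_
  rw [map_smul, LinearMap.smul_apply, norm_smul, mul_assoc]
  exact mul_le_mul_of_nonneg_left (le_minNorm t p q x) (norm_nonneg c)

theorem minNorm_zero : minNorm (0 : A ⊗[ℂ] B) = 0 :=
  le_antisymm (minNorm_le le_rfl fun p q x => by simp) (minNorm_nonneg _)

theorem minNorm_neg (t : A ⊗[ℂ] B) : minNorm (-t) = minNorm t := by
  have h : ∀ s : A ⊗[ℂ] B, minNorm (-s) ≤ minNorm s := fun s => by
    simpa using minNorm_smul_le (-1) s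
  exact le_antisymm (h t) (by simpa using h (-t))

theorem minNorm_star_mul_self (t : A ⊗[ℂ] B) : minNorm t * minNorm t ≤ minNorm (star t * t) := by
  have cs : ∀ (p : HilbertRep A) (q : HilbertRep B) (x y : p.H ⊗[ℂ] q.H),
      ‖(inner ℂ x y : ℂ)‖ ≤ ‖x‖ * ‖y‖ := fun p q x y => norm_inner_le_norm x y
  have h : minNorm t ≤ √(minNorm (star t * t)) := by
    refine minNorm_le (Real.sqrt_nonneg _) fun p q x => ?_
    have h1 : ‖act p q t x‖ ^ 2 ≤ minNorm (star t * t) * ‖x‖ ^ 2 := by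
      have h2 := congrArg norm (norm_act_sq p q t x)
      rw [Complex.norm_real, Real.norm_of_nonneg (by positivity)] at h2
      rw [h2]
      calc ‖inner ℂ x (act p q (star t * t) x)‖ ≤ ‖x‖ * ‖act p q (star t * t) x‖ := cs p q _ _
        _ ≤ ‖x‖ * (minNorm (star t * t) * ‖x‖) := by gcongr; exact le_minNorm _ p q x
        _ = _ := by ring
    apply le_of_sq_le_sq _ (by positivity)
    rw [mul_pow, Real.sq_sqrt (minNorm_nonneg _)]
    exact h1
  calc _ ≤ √(minNorm (star t * t)) * √(minNorm (star t * t)) :=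
        mul_le_mul h h (minNorm_nonneg t) (Real.sqrt_nonneg _)
    _ = _ := Real.mul_self_sqrt (minNorm_nonneg _)

theorem minNorm_star_le (t : A ⊗[ℂ] B) : minNorm (star t) ≤ minNorm t := by
  rcases (minNorm_nonneg (star t)).eq_or_lt with h0 | h0
  · rw [← h0]; exact minNorm_nonneg t
  have h := (minNorm_star_mul_self (star t)).trans (minNorm_mul (star (star t)) (star t))
  rw [star_star] at h
  exact le_of_mul_le_mul_right h h0

instance : SeminormedRing (AlgTensor A B) :=
  RingSeminorm.toSeminormedRing
    { toFun := fun t => minNorm (A := A) (B := B) t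
      map_zero' := minNorm_zero
      add_le' := minNorm_add
      neg' := minNorm_neg
      mul_le' := minNorm_mul }

theorem norm_def (t : AlgTensor A B) : ‖t‖ = minNorm (A := A) (B := B) t := rfl

instance : NormedAlgebra ℂ (AlgTensor A B) where
  norm_smul_le c t := minNorm_smul_le (A := A) (B := B) c t

instance : NormedStarGroup (AlgTensor A B) where
  norm_star_le t := minNorm_star_le (A := A) (B := B) t

theorem norm_mul_self_le (t : AlgTensor A B) : ‖t‖ * ‖t‖ ≤ ‖star t * t‖ :=
  minNorm_star_mul_self (A := A) (B := B) t

end AlgTensor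

/-! ### Completion of a ⋆-algebra in a C⋆-seminorm -/

section Completion

open UniformSpace

instance instStarCompletion (R : Type*) [SeminormedRing R] [StarRing R] : Star (Completion R) :=
  ⟨Completion.map star⟩

theorem completion_continuous_star {R : Type*} [SeminormedRing R] [StarRing R] :
    Continuous (star : Completion R → Completion R) :=
  Completion.continuous_map

variable {R : Type*} [SeminormedRing R] [StarRing R] [NormedStarGroup R]

theorem completion_uniformContinuous_star : UniformContinuous (star : R → R) := by
  refine (LipschitzWith.of_dist_le_mul (K := 1) fun s t => ?_).uniformContinuous
  rw [dist_eq_norm, dist_eq_norm, NNReal.coe_one, one_mul, ← star_sub, norm_star]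

theorem completion_coe_star (x : R) : ((star x : R) : Completion R) = star (x : Completion R) :=
  (Completion.map_coe completion_uniformContinuous_star x).symm

theorem completion_star_star (x : Completion R) : star (star x) = x := by
  induction x using Completion.induction_on with
  | hp =>
    exact isClosed_eq (completion_continuous_star.comp completion_continuous_star) continuous_id
  | ih x => rw [← completion_coe_star, ← completion_coe_star, star_star]

theorem completion_star_mul (x y : Completion R) : star (x * y) = star y * star x := by
  have h := completion_continuous_star (R := R)
  induction x, y using Completion.induction_on₂ with
  | hp =>
    exact isClosed_eq (h.comp (continuous_fst.mul continuous_snd))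
      ((h.comp continuous_snd).mul (h.comp continuous_fst))
  | ih x y => simp only [← completion_coe_star, ← Completion.coe_mul, star_mul]

theorem completion_star_add (x y : Completion R) : star (x + y) = star x + star y := by
  have h := completion_continuous_star (R := R)
  induction x, y using Completion.induction_on₂ with
  | hp =>
    exact isClosed_eq (h.comp (continuous_fst.add continuous_snd))
      ((h.comp continuous_fst).add (h.comp continuous_snd))
  | ih x y => simp only [← completion_coe_star, ← Completion.coe_add, star_add]

theorem completion_norm_mul_self_le (h : ∀ x : R, ‖x‖ * ‖x‖ ≤ ‖star x * x‖) (x : Completion R) :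
    ‖x‖ * ‖x‖ ≤ ‖star x * x‖ := by
  have hs := completion_continuous_star (R := R)
  induction x using Completion.induction_on with
  | hp => exact isClosed_le (by fun_prop) (continuous_norm.comp (hs.mul continuous_id))
  | ih x =>
    rw [← completion_coe_star, ← Completion.coe_mul, Completion.norm_coe, Completion.norm_coe]
    exact h x

theorem completion_star_smul [NormedAlgebra ℂ R] [StarModule ℂ R] (c : ℂ) (x : Completion R) :
    star (c • x) = star c • star x := by
  have h := completion_continuous_star (R := R)
  induction x using Completion.induction_on with
  | hp => exact isClosed_eq (h.comp (continuous_id.const_smul c)) (h.const_smul (star c))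
  | ih x => rw [← Completion.coe_smul, ← completion_coe_star, ← completion_coe_star,
      ← Completion.coe_smul, star_smul]

variable (R)

/-- The completion of a complex ⋆-algebra with respect to a C⋆-seminorm is a C⋆-algebra. -/
@[reducible]
def completionCStarAlgebra [NormedAlgebra ℂ R] [StarModule ℂ R]
    (h : ∀ x : R, ‖x‖ * ‖x‖ ≤ ‖star x * x‖) : CStarAlgebra (Completion R) :=
  let _ : StarRing (Completion R) :=
    { star_involutive := completion_star_star
      star_mul := completion_star_mul
      star_add := completion_star_add }
  let _ : NormedAlgebra ℂ (Completion R) := { norm_smul_le := norm_smul_le }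
  { norm_mul_self_le := completion_norm_mul_self_le h
    star_smul := completion_star_smul }

end Completion

/-- The minimal tensor product of C⋆-algebras: the completion of the algebraic tensor product in
the minimal C⋆-norm. -/
def MinTensor (A B : Type u) [CStarAlgebra A] [CStarAlgebra B] : Type u :=
  UniformSpace.Completion (AlgTensor A B)

namespace MinTensor

open UniformSpace HilbertRep

variable {A B A' B' : Type u} [CStarAlgebra A] [CStarAlgebra B] [CStarAlgebra A'] [CStarAlgebra B']

instance : CStarAlgebra (MinTensor A B) :=
  completionCStarAlgebra (AlgTensor A B) AlgTensor.norm_mul_self_le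

/-- The canonical map of the algebraic tensor product to the minimal tensor product. -/
def of (t : A ⊗[ℂ] B) : MinTensor A B :=
  Completion.coe' (α := AlgTensor A B) t

/-- The elementary tensor `a ⊗ b`. -/
def tmul (a : A) (b : B) : MinTensor A B := of (a ⊗ₜ[ℂ] b)

theorem norm_of (t : A ⊗[ℂ] B) : ‖(of t : MinTensor A B)‖ = AlgTensor.minNorm t :=
  Completion.norm_coe (E := AlgTensor A B) t

theorem of_mul (s t : A ⊗[ℂ] B) : (of (s * t) : MinTensor A B) = of s * of t :=
  Completion.coe_mul (α := AlgTensor A B) s t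

theorem of_star (t : A ⊗[ℂ] B) : (of (star t) : MinTensor A B) = star (of t) :=
  completion_coe_star (R := AlgTensor A B) t

/-- The map `f ⊗ g` on algebraic tensor products. -/
def algMap (f : A →⋆ₐ[ℂ] A') (g : B →⋆ₐ[ℂ] B') : A ⊗[ℂ] B →ₐ[ℂ] A' ⊗[ℂ] B' :=
  Algebra.TensorProduct.map f.toAlgHom g.toAlgHom

theorem minNorm_algMap_le (f : A →⋆ₐ[ℂ] A') (g : B →⋆ₐ[ℂ] B') (t : A ⊗[ℂ] B) :
    AlgTensor.minNorm (algMap f g t) ≤ AlgTensor.minNorm t := by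
  refine AlgTensor.minNorm_le (AlgTensor.minNorm_nonneg t) fun p q x => ?_
  have h : act p q (algMap f g t) = act (p.comp f) (q.comp g) t := by
    induction t using TensorProduct.induction_on with
    | zero => rw [map_zero, map_zero, map_zero]; rfl
    | add s t hs ht => rw [map_add, map_add, hs, ht, map_add]; rfl
    | tmul a b =>
      apply TensorProduct.ext'
      intro y z
      exact (act_tmul p q (f a) (g b) y z).trans
        (act_tmul (p.comp f) (q.comp g) a b y z).symm
  rw [h]
  exact AlgTensor.le_minNorm t (p.comp f) (q.comp g) x

/-- The continuous extension of `f ⊗ g` to the minimal tensor products. -/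
def map (f : A →⋆ₐ[ℂ] A') (g : B →⋆ₐ[ℂ] B') : MinTensor A B → MinTensor A' B' :=
  Completion.map (α := AlgTensor A B) (β := AlgTensor A' B') fun t => algMap f g t

theorem uniformContinuous_algMap (f : A →⋆ₐ[ℂ] A') (g : B →⋆ₐ[ℂ] B') :
    UniformContinuous (α := AlgTensor A B) (β := AlgTensor A' B') (fun t => algMap f g t) := by
  refine (LipschitzWith.of_dist_le_mul (α := AlgTensor A B) (β := AlgTensor A' B') (K := 1)
    fun s t => ?_).uniformContinuous
  have h := minNorm_algMap_le f g (show A ⊗[ℂ] B from s - t)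
  have e : algMap f g (show A ⊗[ℂ] B from s - t) = algMap f g s - algMap f g t :=
    map_sub (algMap f g) s t
  rw [e] at h
  rw [NNReal.coe_one, one_mul, dist_eq_norm s t]
  exact (dist_eq_norm (E := AlgTensor A' B') _ _).trans_le h

theorem map_of (f : A →⋆ₐ[ℂ] A') (g : B →⋆ₐ[ℂ] B') (t : A ⊗[ℂ] B) :
    map f g (of t) = of (algMap f g t) :=
  Completion.map_coe (uniformContinuous_algMap f g) t

theorem map_tmul (f : A →⋆ₐ[ℂ] A') (g : B →⋆ₐ[ℂ] B') (a : A) (b : B) :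
    map f g (tmul a b) = tmul (f a) (g b) :=
  map_of f g (a ⊗ₜ b)

theorem continuous_map (f : A →⋆ₐ[ℂ] A') (g : B →⋆ₐ[ℂ] B') : Continuous (map f g) :=
  Completion.continuous_map

/-- `of` as a linear map. -/
def ofₗ (A B : Type u) [CStarAlgebra A] [CStarAlgebra B] : A ⊗[ℂ] B →ₗ[ℂ] MinTensor A B where
  toFun := of
  map_add' s t := Completion.coe_add (α := AlgTensor A B) s t
  map_smul' c t := Completion.coe_smul (X := AlgTensor A B) c t

/-- `x ∈ (A ⊗ B) ⊗ C` and `y ∈ A ⊗ (B ⊗ C)` correspond to each other under the associativity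
isomorphism of the minimal tensor product. This isomorphism is the isometric extension of the
associator of the algebraic tensor products, so that its graph is the closure of the graph of the
algebraic associator. -/
def AssocRel {A B C : Type u} [CStarAlgebra A] [CStarAlgebra B] [CStarAlgebra C]
    (x : MinTensor (MinTensor A B) C) (y : MinTensor A (MinTensor B C)) : Prop :=
  (x, y) ∈ closure (Set.range fun t : (A ⊗[ℂ] B) ⊗[ℂ] C =>
    ((of (TensorProduct.map (ofₗ A B) LinearMap.id t),
      of (TensorProduct.map LinearMap.id (ofₗ B C) (TensorProduct.assoc ℂ A B C t))) :
      MinTensor (MinTensor A B) C × MinTensor A (MinTensor B C)))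

end MinTensor

/-! ### Compact quantum groups and their representations -/

/-- A compact quantum group with underlying unital C⋆-algebra `A = C(𝔾)`: a coassociative unital
⋆-homomorphism `Δ : A → A ⊗ A` (minimal tensor product) such that both `{Δ(a)(b ⊗ 1)}` and
`{Δ(a)(1 ⊗ b)}` span dense subspaces of `A ⊗ A`. -/
structure CompactQuantumGroup (A : Type u) [CStarAlgebra A] where
  /-- the comultiplication `Δ` -/
  comul : A →⋆ₐ[ℂ] MinTensor A A
  coassoc : ∀ a : A, MinTensor.AssocRel
    (MinTensor.map comul (StarAlgHom.id ℂ A) (comul a))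
    (MinTensor.map (StarAlgHom.id ℂ A) comul (comul a))
  dense_left : Dense (Submodule.span ℂ
    {x : MinTensor A A | ∃ a b : A, x = comul a * MinTensor.tmul b 1} : Set (MinTensor A A))
  dense_right : Dense (Submodule.span ℂ
    {x : MinTensor A A | ∃ a b : A, x = comul a * MinTensor.tmul 1 b} : Set (MinTensor A A))

namespace CompactQuantumGroup

variable {A : Type u} [CStarAlgebra A]
variable {k l m n : Type*} [Fintype k] [Fintype l] [Fintype m] [Fintype n]
  [DecidableEq k] [DecidableEq l] [DecidableEq m] [DecidableEq n]

/-- The element `X ⊗ 1` for a complex matrix `X`. -/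
def scalar (A : Type u) [CStarAlgebra A] (X : Matrix m n ℂ) : Matrix m n A :=
  X.map (algebraMap ℂ A)

/-- `u ∈ Mₙ(C(𝔾))` is a finite dimensional representation. -/
def IsRep (G : CompactQuantumGroup A) (u : Matrix n n A) : Prop :=
  IsUnit u ∧ ∀ i j, G.comul (u i j) = ∑ k, MinTensor.tmul (u i k) (u k j)

/-- `u` is a unitary representation. -/
def IsUnitaryRep (G : CompactQuantumGroup A) (u : Matrix n n A) : Prop :=
  G.IsRep u ∧ u ∈ unitary (Matrix n n A)

/-- The space of intertwiners `Hom(u, v) = {X : v (X ⊗ 1) = (X ⊗ 1) u}`. -/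
def Hom (u : Matrix n n A) (v : Matrix m m A) : Set (Matrix m n ℂ) :=
  {X | v * scalar A X = scalar A X * u}

/-- Equivalence of representations: there is an invertible intertwiner. -/
def Equivalent (u : Matrix n n A) (v : Matrix m m A) : Prop :=
  ∃ X ∈ Hom u v, ∃ Y : Matrix n m ℂ, Y * X = 1 ∧ X * Y = 1

/-- `u` is a (nonzero) irreducible unitary representation: `Hom(u, u) = ℂ · Id`. -/
def IsIrrep (G : CompactQuantumGroup A) (u : Matrix n n A) : Prop :=
  G.IsUnitaryRep u ∧ Nonempty n ∧ ∀ X ∈ Hom u u, ∃ c : ℂ, X = c • (1 : Matrix n n ℂ)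

/-- The tensor product of two representations, with entries `u_{ij} v_{kl}`. -/
def tensor (u : Matrix n n A) (v : Matrix m m A) : Matrix (n × m) (n × m) A :=
  Matrix.kroneckerMap (fun a b => a * b) u v

/-- `u` is a subrepresentation of `v`: `u ⊕ w ≅ v` for some representation `w`. -/
def IsSubrep (G : CompactQuantumGroup A) (u : Matrix n n A) (v : Matrix m m A) : Prop :=
  ∃ (d : ℕ) (w : Matrix (Fin d) (Fin d) A), G.IsRep w ∧
    Equivalent (Matrix.fromBlocks u 0 0 w) v

/-- `v ≅ w₁ ⊕ ⋯ ⊕ w_N` is a multiplicity-free irreducible decomposition of the representation `v`: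
the `w_j` are irreducible unitary representations and pairwise inequivalent. -/
structure IsMultiplicityFreeDecomposition (G : CompactQuantumGroup A) {N : ℕ} {d : Fin N → ℕ}
    (v : Matrix m m A) (w : ∀ j, Matrix (Fin (d j)) (Fin (d j)) A) : Prop where
  isRep : G.IsRep v
  isIrrep : ∀ j, G.IsIrrep (w j)
  inequivalent : ∀ i j, Equivalent (w i) (w j) → i = j
  equivalent : Equivalent v (Matrix.blockDiagonal' w)

/-! ### Conjugate representations, quantum dimension, Kac type -/

/-- The contragredient `u^c = (u_{ij}^*)`. -/
def contragredient (u : Matrix n n A) : Matrix n n A := u.map star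

/-- `(Q^{1/2} ⊗ 1) u^c (Q^{-1/2} ⊗ 1)` -/
def conjBy (Q : Matrix n n ℂ) (u : Matrix n n A) : Matrix n n A :=
  scalar A (CFC.sqrt Q) * contragredient u * scalar A (CFC.sqrt Q)⁻¹

/-- The characterization of the matrix `Q_u` of a unitary representation `u`: it is positive and
invertible, `Q_u^{1/2} u^c Q_u^{-1/2}` is a unitary representation, and the functionals
`Tr(Q_u ·)` and `Tr(Q_u⁻¹ ·)` coincide on the intertwiners of `u^c` (for irreducible `u` these are
the scalars, so that this says `Tr Q_u = Tr Q_u⁻¹`). -/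
structure IsQMatrix (G : CompactQuantumGroup A) (u : Matrix n n A) (Q : Matrix n n ℂ) : Prop where
  posDef : Q.PosDef
  isUnitaryRep : G.IsUnitaryRep (conjBy Q u)
  trace_eq : ∀ X ∈ Hom (contragredient u) (contragredient u),
    (Q * X).trace = (Q⁻¹ * X).trace

open Classical in
/-- The matrix `Q_u`, an operator on the conjugate Hilbert space of `u` (the value `0` is assigned
to a matrix `u` without a `Q_u`; there is no such unitary representation `u`). -/
def qMatrix (G : CompactQuantumGroup A) (u : Matrix n n A) : Matrix n n ℂ :=
  if h : ∃ Q, G.IsQMatrix u Q then h.choose else 0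

/-- The conjugate representation `ū = Q_u^{1/2} u^c Q_u^{-1/2}`. -/
def conj (G : CompactQuantumGroup A) (u : Matrix n n A) : Matrix n n A :=
  conjBy (G.qMatrix u) u

/-- The quantum dimension `d_u = Tr(Q_u)`. -/
def qDim (G : CompactQuantumGroup A) (u : Matrix n n A) : ℂ := (G.qMatrix u).trace

/-- `𝔾` is of Kac type: `Q_u = Id` for every unitary representation `u`. -/
def IsKac (G : CompactQuantumGroup A) : Prop :=
  ∀ (d : ℕ) (u : Matrix (Fin d) (Fin d) A), G.IsUnitaryRep u → G.qMatrix u = 1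

/-! ### Covariant maps and Clebsch–Gordan maps -/

/-- The map `Φ ⊗ id : B(H_u) ⊗ C(𝔾) → B(H_v) ⊗ C(𝔾)`. -/
def amplify (Φ : Matrix n n ℂ →ₗ[ℂ] Matrix m m ℂ) (M : Matrix n n A) : Matrix m m A :=
  Matrix.of fun k l => ∑ i, ∑ j, Φ (Matrix.single i j 1) k l • M i j

/-- The space `Cov(u, v)` of covariant maps: `(Φ ⊗ id)(u (X ⊗ 1) u^*) = v (Φ(X) ⊗ 1) v^*`. -/
def Cov (u : Matrix n n A) (v : Matrix m m A) :
    Submodule ℂ (Matrix n n ℂ →ₗ[ℂ] Matrix m m ℂ) where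
  carrier := {Φ | ∀ X, amplify Φ (u * scalar A X * uᴴ) = v * scalar A (Φ X) * vᴴ}
  zero_mem' X := by
    ext i j
    simp [amplify, scalar]
  add_mem' {Φ Ψ} hΦ hΨ X := by
    have e : amplify (Φ + Ψ) (u * scalar A X * uᴴ)
        = amplify Φ (u * scalar A X * uᴴ) + amplify Ψ (u * scalar A X * uᴴ) := by
      ext i j
      simp [amplify, add_smul, Finset.sum_add_distrib]
    have e' : scalar A ((Φ + Ψ) X) = scalar A (Φ X) + scalar A (Ψ X) := by
      ext i j
      simp [scalar]
    rw [e, e', hΦ X, hΨ X, mul_add, add_mul]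
  smul_mem' c Φ hΦ X := by
    have e : amplify (c • Φ) (u * scalar A X * uᴴ) = c • amplify Φ (u * scalar A X * uᴴ) := by
      ext i j
      simp [amplify, mul_smul, Finset.smul_sum]
    have e' : scalar A ((c • Φ) X) = c • scalar A (Φ X) := by
      ext i j
      simp only [scalar, Matrix.map_apply, LinearMap.smul_apply, Matrix.smul_apply, smul_eq_mul,
        map_mul]
      rw [← Algebra.smul_def]
    rw [e, e', hΦ X, mul_smul_comm, smul_mul_assoc]

/-- Complete positivity: `id_r ⊗ Φ` preserves positive semidefinite matrices for all `r`. -/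
def IsCP (Φ : Matrix n n ℂ →ₗ[ℂ] Matrix m m ℂ) : Prop :=
  ∀ (r : ℕ) (X : Matrix (Fin r × n) (Fin r × n) ℂ), X.PosSemidef →
    (Matrix.of fun (p q : Fin r × m) =>
      Φ (Matrix.of fun i j => X (p.1, i) (q.1, j)) p.2 q.2).PosSemidef

/-- The set of completely positive covariant maps. -/
def CPCov (u : Matrix n n A) (v : Matrix m m A) : Set (Matrix n n ℂ →ₗ[ℂ] Matrix m m ℂ) :=
  {Φ | Φ ∈ Cov u v ∧ IsCP Φ}

/-- The set of unital completely positive covariant maps. -/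
def UCPCov (u : Matrix n n A) (v : Matrix m m A) : Set (Matrix n n ℂ →ₗ[ℂ] Matrix m m ℂ) :=
  {Φ | Φ ∈ CPCov u v ∧ Φ 1 = 1}

/-- The set of completely positive trace-preserving covariant maps. -/
def CPTPCov (u : Matrix n n A) (v : Matrix m m A) : Set (Matrix n n ℂ →ₗ[ℂ] Matrix m m ℂ) :=
  {Φ | Φ ∈ CPCov u v ∧ ∀ X, (Φ X).trace = X.trace}

/-- The quantum trace `Tr_{Q_u}` on `B(H_u)`. Since `Q_u` is an operator on the conjugate space of
`H_u`, the operator on `H_u` that corresponds to it has the matrix `Q_uᵀ`; this is `Q_u` itself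
when the basis of `H_u` is chosen such that `Q_u` is diagonal. -/
def qTrace (G : CompactQuantumGroup A) (u : Matrix n n A) (X : Matrix n n ℂ) : ℂ :=
  ((G.qMatrix u)ᵀ * X).trace

/-- `v` is an isometric intertwiner from `u` to `w`. -/
def IsIsometricIntertwiner (u : Matrix n n A) (w : Matrix m m A) (v : Matrix m n ℂ) : Prop :=
  v ∈ Hom u w ∧ vᴴ * v = 1

/-- The Clebsch–Gordan map `X ↦ (id ⊗ Tr_{Q_γ})(v X v^*)` of an isometric intertwiner
`v ∈ Hom(α, β ⊗ γ)`, where `l`, `m`, `n` are the index sets of `γ`, `β`, `α`. -/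
def cgMap (G : CompactQuantumGroup A) (γ : Matrix l l A) (v : Matrix (m × l) n ℂ) :
    Matrix n n ℂ →ₗ[ℂ] Matrix m m ℂ where
  toFun X := Matrix.of fun i j =>
    G.qTrace γ (Matrix.of fun p q => (v * X * vᴴ) (i, p) (j, q))
  map_add' X Y := by
    ext i j
    simp [qTrace, Matrix.trace, Matrix.mul_apply, mul_add, add_mul, Finset.sum_add_distrib]
  map_smul' c X := by
    ext i j
    simp only [qTrace, Matrix.mul_smul, Matrix.smul_mul, Matrix.smul_apply, Matrix.of_apply,
      RingHom.id_apply, Matrix.trace, Matrix.diag_apply, Matrix.mul_apply (M := (G.qMatrix γ)ᵀ),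
      Finset.smul_sum, mul_smul_comm]

end CompactQuantumGroup

end

/-! Everything is moved into the algebra End(ᾱ ⊗ β) = Hom(ᾱ ⊗ β, ᾱ ⊗ β). Let C be the Choi matrix of
Φ. Complete positivity of Φ is positivity of C, and covariance is a relation between C, αᵀ, α^c and
β. Multiplying C on both sides by Q_α^{-1/2} ⊗ 1 preserves positivity and turns this relation into
membership in End(ᾱ ⊗ β) (`mem_cov_iff_twistedChoi`). On the other side, Frobenius reciprocity
(`frob_mem_hom_iff`) identifies Hom(α, β ⊗ γ) with Hom(γ̄, ᾱ ⊗ β), v ↦ F, and the twisted Choi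
matrix of the Clebsch–Gordan map of v is exactly F F^* (`twistedChoi_cgMap`).

Since ᾱ ⊗ β is multiplicity-free, Schur's lemma makes the F_j F_j^* positive multiples of mutually
orthogonal projections with sum 1 which span End(ᾱ ⊗ β) (`exists_orthogonal`,
`exists_eq_sum_of_mem_hom`). Hence the Φ_j are a basis of the covariant maps, and a combination is
completely positive exactly when its coefficients are nonnegative (`cpCov_eq`): the cone is
simplicial. A normalization that amounts to fixing the sum of the coefficients cuts out a simplex,
whose extreme points are its vertices (`extremePoints_simplex`).

For trace preservation in the Kac case this is clear, since each Φ_j is then an ordinary partial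
trace after an isometry. For unitality one needs Φ_j(1) = (d_α/d_β) 1. Irreducibility of β makes
Φ_j(1) a scalar x. Besides v^c, the operator (Q_β ⊗ Q_γ)⁻¹ v^c Q_α also intertwines α^c and (β ⊗
γ)^c, so multiplicity one makes it c v^c. Taking traces, with Tr Q = Tr Q⁻¹ for all three
representations, gives d_α = c x d_β and x d_β = c d_α, so that x d_β = d_α by positivity
(`ptrRight_mul_conjTranspose`). No Haar state enters.

The matrices Q_u are not assumed to exist: `qMatrix` is 0 when there is none. For α and γ_j
existence follows from the decomposition, because a zero conjugate could not occur in it. For β the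
matrix is built from an intertwiner α → β ⊗ γ_j by partial traces (`exists_isModular`), and for δ ≅
γ_j it is transported along the equivalence (`IsModular.of_equivalent`). -/

set_option linter.unusedSectionVars false

namespace CompactQuantumGroup

section Basic

variable {A : Type u} [CStarAlgebra A]
variable {k l m n : Type*} [Fintype k] [Fintype l] [Fintype m] [Fintype n]
  [DecidableEq k] [DecidableEq l] [DecidableEq m] [DecidableEq n]

/-! ### Scalar matrices -/

theorem scalar_mul (X : Matrix l m ℂ) (Y : Matrix m n ℂ) :
    scalar A (X * Y) = scalar A X * scalar A Y := by
  ext i j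
  simp [scalar, Matrix.mul_apply]

theorem scalar_one : scalar A (1 : Matrix n n ℂ) = 1 := by
  ext i j
  simp [scalar, Matrix.one_apply, apply_ite (algebraMap ℂ A)]

theorem scalar_zero : scalar A (0 : Matrix m n ℂ) = 0 := by
  ext i j
  simp [scalar]

theorem scalar_add (X Y : Matrix m n ℂ) : scalar A (X + Y) = scalar A X + scalar A Y := by
  ext i j
  simp [scalar]

theorem scalar_smul (c : ℂ) (X : Matrix m n ℂ) : scalar A (c • X) = c • scalar A X := by
  ext i j
  simp [scalar, Algebra.smul_def]

theorem scalar_sum {ι : Type*} (s : Finset ι) (X : ι → Matrix m n ℂ) :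
    scalar A (∑ i ∈ s, X i) = ∑ i ∈ s, scalar A (X i) := by
  ext i j
  simp [scalar, Matrix.sum_apply]

theorem scalar_conjTranspose (X : Matrix m n ℂ) : scalar A Xᴴ = (scalar A X)ᴴ := by
  ext i j
  exact algebraMap_star_comm (R := ℂ) (A := A) (X j i)

theorem transpose_mul_scalar (M : Matrix l m A) (X : Matrix m n ℂ) :
    (M * scalar A X)ᵀ = scalar A Xᵀ * Mᵀ := by
  ext i j
  simp only [scalar, Matrix.mul_apply, Matrix.transpose_apply, Matrix.map_apply]
  exact Finset.sum_congr rfl fun _ _ => (Algebra.commutes _ _).symm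

theorem transpose_scalar_mul (X : Matrix l m ℂ) (M : Matrix m n A) :
    (scalar A X * M)ᵀ = Mᵀ * scalar A Xᵀ := by
  ext i j
  simp only [scalar, Matrix.mul_apply, Matrix.transpose_apply, Matrix.map_apply]
  exact Finset.sum_congr rfl fun _ _ => Algebra.commutes _ _

theorem map_star_eq (M : Matrix m n A) : M.map star = Mᴴᵀ := rfl

theorem map_star_mul_scalar (M : Matrix l m A) (X : Matrix m n ℂ) :
    (M * scalar A X).map star = M.map star * scalar A (X.map star) := by
  rw [map_star_eq, Matrix.conjTranspose_mul, ← scalar_conjTranspose, transpose_scalar_mul]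
  rfl

theorem map_star_scalar_mul (X : Matrix l m ℂ) (M : Matrix m n A) :
    (scalar A X * M).map star = scalar A (X.map star) * M.map star := by
  rw [map_star_eq, Matrix.conjTranspose_mul, ← scalar_conjTranspose, transpose_mul_scalar]
  rfl

theorem map_star_map_star {R : Type*} [InvolutiveStar R] (M : Matrix m n R) :
    (M.map star).map star = M := by
  ext; simp

theorem map_star_mul (X : Matrix l m ℂ) (Y : Matrix m n ℂ) :
    (X * Y).map star = X.map star * Y.map star := by
  ext i j
  simp [Matrix.mul_apply]

/-! ### Tensor products -/

/-- The order of the two factors matters, because the entries of `u` and `w` need not commute. A leg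
can be moved past the other one only if one of them is scalar (`tensor_one_comm_scalar`,
`tensor_right_comm_scalar`). -/
theorem tensor_eq_mul (u : Matrix n n A) (w : Matrix m m A) :
    tensor u w = tensor u 1 * tensor 1 w := by
  ext ⟨i, k⟩ ⟨j, l⟩
  simp [tensor, Matrix.mul_apply, Fintype.sum_prod_type, Matrix.one_apply]

theorem tensor_one_left_mul (w w' : Matrix m m A) :
    tensor (1 : Matrix n n A) (w * w') = tensor 1 w * tensor 1 w' := by
  ext ⟨i, k⟩ ⟨j, l⟩
  simp only [tensor, Matrix.kroneckerMap_apply, Matrix.one_apply, Matrix.mul_apply, ite_mul,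
    one_mul, zero_mul, mul_ite, mul_zero, Fintype.sum_prod_type]
  rw [Finset.sum_comm]
  simp [Finset.sum_ite_irrel]

theorem tensor_one_right_mul (w w' : Matrix m m A) :
    tensor (w * w') (1 : Matrix n n A) = tensor w 1 * tensor w' 1 := by
  ext ⟨i, k⟩ ⟨j, l⟩
  simp [tensor, Matrix.mul_apply, Fintype.sum_prod_type, Matrix.one_apply, Finset.sum_ite_irrel]

theorem tensor_one_one : tensor (1 : Matrix n n A) (1 : Matrix m m A) = 1 := by
  ext ⟨i, k⟩ ⟨j, l⟩
  by_cases h : i = j <;> by_cases h' : k = l <;> simp [tensor, Matrix.one_apply, h, h']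

theorem tensor_one_left_conjTranspose (w : Matrix m m A) :
    (tensor (1 : Matrix n n A) w)ᴴ = tensor 1 wᴴ := by
  ext ⟨i, k⟩ ⟨j, l⟩
  simp [tensor, Matrix.one_apply, eq_comm, apply_ite star]

theorem tensor_one_right_conjTranspose (w : Matrix m m A) :
    (tensor w (1 : Matrix n n A))ᴴ = tensor wᴴ 1 := by
  ext ⟨i, k⟩ ⟨j, l⟩
  simp [tensor, Matrix.one_apply, eq_comm, apply_ite star]

theorem tensor_scalar_left (X : Matrix n n ℂ) :
    tensor (scalar A X) (1 : Matrix m m A) = scalar A (Matrix.kronecker X (1 : Matrix m m ℂ)) := by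
  ext ⟨i, k⟩ ⟨j, l⟩
  simp [tensor, scalar, Matrix.one_apply, apply_ite (algebraMap ℂ A)]

theorem tensor_one_comm_scalar (w : Matrix m m A) (X : Matrix n n ℂ) :
    tensor 1 w * tensor (scalar A X) 1 = tensor (scalar A X) 1 * tensor 1 w := by
  ext ⟨i, k⟩ ⟨j, l⟩
  simp [tensor, scalar, Matrix.mul_apply, Fintype.sum_prod_type, Matrix.one_apply,
    Algebra.commutes]

theorem tensor_mem_unitary {u : Matrix n n A} {w : Matrix m m A} (hu : u ∈ unitary (Matrix n n A))
    (hw : w ∈ unitary (Matrix m m A)) : tensor u w ∈ unitary (Matrix (n × m) (n × m) A) := by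
  rw [Unitary.mem_iff, Matrix.star_eq_conjTranspose] at *
  rw [tensor_eq_mul, Matrix.conjTranspose_mul, tensor_one_left_conjTranspose,
    tensor_one_right_conjTranspose]
  constructor
  · rw [mul_assoc, ← mul_assoc (tensor uᴴ 1), ← tensor_one_right_mul, hu.1, tensor_one_one, one_mul,
      ← tensor_one_left_mul, hw.1, tensor_one_one]
  · rw [mul_assoc, ← mul_assoc (tensor 1 w), ← tensor_one_left_mul, hw.2, tensor_one_one, one_mul,
      ← tensor_one_right_mul, hu.2, tensor_one_one]

/-! ### Intertwiners -/

theorem mul_mem_hom {u : Matrix n n A} {v : Matrix m m A} {w : Matrix l l A} {X : Matrix l m ℂ}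
    {Y : Matrix m n ℂ} (hX : X ∈ Hom v w) (hY : Y ∈ Hom u v) : X * Y ∈ Hom u w := by
  simp only [Hom, Set.mem_ofPred_eq] at *
  rw [scalar_mul, ← Matrix.mul_assoc, hX, Matrix.mul_assoc, hY, Matrix.mul_assoc]

theorem one_mem_hom (u : Matrix n n A) : (1 : Matrix n n ℂ) ∈ Hom u u := by
  simp [Hom, scalar_one]

theorem smul_mem_hom {u : Matrix n n A} {v : Matrix m m A} {X : Matrix m n ℂ} (c : ℂ)
    (hX : X ∈ Hom u v) : c • X ∈ Hom u v := by
  simp only [Hom, Set.mem_ofPred_eq] at *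
  rw [scalar_smul, Matrix.mul_smul, hX, Matrix.smul_mul]

theorem conjTranspose_mem_hom {u : Matrix n n A} {v : Matrix m m A} {X : Matrix m n ℂ}
    (hu : u ∈ unitary (Matrix n n A)) (hv : v ∈ unitary (Matrix m m A)) (hX : X ∈ Hom u v) :
    Xᴴ ∈ Hom v u := by
  simp only [Hom, Set.mem_ofPred_eq] at *
  have h := congrArg Matrix.conjTranspose hX
  rw [Matrix.conjTranspose_mul, Matrix.conjTranspose_mul, ← scalar_conjTranspose] at h
  have h1 : u * uᴴ = 1 := (Unitary.mem_iff.1 hu).2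
  have h2 : vᴴ * v = 1 := (Unitary.mem_iff.1 hv).1
  calc u * scalar A Xᴴ = u * (scalar A Xᴴ * vᴴ) * v := by
        rw [Matrix.mul_assoc, Matrix.mul_assoc (scalar A Xᴴ), h2, Matrix.mul_one]
    _ = scalar A Xᴴ * v := by rw [h, ← Matrix.mul_assoc, h1, Matrix.one_mul]

theorem inv_mem_hom {u : Matrix n n A} {v : Matrix m m A} {X : Matrix m n ℂ} {Y : Matrix n m ℂ}
    (hX : X ∈ Hom u v) (h1 : Y * X = 1) (h2 : X * Y = 1) : Y ∈ Hom v u := by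
  simp only [Hom, Set.mem_ofPred_eq] at *
  calc u * scalar A Y = scalar A (Y * X) * u * scalar A Y := by rw [h1, scalar_one, Matrix.one_mul]
    _ = scalar A Y * v * scalar A (X * Y) := by
      rw [scalar_mul, Matrix.mul_assoc (scalar A Y), ← hX, scalar_mul]; simp only [Matrix.mul_assoc]
    _ = _ := by rw [h2, scalar_one, Matrix.mul_one]

theorem Equivalent.symm {u : Matrix n n A} {v : Matrix m m A} (h : Equivalent u v) :
    Equivalent v u := by
  obtain ⟨X, hX, Y, h1, h2⟩ := h
  exact ⟨Y, inv_mem_hom hX h1 h2, X, h2, h1⟩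

theorem Equivalent.trans {u : Matrix n n A} {v : Matrix m m A} {w : Matrix l l A}
    (h : Equivalent u v) (h' : Equivalent v w) : Equivalent u w := by
  obtain ⟨X, hX, Y, h1, h2⟩ := h
  obtain ⟨X', hX', Y', h1', h2'⟩ := h'
  refine ⟨X' * X, mul_mem_hom hX' hX, Y * Y', ?_, ?_⟩
  · rw [Matrix.mul_assoc, ← Matrix.mul_assoc Y', h1', Matrix.one_mul, h1]
  · rw [Matrix.mul_assoc, ← Matrix.mul_assoc X, h2, Matrix.one_mul, h2']

theorem map_star_mem_hom {u : Matrix n n A} {v : Matrix m m A} {X : Matrix m n ℂ}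
    (hX : X ∈ Hom u v) : X.map star ∈ Hom (contragredient u) (contragredient v) := by
  simp only [Hom, Set.mem_ofPred_eq, contragredient] at *
  rw [← map_star_mul_scalar, hX, map_star_scalar_mul]

theorem contragredient_contragredient (u : Matrix n n A) : contragredient (contragredient u) = u :=
  map_star_map_star u

theorem mem_hom_of_map_star {u : Matrix n n A} {v : Matrix m m A} {X : Matrix m n ℂ}
    (hX : X ∈ Hom (contragredient u) (contragredient v)) : X.map star ∈ Hom u v := by
  have := map_star_mem_hom hX
  rwa [contragredient_contragredient, contragredient_contragredient] at this

theorem Equivalent.contragredient {u : Matrix n n A} {v : Matrix m m A} (h : Equivalent u v) :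
    Equivalent (contragredient u) (contragredient v) := by
  obtain ⟨X, hX, Y, h1, h2⟩ := h
  refine ⟨_, map_star_mem_hom hX, Y.map star, ?_, ?_⟩
  · rw [← map_star_mul, h1]; exact Matrix.map_one _ (by simp) (by simp)
  · rw [← map_star_mul, h2]; exact Matrix.map_one _ (by simp) (by simp)

/-! ### Schur's lemma -/

theorem smul_one_injective [Nonempty n] {c d : ℂ} (h : c • (1 : Matrix n n ℂ) = d • 1) :
    c = d := by
  obtain ⟨i⟩ := ‹Nonempty n›
  simpa using congrFun (congrFun h i) i

theorem pos_of_conjTranspose_mul_self_eq [Nonempty n] {X : Matrix m n ℂ} {c : ℂ} (hX : X ≠ 0)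
    (h : Xᴴ * X = c • 1) : 0 < c := by
  obtain ⟨i⟩ := ‹Nonempty n›
  have h1 : 0 ≤ c := by
    have := (Matrix.posSemidef_conjTranspose_mul_self X).diag_nonneg (i := i)
    rw [h] at this
    simpa using this
  refine lt_of_le_of_ne h1 fun h2 => hX ?_
  rw [← h2, zero_smul] at h
  exact Matrix.conjTranspose_mul_self_eq_zero.1 h

variable {G : CompactQuantumGroup A}

/-- X^* X is a self-intertwiner of the irreducible `u`, hence scalar, and the scalar is positive as
X ≠ 0. Thus a nonzero intertwiner out of an irreducible is a multiple of an isometry; `v` need not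
be irreducible. -/
theorem IsIrrep.exists_conjTranspose_mul_self {u : Matrix n n A} {v : Matrix m m A}
    (hu : G.IsIrrep u) (hv : v ∈ unitary (Matrix m m A)) {X : Matrix m n ℂ} (hX : X ∈ Hom u v)
    (h0 : X ≠ 0) : ∃ c : ℂ, 0 < c ∧ Xᴴ * X = c • 1 := by
  obtain ⟨c, hc⟩ := hu.2.2 _ (mul_mem_hom (conjTranspose_mem_hom hu.1.2 hv hX) hX)
  have := hu.2.1
  exact ⟨c, pos_of_conjTranspose_mul_self_eq h0 hc, hc⟩

/-- Both X^* X and X X^* are scalars, and evaluating X X^* X in two ways shows that the scalars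
agree. -/
theorem IsIrrep.equivalent_of_ne_zero {u : Matrix n n A} {v : Matrix m m A}
    (hu : G.IsIrrep u) (hv : G.IsIrrep v) {X : Matrix m n ℂ} (hX : X ∈ Hom u v)
    (h0 : X ≠ 0) : ∃ c : ℂ, 0 < c ∧ Xᴴ * X = c • 1 ∧ X * Xᴴ = c • 1 := by
  obtain ⟨c, hc, h1⟩ := hu.exists_conjTranspose_mul_self hv.1.2 hX h0
  obtain ⟨d, hd, h2⟩ := hv.exists_conjTranspose_mul_self hu.1.2
    (conjTranspose_mem_hom hu.1.2 hv.1.2 hX) (by simpa using h0)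
  rw [Matrix.conjTranspose_conjTranspose] at h2
  have h3 : c • X = d • X := by
    calc c • X = X * (Xᴴ * X) := by rw [h1, Matrix.mul_smul, Matrix.mul_one]
      _ = d • X := by rw [← Matrix.mul_assoc, h2, Matrix.smul_mul, Matrix.one_mul]
  have h4 : c = d := smul_left_injective ℂ h0 h3
  exact ⟨c, hc, h1, h4 ▸ h2⟩

theorem IsIrrep.equivalent {u : Matrix n n A} {v : Matrix m m A}
    (hu : G.IsIrrep u) (hv : G.IsIrrep v) {X : Matrix m n ℂ} (hX : X ∈ Hom u v)
    (h0 : X ≠ 0) : Equivalent u v := by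
  obtain ⟨c, hc, h1, h2⟩ := hu.equivalent_of_ne_zero hv hX h0
  refine ⟨X, hX, c⁻¹ • Xᴴ, ?_, ?_⟩
  · rw [Matrix.smul_mul, h1, smul_smul, inv_mul_cancel₀ hc.ne', one_smul]
  · rw [Matrix.mul_smul, h2, smul_smul, inv_mul_cancel₀ hc.ne', one_smul]

end Basic

end CompactQuantumGroup

namespace CompactQuantumGroup

section Modular

variable {A : Type u} [CStarAlgebra A]
variable {k l m n : Type*} [Fintype k] [Fintype l] [Fintype m] [Fintype n]
  [DecidableEq k] [DecidableEq l] [DecidableEq m] [DecidableEq n]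

/-! ### The square root of a positive definite matrix -/

section Sqrt

variable {Q : Matrix n n ℂ} (hQ : Q.PosDef)
include hQ

theorem sqrt_mul_sqrt : CFC.sqrt Q * CFC.sqrt Q = Q :=
  CFC.sqrt_mul_sqrt_self Q (Matrix.nonneg_iff_posSemidef.2 hQ.posSemidef)

theorem sqrt_conjTranspose : (CFC.sqrt Q)ᴴ = CFC.sqrt Q :=
  (Matrix.nonneg_iff_posSemidef.1 (CFC.sqrt_nonneg Q)).isHermitian

theorem isUnit_sqrt : IsUnit (CFC.sqrt Q) := by
  have h := hQ.isUnit
  rw [← sqrt_mul_sqrt hQ, Matrix.isUnit_iff_isUnit_det, Matrix.det_mul] at h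
  exact (Matrix.isUnit_iff_isUnit_det _).2 (isUnit_of_mul_isUnit_left h)

theorem sqrt_mul_inv : CFC.sqrt Q * (CFC.sqrt Q)⁻¹ = 1 :=
  Matrix.mul_nonsing_inv _ ((Matrix.isUnit_iff_isUnit_det _).1 (isUnit_sqrt hQ))

theorem inv_mul_sqrt : (CFC.sqrt Q)⁻¹ * CFC.sqrt Q = 1 :=
  Matrix.nonsing_inv_mul _ ((Matrix.isUnit_iff_isUnit_det _).1 (isUnit_sqrt hQ))

theorem inv_sqrt_conjTranspose : ((CFC.sqrt Q)⁻¹)ᴴ = (CFC.sqrt Q)⁻¹ := by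
  rw [Matrix.conjTranspose_nonsing_inv, sqrt_conjTranspose hQ]

theorem inv_sqrt_mul_inv_sqrt : (CFC.sqrt Q)⁻¹ * (CFC.sqrt Q)⁻¹ = Q⁻¹ := by
  rw [← Matrix.mul_inv_rev, sqrt_mul_sqrt hQ]

theorem posDef_mul_inv : Q * Q⁻¹ = 1 :=
  Matrix.mul_nonsing_inv _ ((Matrix.isUnit_iff_isUnit_det _).1 hQ.isUnit)

theorem posDef_inv_mul : Q⁻¹ * Q = 1 :=
  Matrix.nonsing_inv_mul _ ((Matrix.isUnit_iff_isUnit_det _).1 hQ.isUnit)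

end Sqrt

/-! ### Representations -/

/-- The embedding `a ↦ a ⊗ 1`. -/
noncomputable def leftLeg (A : Type u) [CStarAlgebra A] : A →ₐ[ℂ] MinTensor A A :=
  AlgHom.ofLinearMap ((MinTensor.ofₗ A A).comp ((TensorProduct.mk ℂ A A).flip 1)) rfl fun a b => by
    change MinTensor.of _ = MinTensor.of _ * MinTensor.of _
    rw [← MinTensor.of_mul]
    simp

/-- The embedding `a ↦ 1 ⊗ a`. -/
noncomputable def rightLeg (A : Type u) [CStarAlgebra A] : A →ₐ[ℂ] MinTensor A A :=
  AlgHom.ofLinearMap ((MinTensor.ofₗ A A).comp (TensorProduct.mk ℂ A A 1)) rfl fun a b => by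
    change MinTensor.of _ = MinTensor.of _ * MinTensor.of _
    rw [← MinTensor.of_mul]
    simp

theorem leftLeg_mul_rightLeg (a b : A) : leftLeg A a * rightLeg A b = MinTensor.tmul a b := by
  change MinTensor.of _ * MinTensor.of _ = MinTensor.of _
  rw [← MinTensor.of_mul]
  simp

theorem star_tmul (a b : A) :
    star (MinTensor.tmul a b) = MinTensor.tmul (star a) (star b) := by
  rw [MinTensor.tmul, ← MinTensor.of_star, TensorProduct.star_tmul]
  rfl

variable {G : CompactQuantumGroup A}

/-- Leg notation: (id ⊗ Δ)(v) = v₁₂ v₁₃ as one identity of matrices over A ⊗ A, which makes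
conjugation and compression by scalar matrices purely algebraic. -/
theorem comul_apply_iff {v : Matrix n n A} :
    (∀ i j, G.comul (v i j) = ∑ k, MinTensor.tmul (v i k) (v k j)) ↔
      v.map G.comul = v.map (leftLeg A) * v.map (rightLeg A) := by
  simp only [← Matrix.ext_iff, Matrix.map_apply, Matrix.mul_apply, leftLeg_mul_rightLeg]

theorem comul_contragredient {v : Matrix n n A}
    (hv : ∀ i j, G.comul (v i j) = ∑ k, MinTensor.tmul (v i k) (v k j)) (i j : n) :
    G.comul (contragredient v i j)
      = ∑ k, MinTensor.tmul (contragredient v i k) (contragredient v k j) := by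
  simp only [contragredient, Matrix.map_apply, map_star, hv, star_sum, star_tmul]

theorem map_scalar {B : Type*} [Ring B] [Algebra ℂ B] {F : Type*} [FunLike F A B]
    [AlgHomClass F ℂ A B] (f : F) (X : Matrix m n ℂ) :
    (scalar A X).map f = X.map (algebraMap ℂ B) := by
  ext i j
  exact AlgHomClass.commutes f (X i j)

/-- Insert Y X = 1 between v₁₂ and v₁₃: X v₁₂ v₁₃ Y = (X v Y)₁₂ (X v Y)₁₃. -/
theorem comul_conj {v : Matrix n n A} {X : Matrix m n ℂ} {Y : Matrix n m ℂ} (h : Y * X = 1)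
    (hv : ∀ i j, G.comul (v i j) = ∑ k, MinTensor.tmul (v i k) (v k j)) (i j : m) :
    G.comul ((scalar A X * v * scalar A Y) i j)
      = ∑ k, MinTensor.tmul ((scalar A X * v * scalar A Y) i k)
        ((scalar A X * v * scalar A Y) k j) := by
  revert i j
  rw [comul_apply_iff] at hv ⊢
  have h' : Y.map (algebraMap ℂ (MinTensor A A)) * X.map (algebraMap ℂ (MinTensor A A)) = 1 := by
    refine (Matrix.map_mul (f := algebraMap ℂ (MinTensor A A))).symm.trans ?_
    rw [h]
    exact Matrix.map_one _ (map_zero _) (map_one _)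
  have e : ∀ {B : Type u} [CStarAlgebra B] (f : A →ₐ[ℂ] B), (scalar A X * v * scalar A Y).map f
      = X.map (algebraMap ℂ B) * v.map f * Y.map (algebraMap ℂ B) := fun f => by
    rw [← map_scalar f, ← map_scalar f, ← Matrix.map_mul, ← Matrix.map_mul]
  have e' := e (G.comul : A →ₐ[ℂ] MinTensor A A)
  refine e'.trans ?_
  rw [e, e]
  refine (congrArg (fun M => X.map (algebraMap ℂ (MinTensor A A)) * M
    * Y.map (algebraMap ℂ (MinTensor A A))) hv).trans ?_
  simp only [Matrix.mul_assoc]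
  rw [← Matrix.mul_assoc (Y.map _) (X.map _), h', Matrix.one_mul]

/-- A unitary matrix compatible with the comultiplication is a unitary representation. -/
theorem isUnitaryRep_of_mem_unitary {v : Matrix n n A} (h : v ∈ unitary (Matrix n n A))
    (hc : ∀ i j, G.comul (v i j) = ∑ k, MinTensor.tmul (v i k) (v k j)) : G.IsUnitaryRep v :=
  ⟨⟨⟨⟨v, star v, (Unitary.mem_iff.1 h).2, (Unitary.mem_iff.1 h).1⟩, rfl⟩, hc⟩, h⟩

/-! ### Matrices which unitarize the contragredient -/

/-- `Q` is positive definite and `Q^{1/2} u^c Q^{-1/2}` is unitary. -/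
structure IsModular (v : Matrix n n A) (Q : Matrix n n ℂ) : Prop where
  posDef : Q.PosDef
  left : vᵀ * scalar A Q * v.map star = scalar A Q
  right : v.map star * scalar A Q⁻¹ * vᵀ = scalar A Q⁻¹

theorem conjTranspose_map_star (v : Matrix m n A) : (v.map star)ᴴ = vᵀ := by
  ext; simp

/-- `left` says that Q^{1/2} v^c Q^{-1/2} is an isometry and `right` that it is a coisometry. Over a
general C⋆-algebra a one-sided inverse of a matrix need not be two-sided, so both relations are
kept. This form avoids square roots. -/
theorem isModular_iff {v : Matrix n n A} {Q : Matrix n n ℂ} (hQ : Q.PosDef) :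
    IsModular v Q ↔ conjBy Q v ∈ unitary (Matrix n n A) := by
  set S := CFC.sqrt Q with hS
  have h1 : scalar A S * scalar A S = scalar A Q := by rw [← scalar_mul, sqrt_mul_sqrt hQ]
  have h2 : scalar A S⁻¹ * scalar A S⁻¹ = scalar A Q⁻¹ := by
    rw [← scalar_mul, inv_sqrt_mul_inv_sqrt hQ]
  have h3 : scalar A S * scalar A S⁻¹ = 1 := by rw [← scalar_mul, sqrt_mul_inv hQ, scalar_one]
  have h4 : scalar A S⁻¹ * scalar A S = 1 := by rw [← scalar_mul, inv_mul_sqrt hQ, scalar_one]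
  have e : (conjBy Q v)ᴴ = scalar A S⁻¹ * vᵀ * scalar A S := by
    rw [conjBy, Matrix.conjTranspose_mul, Matrix.conjTranspose_mul, ← scalar_conjTranspose,
      ← scalar_conjTranspose, inv_sqrt_conjTranspose hQ, sqrt_conjTranspose hQ, contragredient,
      conjTranspose_map_star, Matrix.mul_assoc]
  have e1 : (conjBy Q v)ᴴ * conjBy Q v
      = scalar A S⁻¹ * (vᵀ * scalar A Q * v.map star) * scalar A S⁻¹ := by
    rw [e, conjBy, contragredient, ← h1]
    simp only [Matrix.mul_assoc, hS]
  have e2 : conjBy Q v * (conjBy Q v)ᴴ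
      = scalar A S * (v.map star * scalar A Q⁻¹ * vᵀ) * scalar A S := by
    rw [e, conjBy, contragredient, ← h2]
    simp only [Matrix.mul_assoc, hS]
  have a1 : scalar A S⁻¹ * scalar A Q * scalar A S⁻¹ = 1 := by
    rw [← h1, ← Matrix.mul_assoc, h4, Matrix.one_mul, h3]
  have a2 : scalar A S * scalar A Q⁻¹ * scalar A S = 1 := by
    rw [← h2, ← Matrix.mul_assoc, h3, Matrix.one_mul, h4]
  rw [Unitary.mem_iff, Matrix.star_eq_conjTranspose, e1, e2]
  refine ⟨fun h => ⟨by rw [h.left, a1], by rw [h.right, a2]⟩, fun h => ⟨hQ, ?_, ?_⟩⟩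
  · have := congrArg (fun M => scalar A S * M * scalar A S) h.1
    simp only [Matrix.mul_one, h1] at this
    refine Eq.trans ?_ this
    simp only [Matrix.mul_assoc, h4, Matrix.mul_one]
    simp only [← Matrix.mul_assoc, h3, Matrix.one_mul]
  · have := congrArg (fun M => scalar A S⁻¹ * M * scalar A S⁻¹) h.2
    simp only [Matrix.mul_one, h2] at this
    refine Eq.trans ?_ this
    simp only [Matrix.mul_assoc, h3, Matrix.mul_one]
    simp only [← Matrix.mul_assoc, h4, Matrix.one_mul]

theorem IsQMatrix.isModular {v : Matrix n n A} {Q : Matrix n n ℂ} (h : G.IsQMatrix v Q) :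
    IsModular v Q :=
  (isModular_iff h.posDef).2 h.isUnitaryRep.2

theorem IsModular.isUnitaryRep_conjBy {v : Matrix n n A} {Q : Matrix n n ℂ} (h : IsModular v Q)
    (hv : G.IsUnitaryRep v) : G.IsUnitaryRep (conjBy Q v) :=
  isUnitaryRep_of_mem_unitary ((isModular_iff h.posDef).1 h)
    (comul_conj (inv_mul_sqrt h.posDef) (comul_contragredient hv.1.2))

theorem IsModular.smul {v : Matrix n n A} {Q : Matrix n n ℂ} (h : IsModular v Q) {t : ℝ}
    (ht : 0 < t) : IsModular v (t • Q) := by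
  have ht' : (t : ℂ) ≠ 0 := by exact_mod_cast ht.ne'
  have e : (t • Q)⁻¹ = (t : ℂ)⁻¹ • Q⁻¹ := by
    refine Matrix.inv_eq_left_inv ?_
    rw [← Complex.coe_smul, Matrix.smul_mul, Matrix.mul_smul, smul_smul, posDef_inv_mul h.posDef,
      inv_mul_cancel₀ ht', one_smul]
  refine ⟨h.posDef.smul ht, ?_, ?_⟩
  · rw [← Complex.coe_smul, scalar_smul, Matrix.mul_smul, Matrix.smul_mul, h.left]
  · rw [e, scalar_smul, Matrix.mul_smul, Matrix.smul_mul, h.right]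

theorem IsIrrep.eq_smul_one_of_mem_hom_contragredient {v : Matrix n n A} (hv : G.IsIrrep v)
    {X : Matrix n n ℂ} (hX : X ∈ Hom (contragredient v) (contragredient v)) :
    ∃ c : ℂ, X = c • (1 : Matrix n n ℂ) := by
  obtain ⟨c, hc⟩ := hv.2.2 _ (mem_hom_of_map_star hX)
  refine ⟨star c, ?_⟩
  rw [← map_star_map_star X, hc]
  ext i j
  by_cases h : i = j <;> simp [h]

theorem IsIrrep.of_equivalent_contragredient {v : Matrix n n A} (hv : G.IsIrrep v)
    {w : Matrix m m A} (h : Equivalent (contragredient v) w) (hw : G.IsUnitaryRep w) :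
    G.IsIrrep w := by
  obtain ⟨X, hX, Y, h1, h2⟩ := h
  have hY := inv_mem_hom hX h1 h2
  refine ⟨hw, ?_, fun Z hZ => ?_⟩
  · by_contra hm
    rw [not_nonempty_iff] at hm
    obtain ⟨i⟩ := hv.2.1
    have := congrFun (congrFun h1 i) i
    simp [Matrix.mul_apply] at this
  · obtain ⟨c, hc⟩ := hv.eq_smul_one_of_mem_hom_contragredient (mul_mem_hom hY (mul_mem_hom hZ hX))
    refine ⟨c, ?_⟩
    calc Z = X * Y * Z * (X * Y) := by rw [h2, Matrix.one_mul, Matrix.mul_one]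
      _ = X * (Y * (Z * X)) * Y := by simp only [Matrix.mul_assoc]
      _ = c • 1 := by rw [hc, Matrix.mul_smul, Matrix.smul_mul, Matrix.mul_one, h2]

theorem equivalent_conjBy {Q : Matrix n n ℂ} (hQ : Q.PosDef) (v : Matrix n n A) :
    Equivalent (contragredient v) (conjBy Q v) := by
  refine ⟨CFC.sqrt Q, ?_, (CFC.sqrt Q)⁻¹, inv_mul_sqrt hQ, sqrt_mul_inv hQ⟩
  simp only [Hom, Set.mem_ofPred_eq, conjBy]
  rw [Matrix.mul_assoc, ← scalar_mul, inv_mul_sqrt hQ, scalar_one, Matrix.mul_one]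

/-- The relations of `IsModular` are invariant under positive scaling, and for irreducible `v` the
trace condition only has to be tested on scalars. So it suffices to rescale Q until its trace equals
that of its inverse. -/
theorem IsIrrep.exists_isQMatrix {v : Matrix n n A} (hv : G.IsIrrep v) {Q : Matrix n n ℂ}
    (h : IsModular v Q) : ∃ Q', G.IsQMatrix v Q' := by
  have := hv.2.1
  obtain ⟨p, hp⟩ : ∃ p : ℝ, (p : ℂ) = Q.trace := ⟨_, (Complex.eq_re_of_ofReal_le
    (r := 0) (by simpa using h.posDef.trace_pos.le)).symm⟩
  obtain ⟨q, hq⟩ : ∃ q : ℝ, (q : ℂ) = (Q⁻¹).trace := ⟨_, (Complex.eq_re_of_ofReal_le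
    (r := 0) (by simpa using h.posDef.inv.trace_pos.le)).symm⟩
  have hp0 : 0 < p := by have := h.posDef.trace_pos; rw [← hp] at this; exact_mod_cast this
  have hq0 : 0 < q := by have := h.posDef.inv.trace_pos; rw [← hq] at this; exact_mod_cast this
  -- The solution of t · Tr Q = t⁻¹ · Tr Q⁻¹.
  set t := √(q / p) with ht
  have ht0 : 0 < t := Real.sqrt_pos.2 (div_pos hq0 hp0)
  have htt : t * t = q / p := Real.mul_self_sqrt (div_pos hq0 hp0).le
  have hm := h.smul ht0
  refine ⟨t • Q, hm.posDef, hm.isUnitaryRep_conjBy hv.1, fun X hX => ?_⟩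
  obtain ⟨c, rfl⟩ := hv.eq_smul_one_of_mem_hom_contragredient hX
  have e : (t • Q)⁻¹ = (t : ℂ)⁻¹ • Q⁻¹ := by
    refine Matrix.inv_eq_left_inv ?_
    rw [← Complex.coe_smul, Matrix.smul_mul, Matrix.mul_smul, smul_smul, posDef_inv_mul h.posDef,
      inv_mul_cancel₀ (by exact_mod_cast ht0.ne'), one_smul]
  rw [e, ← Complex.coe_smul]
  simp only [Matrix.mul_smul, Matrix.mul_one, Matrix.trace_smul, ← hp, ← hq]
  have : t * p = t⁻¹ * q := by
    field_simp
    rw [pow_two, htt]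
    field_simp
  congr 1
  simp only [smul_eq_mul]
  exact_mod_cast this

theorem isQMatrix_qMatrix {v : Matrix n n A} (h : ∃ Q, G.IsQMatrix v Q) :
    G.IsQMatrix v (G.qMatrix v) := by
  rw [qMatrix, dif_pos h]
  exact h.choose_spec

/-- The default value 0 of `qMatrix` forces the conjugate to be 0, since √0 = 0. A nonzero conjugate
therefore certifies that Q_v exists. -/
theorem isQMatrix_of_conj_ne_zero {v : Matrix n n A} (h : G.conj v ≠ 0) :
    G.IsQMatrix v (G.qMatrix v) := by
  refine isQMatrix_qMatrix ?_
  by_contra h'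
  refine h ?_
  rw [conj, qMatrix, dif_neg h', conjBy, CFC.sqrt_zero, scalar_zero, Matrix.zero_mul,
    Matrix.zero_mul]

theorem IsIrrep.conj {v : Matrix n n A} (hv : G.IsIrrep v) (h : G.IsQMatrix v (G.qMatrix v)) :
    G.IsIrrep (G.conj v) :=
  hv.of_equivalent_contragredient (equivalent_conjBy h.posDef v) h.isUnitaryRep

theorem IsIrrep.ne_zero [Nontrivial A] {v : Matrix n n A} (hv : G.IsIrrep v) : v ≠ 0 := by
  rintro rfl
  obtain ⟨i⟩ := hv.2.1
  have := congrFun (congrFun (Unitary.mem_iff.1 hv.1.2).1 i) i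
  simp at this

theorem trace_qMatrix {v : Matrix n n A} (h : G.IsQMatrix v (G.qMatrix v)) :
    (G.qMatrix v).trace = (G.qMatrix v)⁻¹.trace := by
  simpa using h.trace_eq 1 (one_mem_hom _)

end Modular

end CompactQuantumGroup

namespace CompactQuantumGroup

section Frobenius

variable {A : Type u} [CStarAlgebra A]
variable {k l m n : Type*} [Fintype k] [Fintype l] [Fintype m] [Fintype n]
  [DecidableEq k] [DecidableEq l] [DecidableEq m] [DecidableEq n]

/-! ### Frobenius reciprocity -/

/-- The inverse `Q u^c Q⁻¹` of the transpose of `u`. -/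
noncomputable def dual (Q : Matrix n n ℂ) (v : Matrix n n A) : Matrix n n A :=
  scalar A Q * contragredient v * scalar A Q⁻¹

theorem IsModular.transpose_mul_dual {v : Matrix n n A} {Q : Matrix n n ℂ} (h : IsModular v Q) :
    vᵀ * dual Q v = 1 := by
  rw [dual, ← Matrix.mul_assoc, ← Matrix.mul_assoc, contragredient, h.left, ← scalar_mul,
    posDef_mul_inv h.posDef, scalar_one]

theorem IsModular.dual_mul_transpose {v : Matrix n n A} {Q : Matrix n n ℂ} (h : IsModular v Q) :
    dual Q v * vᵀ = 1 := by
  rw [dual, Matrix.mul_assoc, Matrix.mul_assoc, ← Matrix.mul_assoc (contragredient v),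
    contragredient, h.right, ← scalar_mul, posDef_mul_inv h.posDef, scalar_one]

theorem sqrt_mul_conjBy {Q : Matrix n n ℂ} (hQ : Q.PosDef) (v : Matrix n n A) :
    scalar A (CFC.sqrt Q) * conjBy Q v = dual Q v * scalar A (CFC.sqrt Q) := by
  have h1 : scalar A (CFC.sqrt Q) * scalar A (CFC.sqrt Q) = scalar A Q := by
    rw [← scalar_mul, sqrt_mul_sqrt hQ]
  have h2 : scalar A Q⁻¹ * scalar A (CFC.sqrt Q) = scalar A (CFC.sqrt Q)⁻¹ := by
    rw [← scalar_mul, ← inv_sqrt_mul_inv_sqrt hQ, Matrix.mul_assoc, inv_mul_sqrt hQ,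
      Matrix.mul_one]
  rw [conjBy, dual, ← Matrix.mul_assoc, ← Matrix.mul_assoc, h1, Matrix.mul_assoc (_ * _), h2]

theorem conjBy_mul_inv_sqrt {Q : Matrix n n ℂ} (hQ : Q.PosDef) (v : Matrix n n A) :
    conjBy Q v * scalar A (CFC.sqrt Q)⁻¹ = scalar A (CFC.sqrt Q)⁻¹ * dual Q v := by
  have h1 : scalar A (CFC.sqrt Q)⁻¹ * scalar A (CFC.sqrt Q) = 1 := by
    rw [← scalar_mul, inv_mul_sqrt hQ, scalar_one]
  have h2 : scalar A (CFC.sqrt Q) * scalar A (CFC.sqrt Q)⁻¹ = 1 := by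
    rw [← scalar_mul, sqrt_mul_inv hQ, scalar_one]
  calc conjBy Q v * scalar A (CFC.sqrt Q)⁻¹
      = scalar A (CFC.sqrt Q)⁻¹ * (scalar A (CFC.sqrt Q) * conjBy Q v)
        * scalar A (CFC.sqrt Q)⁻¹ := by rw [← Matrix.mul_assoc, h1, Matrix.one_mul]
    _ = _ := by
      rw [sqrt_mul_conjBy hQ, Matrix.mul_assoc, Matrix.mul_assoc, h2, Matrix.mul_one]

theorem inv_sqrt_mul_conjBy {Q : Matrix n n ℂ} (hQ : Q.PosDef) (v : Matrix n n A) :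
    scalar A (CFC.sqrt Q)⁻¹ * conjBy Q v = contragredient v * scalar A (CFC.sqrt Q)⁻¹ := by
  have h1 : scalar A (CFC.sqrt Q)⁻¹ * scalar A (CFC.sqrt Q) = 1 := by
    rw [← scalar_mul, inv_mul_sqrt hQ, scalar_one]
  rw [conjBy, ← Matrix.mul_assoc, ← Matrix.mul_assoc, h1, Matrix.one_mul]

/-- The operator `Q^{-1/2} ⊗ 1`. -/
noncomputable def invSqrtLeft (m : Type*) [DecidableEq m] (Q : Matrix n n ℂ) :
    Matrix (n × m) (n × m) ℂ :=
  Matrix.kronecker (CFC.sqrt Q)⁻¹ (1 : Matrix m m ℂ)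

theorem invSqrtLeft_conjTranspose {Q : Matrix n n ℂ} (hQ : Q.PosDef) :
    (invSqrtLeft m Q)ᴴ = invSqrtLeft m Q := by
  rw [invSqrtLeft, Matrix.kronecker, Matrix.conjTranspose_kronecker, inv_sqrt_conjTranspose hQ,
    Matrix.conjTranspose_one]

theorem invSqrtLeft_mul {Q : Matrix n n ℂ} (hQ : Q.PosDef) :
    invSqrtLeft m Q * Matrix.kronecker (CFC.sqrt Q) (1 : Matrix m m ℂ) = 1 := by
  unfold invSqrtLeft Matrix.kronecker
  rw [← Matrix.mul_kronecker_mul,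
    inv_mul_sqrt hQ, Matrix.one_mul, Matrix.one_kronecker_one]

theorem mul_invSqrtLeft {Q : Matrix n n ℂ} (hQ : Q.PosDef) :
    Matrix.kronecker (CFC.sqrt Q) (1 : Matrix m m ℂ) * invSqrtLeft m Q = 1 := by
  unfold invSqrtLeft Matrix.kronecker
  rw [← Matrix.mul_kronecker_mul,
    sqrt_mul_inv hQ, Matrix.one_mul, Matrix.one_kronecker_one]

theorem isUnit_scalar_invSqrtLeft {Q : Matrix n n ℂ} (hQ : Q.PosDef) :
    IsUnit (scalar A (invSqrtLeft m Q)) :=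
  ⟨⟨scalar A (invSqrtLeft m Q), scalar A (Matrix.kronecker (CFC.sqrt Q) (1 : Matrix m m ℂ)),
    by rw [← scalar_mul, invSqrtLeft_mul hQ, scalar_one],
    by rw [← scalar_mul, mul_invSqrtLeft hQ, scalar_one]⟩, rfl⟩

theorem tensor_conjBy_mul_invSqrtLeft {Q : Matrix n n ℂ} (hQ : Q.PosDef) (α : Matrix n n A)
    (β : Matrix m m A) :
    tensor (conjBy Q α) β * scalar A (invSqrtLeft m Q)
      = scalar A (invSqrtLeft m Q) * (tensor (dual Q α) 1 * tensor 1 β) := by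
  rw [tensor_eq_mul, invSqrtLeft, ← tensor_scalar_left, Matrix.mul_assoc, tensor_one_comm_scalar,
    ← Matrix.mul_assoc, ← tensor_one_right_mul, conjBy_mul_inv_sqrt hQ, tensor_one_right_mul,
    Matrix.mul_assoc]

theorem invSqrtLeft_mul_tensor_conjBy {Q : Matrix n n ℂ} (hQ : Q.PosDef) (α : Matrix n n A)
    (β : Matrix m m A) :
    scalar A (invSqrtLeft m Q) * tensor (conjBy Q α) β
      = tensor (contragredient α) 1 * tensor 1 β * scalar A (invSqrtLeft m Q) := by
  rw [tensor_eq_mul, invSqrtLeft, ← tensor_scalar_left, Matrix.mul_assoc (tensor _ 1),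
    tensor_one_comm_scalar, ← Matrix.mul_assoc, ← Matrix.mul_assoc, ← tensor_one_right_mul,
    ← tensor_one_right_mul, inv_sqrt_mul_conjBy hQ]

/-- The matrix of `v : H_n → H_m ⊗ H_l` as an operator on `H_l` with values in `H̄_n ⊗ H_m`. -/
def reshape (v : Matrix (m × l) n ℂ) : Matrix (n × m) l ℂ :=
  Matrix.of fun q p => v (q.2, p) q.1

/-- The two sides are the two sides of the intertwining relation with their entries rearranged. The
products β_{ik} γ_{pq} keep their order, since only scalars are moved across them. -/
theorem mem_hom_tensor_iff {α : Matrix n n A} {β : Matrix m m A} {γ : Matrix l l A}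
    {v : Matrix (m × l) n ℂ} :
    v ∈ Hom α (tensor β γ) ↔
      tensor (1 : Matrix n n A) β * scalar A (reshape v) * γᵀ
        = tensor αᵀ (1 : Matrix m m A) * scalar A (reshape v) := by
  have h1 : ∀ a k p, (tensor (1 : Matrix n n A) β * scalar A (reshape v) * γᵀ) (a, k) p
      = (tensor β γ * scalar A v) (k, p) a := fun a k p => by
    simp only [tensor, scalar, reshape, Matrix.mul_apply, Matrix.kroneckerMap_apply,
      Fintype.sum_prod_type, Matrix.one_apply, Matrix.map_apply, Matrix.of_apply,
      Matrix.transpose_apply, ite_mul, one_mul, zero_mul, Finset.sum_ite_irrel,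
      Finset.sum_const_zero, Finset.sum_ite_eq, Finset.mem_univ, if_true, Finset.sum_mul]
    rw [Finset.sum_comm]
    refine Finset.sum_congr rfl fun k' _ => Finset.sum_congr rfl fun p' _ => ?_
    rw [mul_assoc, mul_assoc, Algebra.commutes]
  have h2 : ∀ a k p, (tensor αᵀ (1 : Matrix m m A) * scalar A (reshape v)) (a, k) p
      = (scalar A v * α) (k, p) a := fun a k p => by
    simp [tensor, scalar, reshape, Matrix.mul_apply, Fintype.sum_prod_type, Matrix.one_apply,
      Algebra.commutes]
  simp only [Hom, Set.mem_ofPred_eq]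
  constructor
  · intro h
    ext ⟨a, k⟩ p
    rw [h1, h2, h]
  · intro h
    ext ⟨k, p⟩ a
    rw [← h1, ← h2, h]

/-- The operator `H_{γ̄} → H_{ᾱ} ⊗ H_β` corresponding to `v : H_α → H_β ⊗ H_γ`. -/
noncomputable def frob (Q : Matrix n n ℂ) (P : Matrix l l ℂ) (v : Matrix (m × l) n ℂ) :
    Matrix (n × m) l ℂ :=
  invSqrtLeft m Q * reshape v * CFC.sqrt P

/-- Since `dual` inverts the transpose, αᵀ and γᵀ in `mem_hom_tensor_iff` can be carried to the
other sides as duals. The factors Q^{-1/2} and P^{1/2} in `frob` then convert the duals into the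
unitary conjugates. -/
theorem frob_mem_hom_iff {α : Matrix n n A} {β : Matrix m m A} {γ : Matrix l l A}
    {Q : Matrix n n ℂ} {P : Matrix l l ℂ} (hα : IsModular α Q) (hγ : IsModular γ P)
    {v : Matrix (m × l) n ℂ} :
    frob Q P v ∈ Hom (conjBy P γ) (tensor (conjBy Q α) β) ↔ v ∈ Hom α (tensor β γ) := by
  rw [mem_hom_tensor_iff (v := v)]
  set V := scalar A (reshape v) with hV
  have ea : tensor αᵀ 1 * tensor (dual Q α) (1 : Matrix m m A) = 1 := by
    rw [← tensor_one_right_mul, hα.transpose_mul_dual, tensor_one_one]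
  have ea' : tensor (dual Q α) (1 : Matrix m m A) * tensor αᵀ 1 = 1 := by
    rw [← tensor_one_right_mul, hα.dual_mul_transpose, tensor_one_one]
  have e1 : tensor (conjBy Q α) β * scalar A (frob Q P v)
      = scalar A (invSqrtLeft m Q) * (tensor (dual Q α) 1 * tensor 1 β * V)
        * scalar A (CFC.sqrt P) := by
    rw [frob, scalar_mul, scalar_mul, ← Matrix.mul_assoc, ← Matrix.mul_assoc,
      tensor_conjBy_mul_invSqrtLeft hα.posDef]
    simp only [Matrix.mul_assoc, hV]
  have e2 : scalar A (frob Q P v) * conjBy P γ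
      = scalar A (invSqrtLeft m Q) * (V * dual P γ) * scalar A (CFC.sqrt P) := by
    rw [frob, scalar_mul, scalar_mul, Matrix.mul_assoc, sqrt_mul_conjBy hγ.posDef]
    simp only [Matrix.mul_assoc, hV]
  have e3 : frob Q P v ∈ Hom (conjBy P γ) (tensor (conjBy Q α) β) ↔
      tensor (dual Q α) 1 * tensor 1 β * V = V * dual P γ := by
    simp only [Hom, Set.mem_ofPred_eq]
    rw [e1, e2]
    refine ⟨fun h => ?_, fun h => by rw [h]⟩
    have := congrArg (fun M => scalar A (Matrix.kronecker (CFC.sqrt Q) (1 : Matrix m m ℂ)) * M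
      * scalar A (CFC.sqrt P)⁻¹) h
    simp only [Matrix.mul_assoc] at this
    simp only [← scalar_mul, sqrt_mul_inv hγ.posDef, scalar_one, Matrix.mul_one] at this
    simp only [← Matrix.mul_assoc, ← scalar_mul, mul_invSqrtLeft hα.posDef] at this
    simpa only [scalar_one, Matrix.one_mul] using this
  rw [e3]
  generalize (tensor 1 β : Matrix (n × m) (n × m) A) = B
  generalize (tensor αᵀ 1 : Matrix (n × m) (n × m) A) = a at ea ea' ⊢
  generalize (tensor (dual Q α) 1 : Matrix (n × m) (n × m) A) = d at ea ea' ⊢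
  constructor
  · intro h
    calc B * V * γᵀ = a * (d * B * V) * γᵀ := by
          simp only [← Matrix.mul_assoc, ea, Matrix.one_mul]
      _ = a * V := by
          rw [h, Matrix.mul_assoc, Matrix.mul_assoc, hγ.dual_mul_transpose, Matrix.mul_one]
  · intro h
    calc d * B * V = d * (B * V * γᵀ) * dual P γ := by
          simp only [Matrix.mul_assoc, hγ.transpose_mul_dual, Matrix.mul_one]
      _ = V * dual P γ := by rw [h, ← Matrix.mul_assoc, ea', Matrix.one_mul]

theorem exists_frob_eq {Q : Matrix n n ℂ} {P : Matrix l l ℂ} (hQ : Q.PosDef) (hP : P.PosDef)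
    (R : Matrix (n × m) l ℂ) : ∃ v, frob Q P v = R := by
  refine ⟨Matrix.of fun q a => (Matrix.kronecker (CFC.sqrt Q) (1 : Matrix m m ℂ) * R
    * (CFC.sqrt P)⁻¹) (a, q.1) q.2, ?_⟩
  have : reshape (Matrix.of fun (q : m × l) a => (Matrix.kronecker (CFC.sqrt Q)
    (1 : Matrix m m ℂ) * R * (CFC.sqrt P)⁻¹) (a, q.1) q.2)
    = Matrix.kronecker (CFC.sqrt Q) (1 : Matrix m m ℂ) * R * (CFC.sqrt P)⁻¹ := rfl
  rw [frob, this]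
  simp only [Matrix.mul_assoc, inv_mul_sqrt hP, Matrix.mul_one]
  rw [← Matrix.mul_assoc, invSqrtLeft_mul hQ, Matrix.one_mul]

theorem frob_zero {Q : Matrix n n ℂ} {P : Matrix l l ℂ} :
    frob Q P (0 : Matrix (m × l) n ℂ) = 0 := by
  have : reshape (0 : Matrix (m × l) n ℂ) = 0 := rfl
  rw [frob, this, Matrix.mul_zero, Matrix.zero_mul]

theorem frob_smul {Q : Matrix n n ℂ} {P : Matrix l l ℂ} (c : ℂ) (v : Matrix (m × l) n ℂ) :
    frob Q P (c • v) = c • frob Q P v := by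
  have : reshape (c • v) = c • reshape v := rfl
  rw [frob, this, Matrix.mul_smul, Matrix.smul_mul, frob]

theorem frob_injective {Q : Matrix n n ℂ} {P : Matrix l l ℂ} (hQ : Q.PosDef) (hP : P.PosDef) :
    Function.Injective (frob Q P : Matrix (m × l) n ℂ → _) := by
  intro v w h
  have := congrArg (fun M => Matrix.kronecker (CFC.sqrt Q) (1 : Matrix m m ℂ) * M
      * (CFC.sqrt P)⁻¹) h
  simp only [frob, Matrix.mul_assoc, sqrt_mul_inv hP, Matrix.mul_one] at this
  simp only [← Matrix.mul_assoc, mul_invSqrtLeft hQ, Matrix.one_mul] at this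
  ext ⟨i, p⟩ a
  exact congrFun (congrFun this (a, i)) p

end Frobenius

/-! ### Multiplicity-free decompositions -/

section Decomposition

variable {A : Type u} [CStarAlgebra A] {G : CompactQuantumGroup A}
variable {m ι : Type*} [Fintype m] [DecidableEq m] [Fintype ι] [DecidableEq ι]
  {n : ι → Type*} [∀ j, Fintype (n j)] [∀ j, DecidableEq (n j)]

theorem exists_components {U : Matrix m m A} {σ : ∀ j, Matrix (n j) (n j) A}
    (h : Equivalent U (Matrix.blockDiagonal' σ)) :
    ∃ (X : ∀ j, Matrix (n j) m ℂ) (Y : ∀ j, Matrix m (n j) ℂ), (∀ j, X j ∈ Hom U (σ j)) ∧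
      (∀ j, Y j ∈ Hom (σ j) U) ∧ ∑ j, Y j * X j = 1 ∧ (∀ j, X j * Y j = 1) ∧
      ∀ i j, i ≠ j → X i * Y j = 0 := by
  obtain ⟨X, hX, Y, h1, h2⟩ := h
  have hY := inv_mem_hom hX h1 h2
  simp only [Hom, Set.mem_ofPred_eq] at hX hY
  refine ⟨fun j => X.submatrix (fun p => ⟨j, p⟩) id, fun j => Y.submatrix id (fun p => ⟨j, p⟩),
    fun j => ?_, fun j => ?_, ?_, fun j => ?_, fun i j hij => ?_⟩
  · simp only [Hom, Set.mem_ofPred_eq]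
    ext p q
    have := congrFun (congrFun hX ⟨j, p⟩) q
    rw [Matrix.mul_apply, Fintype.sum_sigma, Fintype.sum_eq_single j] at this
    · simpa [Matrix.mul_apply, scalar] using this
    · intro i hi
      simp [Matrix.blockDiagonal'_apply_ne _ _ _ hi.symm]
  · simp only [Hom, Set.mem_ofPred_eq]
    ext q p
    have := congrFun (congrFun hY q) ⟨j, p⟩
    rw [Matrix.mul_apply (M := scalar A Y), Fintype.sum_sigma, Fintype.sum_eq_single j] at this
    · simpa [Matrix.mul_apply, scalar] using this
    · intro i hi
      simp [Matrix.blockDiagonal'_apply_ne _ _ _ hi]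
  · rw [← h1]
    ext p q
    simp [Matrix.mul_apply, Matrix.sum_apply, Fintype.sum_sigma]
  · ext p q
    have := congrFun (congrFun h2 ⟨j, p⟩) ⟨j, q⟩
    simpa [Matrix.mul_apply, Matrix.one_apply] using this
  · ext p q
    have := congrFun (congrFun h2 ⟨i, p⟩) ⟨j, q⟩
    simpa [Matrix.mul_apply, Matrix.one_apply, hij] using this

/-- A unitary representation `U` with nonzero intertwiners `R j` from pairwise inequivalent
irreducible representations `σ j` which exhaust `U`. -/
theorem exists_orthogonal {U : Matrix m m A} (hU : U ∈ unitary (Matrix m m A))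
    {σ : ∀ j, Matrix (n j) (n j) A} (hσ : ∀ j, G.IsIrrep (σ j))
    (hne : ∀ i j, Equivalent (σ i) (σ j) → i = j)
    (hdec : Equivalent U (Matrix.blockDiagonal' σ))
    {R : ∀ j, Matrix m (n j) ℂ} (hR : ∀ j, R j ∈ Hom (σ j) U) (h0 : ∀ j, R j ≠ 0) :
    ∃ r : ι → ℂ, (∀ j, 0 < r j) ∧ (∀ j, (R j)ᴴ * R j = r j • 1) ∧
      (∀ i j, i ≠ j → (R i)ᴴ * R j = 0) ∧ ∑ j, (r j)⁻¹ • (R j * (R j)ᴴ) = 1 := by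
  have schur : ∀ i j, i ≠ j → ∀ Z ∈ Hom (σ j) (σ i), Z = 0 := fun i j hij Z hZ => by
    by_contra h
    exact hij (hne j i ((hσ j).equivalent (hσ i) hZ h)).symm
  choose r hr0 hr using fun j => (hσ j).exists_conjTranspose_mul_self hU (hR j) (h0 j)
  have hR' : ∀ j, (R j)ᴴ ∈ Hom U (σ j) := fun j => conjTranspose_mem_hom (hσ j).1.2 hU (hR j)
  have horth : ∀ i j, i ≠ j → (R i)ᴴ * R j = 0 := fun i j hij =>
    schur i j hij _ (mul_mem_hom (hR' i) (hR j))
  obtain ⟨X, Y, hX, hY, h1, -, -⟩ := exists_components hdec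
  refine ⟨r, hr0, hr, horth, ?_⟩
  choose c hc using fun j => (hσ j).2.2 _ (mul_mem_hom (hX j) (hR j))
  -- The equivalence behind X, Y is only invertible, not unitary. By Schur R_j has no component
  -- outside the j-th block, and there it is a multiple of the inclusion Y_j.
  have e1 : ∀ j, R j = c j • Y j := fun j => by
    calc R j = ∑ i, Y i * X i * R j := by rw [← Matrix.sum_mul, h1, Matrix.one_mul]
      _ = Y j * X j * R j := by
        refine Fintype.sum_eq_single j fun i hi => ?_
        rw [Matrix.mul_assoc, schur i j hi _ (mul_mem_hom (hX i) (hR j)), Matrix.mul_zero]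
      _ = _ := by rw [Matrix.mul_assoc, hc, Matrix.mul_smul, Matrix.mul_one]
  have hc0 : ∀ j, c j ≠ 0 := fun j hj => h0 j (by rw [e1 j, hj, zero_smul])
  have e2 : ∀ j, Y j = (c j)⁻¹ • R j := fun j => by
    conv_rhs => rw [e1 j]
    rw [smul_smul, inv_mul_cancel₀ (hc0 j), one_smul]
  have e3 : ∑ j, (c j)⁻¹ • (R j * X j) = 1 := by
    rw [← h1]
    exact Finset.sum_congr rfl fun j _ => by rw [e2 j, Matrix.smul_mul]
  -- Multiplying the resolution of the identity `e3` by R_i^* isolates its i-th term. So the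
  -- algebraic projections in `e3` are in fact the orthogonal ones.
  have e4 : ∀ i, (R i)ᴴ = ((c i)⁻¹ * r i) • X i := fun i => by
    calc (R i)ᴴ = ∑ j, (c j)⁻¹ • ((R i)ᴴ * R j * X j) := by
          conv_lhs => rw [← Matrix.mul_one (R i)ᴴ, ← e3, Matrix.mul_sum]
          exact Finset.sum_congr rfl fun j _ => by rw [Matrix.mul_smul, Matrix.mul_assoc]
      _ = (c i)⁻¹ • ((R i)ᴴ * R i * X i) := by
        refine Fintype.sum_eq_single i fun j hj => ?_
        rw [horth i j hj.symm, Matrix.zero_mul, smul_zero]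
      _ = _ := by rw [hr, Matrix.smul_mul, Matrix.one_mul, smul_smul]
  rw [← e3]
  refine Finset.sum_congr rfl fun j _ => ?_
  rw [e4 j, Matrix.mul_smul, smul_smul, mul_comm, mul_assoc, mul_inv_cancel₀ (hr0 j).ne', mul_one]

section Orthogonal

variable {R : ∀ j, Matrix m (n j) ℂ} {r : ι → ℂ}

/-- Compression by R_i reads off the i-th coefficient; this gives both linear independence and the
nonnegativity of the coefficients of a positive operator. -/
theorem conjTranspose_mul_sum_mul (hr : ∀ j, (R j)ᴴ * R j = r j • 1)
    (horth : ∀ i j, i ≠ j → (R i)ᴴ * R j = 0) (t : ι → ℂ) (i : ι) :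
    (R i)ᴴ * (∑ j, t j • (R j * (R j)ᴴ)) * R i = (t i * (r i * r i)) • 1 := by
  rw [Matrix.mul_sum, Matrix.sum_mul, Fintype.sum_eq_single i]
  · rw [Matrix.mul_smul, Matrix.smul_mul, ← Matrix.mul_assoc, hr, Matrix.mul_assoc, hr]
    simp [smul_smul]
  · intro j hj
    rw [Matrix.mul_smul, Matrix.smul_mul, ← Matrix.mul_assoc, horth i j hj.symm]
    simp

theorem linearIndependent_mul_conjTranspose [∀ j, Nonempty (n j)] (h0 : ∀ j, 0 < r j)
    (hr : ∀ j, (R j)ᴴ * R j = r j • 1) (horth : ∀ i j, i ≠ j → (R i)ᴴ * R j = 0) :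
    LinearIndependent ℂ fun j => R j * (R j)ᴴ := by
  rw [Fintype.linearIndependent_iff]
  intro t ht i
  have h := conjTranspose_mul_sum_mul hr horth t i
  rw [ht, Matrix.mul_zero, Matrix.zero_mul, ← zero_smul ℂ (1 : Matrix (n i) (n i) ℂ)] at h
  have h' := smul_one_injective h
  simpa [(h0 i).ne'] using h'.symm

theorem nonneg_of_posSemidef_sum [∀ j, Nonempty (n j)] (h0 : ∀ j, 0 < r j)
    (hr : ∀ j, (R j)ᴴ * R j = r j • 1) (horth : ∀ i j, i ≠ j → (R i)ᴴ * R j = 0) {t : ι → ℂ}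
    (ht : (∑ j, t j • (R j * (R j)ᴴ)).PosSemidef) (i : ι) : 0 ≤ t i := by
  have h := ht.conjTranspose_mul_mul_same (R i)
  rw [conjTranspose_mul_sum_mul hr horth] at h
  have p : n i := Classical.arbitrary _
  have h1 := h.diag_nonneg (i := p)
  have h2 : (0 : ℂ) < r i * r i := mul_pos (h0 i) (h0 i)
  simp only [Matrix.smul_apply, Matrix.one_apply_eq, smul_eq_mul, mul_one] at h1
  have h3 := mul_nonneg h1 (inv_pos.2 h2).le
  rwa [mul_assoc, mul_inv_cancel₀ h2.ne', mul_one] at h3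

/-- Multiplicity one: in the expansion of T by the resolution of the identity only the j-th term
survives Schur's lemma, and R_j^* T is scalar. -/
theorem exists_eq_smul_of_mem_hom {U : Matrix m m A} (hU : U ∈ unitary (Matrix m m A))
    {σ : ∀ j, Matrix (n j) (n j) A} (hσ : ∀ j, G.IsIrrep (σ j))
    (hne : ∀ i j, Equivalent (σ i) (σ j) → i = j) (hR : ∀ j, R j ∈ Hom (σ j) U)
    (hsum : ∑ j, (r j)⁻¹ • (R j * (R j)ᴴ) = 1) {j : ι} {T : Matrix m (n j) ℂ}
    (hT : T ∈ Hom (σ j) U) : ∃ c : ℂ, T = c • R j := by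
  have hR' : ∀ j, (R j)ᴴ ∈ Hom U (σ j) := fun j => conjTranspose_mem_hom (hσ j).1.2 hU (hR j)
  obtain ⟨c, hc⟩ := (hσ j).2.2 _ (mul_mem_hom (hR' j) hT)
  refine ⟨(r j)⁻¹ * c, ?_⟩
  calc T = ∑ i, (r i)⁻¹ • (R i * ((R i)ᴴ * T)) := by
        conv_lhs => rw [← Matrix.one_mul T, ← hsum, Matrix.sum_mul]
        simp only [Matrix.smul_mul, Matrix.mul_assoc]
    _ = (r j)⁻¹ • (R j * ((R j)ᴴ * T)) := by
      refine Fintype.sum_eq_single j fun i hi => ?_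
      have : (R i)ᴴ * T = 0 := by
        by_contra h
        exact hi (hne j i ((hσ j).equivalent (hσ i) (mul_mem_hom (hR' i) hT) h)).symm
      rw [this, Matrix.mul_zero, smul_zero]
    _ = _ := by rw [hc, Matrix.mul_smul, Matrix.mul_one, smul_smul]

theorem exists_eq_sum_of_mem_hom {U : Matrix m m A} (hU : U ∈ unitary (Matrix m m A))
    {σ : ∀ j, Matrix (n j) (n j) A} (hσ : ∀ j, G.IsIrrep (σ j))
    (hne : ∀ i j, Equivalent (σ i) (σ j) → i = j) (hR : ∀ j, R j ∈ Hom (σ j) U)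
    (hsum : ∑ j, (r j)⁻¹ • (R j * (R j)ᴴ) = 1) {Z : Matrix m m ℂ} (hZ : Z ∈ Hom U U) :
    ∃ z : ι → ℂ, Z = ∑ j, z j • (R j * (R j)ᴴ) := by
  choose c hc using fun j => exists_eq_smul_of_mem_hom hU hσ hne hR hsum (mul_mem_hom hZ (hR j))
  refine ⟨fun j => (r j)⁻¹ * c j, ?_⟩
  conv_lhs => rw [← Matrix.mul_one Z, ← hsum, Matrix.mul_sum]
  refine Finset.sum_congr rfl fun j _ => ?_
  rw [Matrix.mul_smul, ← Matrix.mul_assoc, hc, Matrix.smul_mul, smul_smul]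

end Orthogonal

end Decomposition

end CompactQuantumGroup

namespace CompactQuantumGroup

section Choi

variable {A : Type u} [CStarAlgebra A]
variable {k l m n : Type*} [Fintype k] [Fintype l] [Fintype m] [Fintype n]
  [DecidableEq k] [DecidableEq l] [DecidableEq m] [DecidableEq n]

theorem sum_comm_pairs {ι₁ ι₂ ι₃ ι₄ M : Type*} [Fintype ι₁] [Fintype ι₂] [Fintype ι₃]
    [Fintype ι₄] [AddCommMonoid M] (f : ι₁ → ι₂ → ι₃ → ι₄ → M) :
    ∑ a, ∑ b, ∑ c, ∑ d, f a b c d = ∑ c, ∑ d, ∑ a, ∑ b, f a b c d := by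
  have h := Finset.sum_comm (s := (Finset.univ : Finset (ι₁ × ι₂)))
    (t := (Finset.univ : Finset (ι₃ × ι₄))) (f := fun x y => f x.1 x.2 y.1 y.2)
  simpa only [Fintype.sum_prod_type] using h

/-! ### Choi matrices -/

/-- The Choi matrix of a linear map. -/
def choi : (Matrix n n ℂ →ₗ[ℂ] Matrix m m ℂ) →ₗ[ℂ] Matrix (n × m) (n × m) ℂ where
  toFun Φ := Matrix.of fun p q => Φ (Matrix.single p.1 q.1 1) p.2 q.2
  map_add' _ _ := rfl
  map_smul' _ _ := rfl

theorem choi_apply (Φ : Matrix n n ℂ →ₗ[ℂ] Matrix m m ℂ) (p q : n × m) :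
    choi Φ p q = Φ (Matrix.single p.1 q.1 1) p.2 q.2 := rfl

theorem map_eq_sum_single (Φ : Matrix n n ℂ →ₗ[ℂ] Matrix m m ℂ) (X : Matrix n n ℂ) :
    Φ X = ∑ i, ∑ j, X i j • Φ (Matrix.single i j 1) := by
  conv_lhs => rw [Matrix.matrix_eq_sum_single X]
  simp only [map_sum]
  refine Finset.sum_congr rfl fun i _ => Finset.sum_congr rfl fun j _ => ?_
  rw [← map_smul, Matrix.smul_single, smul_eq_mul, mul_one]

theorem choi_injective :
    Function.Injective (choi : (Matrix n n ℂ →ₗ[ℂ] Matrix m m ℂ) →ₗ[ℂ] _) := by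
  intro Φ Ψ h
  have h' : ∀ i j, Φ (Matrix.single i j 1) = Ψ (Matrix.single i j 1) := fun i j => by
    ext p q
    exact congrFun (congrFun h (i, p)) (j, q)
  refine LinearMap.ext fun X => ?_
  rw [map_eq_sum_single Φ, map_eq_sum_single Ψ]
  simp only [h']

/-- Choi's theorem. The Choi matrix is the image of the unnormalized maximally entangled projection
under id_d ⊗ Φ; conversely (id_r ⊗ Φ)(X) is a compression of X ⊗ C. The domain is indexed by `Fin d`
so that r = d is an admissible amplification. -/
theorem isCP_iff {d : ℕ} {Φ : Matrix (Fin d) (Fin d) ℂ →ₗ[ℂ] Matrix m m ℂ} :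
    IsCP Φ ↔ (choi Φ).PosSemidef := by
  constructor
  · intro h
    have hX := Matrix.posSemidef_vecMulVec_self_star
      (fun p : Fin d × Fin d => if p.1 = p.2 then (1 : ℂ) else 0)
    have e : choi Φ = Matrix.of fun (p q : Fin d × m) =>
        Φ (Matrix.of fun i j => Matrix.vecMulVec
          (fun p : Fin d × Fin d => if p.1 = p.2 then (1 : ℂ) else 0)
          (star fun p : Fin d × Fin d => if p.1 = p.2 then (1 : ℂ) else 0)
          (p.1, i) (q.1, j)) p.2 q.2 := by
      ext p q
      rw [choi_apply, Matrix.of_apply]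
      have : Matrix.single p.1 q.1 (1 : ℂ) = Matrix.of fun i j => Matrix.vecMulVec
          (fun p : Fin d × Fin d => if p.1 = p.2 then (1 : ℂ) else 0)
          (star fun p : Fin d × Fin d => if p.1 = p.2 then (1 : ℂ) else 0)
          (p.1, i) (q.1, j) := by
        ext i j
        by_cases h1 : p.1 = i <;> by_cases h2 : q.1 = j <;>
          simp [Matrix.vecMulVec_apply, h1, h2]
      rw [this]
    rw [e]
    exact h d _ hX
  · intro h r X hX
    -- L inserts the vector Σ e_i ⊗ e_i into the two middle factors, so that compression by L
    -- contracts the indices of X with the input indices of Φ.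
    let L : Matrix ((Fin r × Fin d) × (Fin d × m)) (Fin r × m) ℂ :=
      Matrix.of fun p q => if p.1.1 = q.1 then if p.1.2 = p.2.1 then if p.2.2 = q.2 then 1
        else 0 else 0 else 0
    have e : (Matrix.of fun (p q : Fin r × m) =>
        Φ (Matrix.of fun i j => X (p.1, i) (q.1, j)) p.2 q.2)
        = Lᴴ * Matrix.kronecker X (choi Φ) * L := by
      ext ⟨s, k⟩ ⟨t, q⟩
      rw [Matrix.of_apply, map_eq_sum_single Φ]
      simp only [L, Matrix.mul_apply, Fintype.sum_prod_type, Matrix.conjTranspose_apply,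
        Matrix.of_apply, apply_ite star, star_one,
        star_zero, ite_mul, one_mul, zero_mul, mul_ite, mul_one, mul_zero, Finset.sum_ite_eq',
        Finset.sum_ite_eq, Finset.mem_univ, if_true, Finset.sum_ite_irrel, Finset.sum_const_zero,
        Matrix.sum_apply, Matrix.smul_apply, smul_eq_mul]
      rw [Finset.sum_comm]
      rfl
    rw [e]
    exact (hX.kronecker h).conjTranspose_mul_mul_same L

/-- Both sides of the covariance relation are linear in X; compare the coefficients of the entries
X_{ab}. -/
theorem mem_cov_iff {α : Matrix n n A} {β : Matrix m m A}
    {Φ : Matrix n n ℂ →ₗ[ℂ] Matrix m m ℂ} :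
    Φ ∈ Cov α β ↔ tensor αᵀ (1 : Matrix m m A) * scalar A (choi Φ) * tensor (contragredient α) 1
      = tensor (1 : Matrix n n A) β * scalar A (choi Φ) * (tensor (1 : Matrix n n A) β)ᴴ := by
  have h1 : ∀ X i j, amplify Φ (α * scalar A X * αᴴ) i j = ∑ a, ∑ b, X a b •
      (tensor αᵀ (1 : Matrix m m A) * scalar A (choi Φ) *
        tensor (contragredient α) (1 : Matrix m m A) : Matrix (n × m) (n × m) A)
        (a, i) (b, j) := fun X i j => by
    have e1 : ∀ p q, (α * scalar A X * αᴴ) p q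
        = ∑ a, ∑ b, X a b • (α p a * star (α q b)) := fun p q => by
      simp only [Matrix.mul_apply, scalar, Matrix.map_apply, Matrix.conjTranspose_apply,
        Finset.sum_mul]
      rw [Finset.sum_comm]
      refine Finset.sum_congr rfl fun a _ => Finset.sum_congr rfl fun b _ => ?_
      rw [← Algebra.commutes, ← Algebra.smul_def, smul_mul_assoc]
    have e2 : ∀ a b, (tensor αᵀ (1 : Matrix m m A) * scalar A (choi Φ)
        * tensor (contragredient α) (1 : Matrix m m A) : Matrix (n × m) (n × m) A) (a, i) (b, j)
        = ∑ p, ∑ q, Φ (Matrix.single p q 1) i j • (α p a * star (α q b)) := fun a b => by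
      simp only [tensor, scalar, choi_apply, contragredient, Matrix.mul_apply,
        Matrix.kroneckerMap_apply, Fintype.sum_prod_type, Matrix.one_apply, Matrix.map_apply,
        Matrix.transpose_apply, mul_ite, mul_one, mul_zero, ite_mul, zero_mul, Finset.sum_ite_eq,
        Finset.sum_ite_eq', Finset.mem_univ, if_true, Finset.sum_mul]
      rw [Finset.sum_comm]
      refine Finset.sum_congr rfl fun p _ => Finset.sum_congr rfl fun q _ => ?_
      rw [← Algebra.commutes, ← Algebra.smul_def, smul_mul_assoc]
    simp only [amplify, Matrix.of_apply, e1, e2, Finset.smul_sum]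
    rw [sum_comm_pairs]
    refine Finset.sum_congr rfl fun _ _ => Finset.sum_congr rfl fun _ _ =>
      Finset.sum_congr rfl fun _ _ => Finset.sum_congr rfl fun _ _ => smul_comm _ _ _
  have h2 : ∀ a b i j, (tensor (1 : Matrix n n A) β * scalar A (choi Φ)
      * (tensor (1 : Matrix n n A) β)ᴴ) (a, i) (b, j)
      = (β * scalar A (Φ (Matrix.single a b 1)) * βᴴ) i j := fun a b i j => by
    rw [tensor_one_left_conjTranspose]
    simp [tensor, scalar, choi_apply, Matrix.mul_apply,
      Fintype.sum_prod_type, Matrix.one_apply, Finset.sum_ite_irrel]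
  have h3 : ∀ X i j, (β * scalar A (Φ X) * βᴴ) i j = ∑ a, ∑ b, X a b •
      (β * scalar A (Φ (Matrix.single a b 1)) * βᴴ) i j := fun X i j => by
    rw [map_eq_sum_single Φ X]
    simp only [scalar_sum, scalar_smul, Matrix.mul_sum, Matrix.sum_mul, Matrix.mul_smul,
      Matrix.smul_mul, Matrix.sum_apply, Matrix.smul_apply]
  constructor
  · intro h
    ext ⟨a, i⟩ ⟨b, j⟩
    rw [h2, ← h (Matrix.single a b 1), h1]
    simp only [Matrix.single_apply, ite_and, ite_smul, one_smul, zero_smul, Finset.sum_ite_eq,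
      Finset.mem_univ, if_true, Finset.sum_ite_irrel, Finset.sum_const_zero]
  · intro h X
    ext i j
    rw [h1, h3, h]
    simp only [h2]

/-- The Choi matrix, twisted so that covariant maps correspond to intertwiners of `ᾱ ⊗ β`. -/
noncomputable def twistedChoi (Q : Matrix n n ℂ) :
    (Matrix n n ℂ →ₗ[ℂ] Matrix m m ℂ) →ₗ[ℂ] Matrix (n × m) (n × m) ℂ :=
  (LinearMap.mulRight ℂ (invSqrtLeft m Q)).comp
    ((LinearMap.mulLeft ℂ (invSqrtLeft m Q)).comp choi)

theorem twistedChoi_apply (Q : Matrix n n ℂ) (Φ : Matrix n n ℂ →ₗ[ℂ] Matrix m m ℂ) :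
    twistedChoi Q Φ = invSqrtLeft m Q * choi Φ * invSqrtLeft m Q := rfl

theorem choi_eq_twistedChoi {Q : Matrix n n ℂ} (hQ : Q.PosDef)
    (Φ : Matrix n n ℂ →ₗ[ℂ] Matrix m m ℂ) :
    choi Φ = Matrix.kronecker (CFC.sqrt Q) (1 : Matrix m m ℂ) * twistedChoi Q Φ
      * Matrix.kronecker (CFC.sqrt Q) (1 : Matrix m m ℂ) := by
  rw [twistedChoi_apply]
  simp only [Matrix.mul_assoc, invSqrtLeft_mul hQ, Matrix.mul_one]
  rw [← Matrix.mul_assoc, mul_invSqrtLeft hQ, Matrix.one_mul]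

theorem twistedChoi_injective {Q : Matrix n n ℂ} (hQ : Q.PosDef) :
    Function.Injective
      (twistedChoi Q : (Matrix n n ℂ →ₗ[ℂ] Matrix m m ℂ) →ₗ[ℂ] _) := by
  intro Φ Ψ h
  apply choi_injective
  rw [choi_eq_twistedChoi hQ, choi_eq_twistedChoi hQ, h]

theorem isCP_iff_twistedChoi {d : ℕ} {Q : Matrix (Fin d) (Fin d) ℂ} (hQ : Q.PosDef)
    {Φ : Matrix (Fin d) (Fin d) ℂ →ₗ[ℂ] Matrix m m ℂ} :
    IsCP Φ ↔ (twistedChoi Q Φ).PosSemidef := by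
  rw [isCP_iff]
  constructor
  · intro h
    have := h.conjTranspose_mul_mul_same (invSqrtLeft m Q)
    rwa [invSqrtLeft_conjTranspose hQ] at this
  · intro h
    have := h.conjTranspose_mul_mul_same (Matrix.kronecker (CFC.sqrt Q) (1 : Matrix m m ℂ))
    rw [choi_eq_twistedChoi hQ]
    rwa [Matrix.kronecker, Matrix.conjTranspose_kronecker, sqrt_conjTranspose hQ,
      Matrix.conjTranspose_one] at this

/-- In (αᵀ ⊗ 1) C (α^c ⊗ 1) = (1 ⊗ β) C (1 ⊗ β)^* the inverse of αᵀ is the dual Q α^c Q⁻¹. Hence C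
intertwines α^c ⊗ β on one side with the dual of α tensored with β on the other; the factors
Q^{-1/2} make both equal to ᾱ ⊗ β. -/
theorem mem_cov_iff_twistedChoi {α : Matrix n n A} {β : Matrix m m A} {Q : Matrix n n ℂ}
    (hα : IsModular α Q) (hβ : β ∈ unitary (Matrix m m A))
    {Φ : Matrix n n ℂ →ₗ[ℂ] Matrix m m ℂ} :
    Φ ∈ Cov α β ↔ twistedChoi Q Φ ∈ Hom (tensor (conjBy Q α) β) (tensor (conjBy Q α) β) := by
  rw [mem_cov_iff]
  set C := scalar A (choi Φ) with hC
  set J := scalar A (invSqrtLeft m Q) with hJ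
  have ea : tensor αᵀ 1 * tensor (dual Q α) (1 : Matrix m m A) = 1 := by
    rw [← tensor_one_right_mul, hα.transpose_mul_dual, tensor_one_one]
  have ea' : tensor (dual Q α) (1 : Matrix m m A) * tensor αᵀ 1 = 1 := by
    rw [← tensor_one_right_mul, hα.dual_mul_transpose, tensor_one_one]
  have eb : (tensor (1 : Matrix n n A) β)ᴴ * tensor (1 : Matrix n n A) β = 1 := by
    rw [tensor_one_left_conjTranspose, ← tensor_one_left_mul, ← tensor_one_one]
    exact congrArg _ (Unitary.mem_iff.1 hβ).1
  have eb' : tensor (1 : Matrix n n A) β * (tensor (1 : Matrix n n A) β)ᴴ = 1 := by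
    rw [tensor_one_left_conjTranspose, ← tensor_one_left_mul, ← tensor_one_one]
    exact congrArg _ (Unitary.mem_iff.1 hβ).2
  have e1 : tensor (conjBy Q α) β * scalar A (twistedChoi Q Φ)
      = J * (tensor (dual Q α) 1 * tensor 1 β * C) * J := by
    rw [twistedChoi_apply, scalar_mul, scalar_mul, ← Matrix.mul_assoc, ← Matrix.mul_assoc,
      tensor_conjBy_mul_invSqrtLeft hα.posDef]
    simp only [Matrix.mul_assoc, hC, hJ]
  have e2 : scalar A (twistedChoi Q Φ) * tensor (conjBy Q α) β
      = J * (C * (tensor (contragredient α) 1 * tensor 1 β)) * J := by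
    rw [twistedChoi_apply, scalar_mul, scalar_mul, Matrix.mul_assoc,
      invSqrtLeft_mul_tensor_conjBy hα.posDef]
    simp only [Matrix.mul_assoc, hC, hJ]
  simp only [Hom, Set.mem_ofPred_eq]
  have hJu : IsUnit J := isUnit_scalar_invSqrtLeft hα.posDef
  rw [e1, e2, hJu.mul_left_inj, hJu.mul_right_inj]
  generalize (tensor 1 β : Matrix (n × m) (n × m) A) = B at *
  generalize (tensor αᵀ 1 : Matrix (n × m) (n × m) A) = a at *
  generalize (tensor (dual Q α) 1 : Matrix (n × m) (n × m) A) = d at *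
  generalize (tensor (contragredient α) 1 : Matrix (n × m) (n × m) A) = c at *
  constructor
  · intro h
    calc d * B * C = d * (B * C * Bᴴ) * B := by simp only [Matrix.mul_assoc, eb, Matrix.mul_one]
      _ = C * (c * B) := by
        rw [← h]
        simp only [← Matrix.mul_assoc, ea', Matrix.one_mul]
  · intro h
    calc a * C * c = a * (C * (c * B)) * Bᴴ := by
          simp only [Matrix.mul_assoc, eb', Matrix.mul_one]
      _ = B * C * Bᴴ := by
        rw [← h]
        simp only [← Matrix.mul_assoc, ea, Matrix.one_mul]

theorem choi_cgMap (G : CompactQuantumGroup A) (γ : Matrix l l A) (v : Matrix (m × l) n ℂ) :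
    choi (G.cgMap γ v) = reshape v * G.qMatrix γ * (reshape v)ᴴ := by
  ext ⟨a, i⟩ ⟨b, j⟩
  simp only [choi_apply, cgMap, LinearMap.coe_mk, AddHom.coe_mk, Matrix.of_apply, qTrace,
    Matrix.trace, Matrix.diag_apply, Matrix.mul_apply, Matrix.transpose_apply, reshape,
    Matrix.conjTranspose_apply, Matrix.single_apply, ite_and, mul_ite, mul_one, mul_zero,
    Finset.sum_ite_eq, Finset.mem_univ, if_true, ite_mul, zero_mul, Finset.sum_mul]
  refine Finset.sum_congr rfl fun q _ => Finset.sum_congr rfl fun p _ => ?_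
  simp
  ring

/-- The bridge between the two pictures. The transpose in `qTrace` is what puts Q_γ itself in the
middle of the Choi matrix, so that it splits as Q_γ^{1/2} Q_γ^{1/2} into the two `frob` factors. -/
theorem twistedChoi_cgMap {G : CompactQuantumGroup A} {γ : Matrix l l A}
    (hγ : (G.qMatrix γ).PosDef) {Q : Matrix n n ℂ} (hQ : Q.PosDef) (v : Matrix (m × l) n ℂ) :
    twistedChoi Q (G.cgMap γ v)
      = frob Q (G.qMatrix γ) v * (frob Q (G.qMatrix γ) v)ᴴ := by
  rw [twistedChoi_apply, choi_cgMap, frob, Matrix.conjTranspose_mul, Matrix.conjTranspose_mul,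
    invSqrtLeft_conjTranspose hQ, sqrt_conjTranspose hγ]
  conv_lhs => rw [← sqrt_mul_sqrt hγ]
  simp only [Matrix.mul_assoc]

end Choi

/-! ### Partial traces -/

section PartialTrace

variable {A : Type u} [CStarAlgebra A]
variable {l m : Type*} [Fintype l] [Fintype m] [DecidableEq l] [DecidableEq m]

/-- The contraction of the second tensor factor with a matrix `M`. -/
def ptrRight {R : Type*} [AddCommMonoid R] [Module ℂ R] (M : Matrix l l ℂ)
    (Y : Matrix (m × l) (m × l) R) : Matrix m m R :=
  Matrix.of fun i j => ∑ p, ∑ q, M p q • Y (i, p) (j, q)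

/-- The contraction of the first tensor factor with a matrix `M`. -/
def ptrLeft {R : Type*} [AddCommMonoid R] [Module ℂ R] (M : Matrix m m ℂ)
    (Y : Matrix (m × l) (m × l) R) : Matrix l l R :=
  Matrix.of fun p q => ∑ i, ∑ j, M i j • Y (i, p) (j, q)

theorem scalar_ptrRight (M : Matrix l l ℂ) (Z : Matrix (m × l) (m × l) ℂ) :
    scalar A (ptrRight M Z) = ptrRight M (scalar A Z) := by
  ext i j
  simp [scalar, ptrRight, Algebra.smul_def]

theorem scalar_ptrLeft (M : Matrix m m ℂ) (Z : Matrix (m × l) (m × l) ℂ) :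
    scalar A (ptrLeft M Z) = ptrLeft M (scalar A Z) := by
  ext i j
  simp [scalar, ptrLeft, Algebra.smul_def]

theorem ptrRight_outer (M : Matrix l l ℂ) (w w' : Matrix m m A) (Y : Matrix (m × l) (m × l) A) :
    ptrRight M (tensor w 1 * Y * tensor w' 1) = w * ptrRight M Y * w' := by
  ext i j
  simp only [ptrRight, tensor, Matrix.of_apply, Matrix.mul_apply, Matrix.kroneckerMap_apply,
    Fintype.sum_prod_type, Matrix.one_apply, mul_ite, mul_one, mul_zero, ite_mul, zero_mul,
    Finset.sum_ite_eq, Finset.sum_ite_eq', Finset.mem_univ, if_true, Finset.sum_mul,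
    Finset.mul_sum, Finset.smul_sum, smul_mul_assoc, mul_smul_comm]
  rw [sum_comm_pairs]

theorem ptrLeft_outer (M : Matrix m m ℂ) (w w' : Matrix l l A) (Y : Matrix (m × l) (m × l) A) :
    ptrLeft M (tensor 1 w * Y * tensor 1 w') = w * ptrLeft M Y * w' := by
  ext i j
  simp only [ptrLeft, tensor, Matrix.of_apply, Matrix.mul_apply, Matrix.kroneckerMap_apply,
    Fintype.sum_prod_type, Matrix.one_apply, mul_ite, mul_zero, ite_mul, zero_mul,
    Finset.sum_ite_irrel, Finset.sum_const_zero, one_mul,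
    Finset.sum_ite_eq, Finset.sum_ite_eq', Finset.mem_univ, if_true, Finset.sum_mul,
    Finset.mul_sum, Finset.smul_sum, smul_mul_assoc, mul_smul_comm]
  rw [sum_comm_pairs]

/-- Because Z is scalar, the entries of `w` and `w'` become adjacent and their contraction with M is
the matrix product in `h`. This is the invariance that makes the weighted partial trace equivariant.
-/
theorem ptrRight_inner {M M' : Matrix l l ℂ} {w w' : Matrix l l A}
    (h : wᵀ * scalar A M * w'ᵀ = scalar A M') (Z : Matrix (m × l) (m × l) ℂ) :
    ptrRight M (tensor 1 w * scalar A Z * tensor 1 w') = scalar A (ptrRight M' Z) := by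
  ext i j
  have h' : ∀ p q, M' p q • (1 : A) = ∑ q', ∑ p', M p' q' • (w p' p * w' q q') := fun p q => by
    have := congrFun (congrFun h p) q
    rw [← Algebra.algebraMap_eq_smul_one]
    refine this.symm.trans ?_
    simp only [scalar, Matrix.mul_apply, Matrix.transpose_apply, Matrix.map_apply, Finset.sum_mul]
    refine Finset.sum_congr rfl fun q' _ => Finset.sum_congr rfl fun p' _ => ?_
    rw [← Algebra.commutes, ← Algebra.smul_def, smul_mul_assoc]
  have e : ∀ p q, (tensor (1 : Matrix m m A) w * scalar A Z * tensor (1 : Matrix m m A) w' :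
      Matrix (m × l) (m × l) A) (i, p) (j, q)
      = ∑ q', ∑ p', Z (i, p') (j, q') • (w p p' * w' q' q) := fun p q => by
    simp only [scalar, tensor, Matrix.mul_apply, Matrix.kroneckerMap_apply, Matrix.map_apply,
      Fintype.sum_prod_type, Matrix.one_apply, mul_ite, mul_zero, ite_mul, zero_mul,
      Finset.sum_ite_irrel, Finset.sum_const_zero, one_mul, Finset.sum_ite_eq, Finset.sum_ite_eq',
      Finset.mem_univ, if_true, Finset.sum_mul]
    refine Finset.sum_congr rfl fun q' _ => Finset.sum_congr rfl fun p' _ => ?_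
    rw [← Algebra.commutes, ← Algebra.smul_def, smul_mul_assoc]
  rw [scalar_ptrRight]
  simp only [ptrRight, Matrix.of_apply, e]
  calc ∑ p, ∑ q, M p q • ∑ q', ∑ p', Z (i, p') (j, q') • (w p p' * w' q' q)
      = ∑ p', ∑ q', Z (i, p') (j, q') • ∑ q, ∑ p, M p q • (w p p' * w' q' q) := by
        simp only [Finset.smul_sum]
        rw [sum_comm_pairs, Finset.sum_comm]
        refine Finset.sum_congr rfl fun _ _ => Finset.sum_congr rfl fun _ _ => ?_
        rw [Finset.sum_comm]
        exact Finset.sum_congr rfl fun _ _ => Finset.sum_congr rfl fun _ _ => smul_comm _ _ _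
    _ = _ := by
        simp only [← h', scalar, Matrix.map_apply, Algebra.algebraMap_eq_smul_one]
        exact Finset.sum_congr rfl fun _ _ => Finset.sum_congr rfl fun _ _ => smul_comm _ _ _

theorem ptrLeft_inner {M M' : Matrix m m ℂ} {w w' : Matrix m m A}
    (h : wᵀ * scalar A M * w'ᵀ = scalar A M') (Z : Matrix (m × l) (m × l) ℂ) :
    ptrLeft M (tensor w 1 * scalar A Z * tensor w' 1) = scalar A (ptrLeft M' Z) := by
  have e1 : ∀ (N : Matrix m m ℂ) (Y : Matrix (m × l) (m × l) A),
      ptrLeft N Y = ptrRight N (Y.submatrix Prod.swap Prod.swap) := fun _ _ => rfl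
  have e2 : ptrLeft M' Z = ptrRight M' (Z.submatrix Prod.swap Prod.swap) := rfl
  have e3 : ∀ (x : Matrix m m A), (tensor x (1 : Matrix l l A)).submatrix Prod.swap Prod.swap
      = tensor 1 x := fun x => by
    ext ⟨i, p⟩ ⟨j, q⟩
    simp [tensor, Matrix.one_apply]
  rw [e1, e2, ← ptrRight_inner h, ← e3, ← e3]
  have e4 : ∀ X Y : Matrix (m × l) (m × l) A, (X * Y).submatrix Prod.swap Prod.swap
      = X.submatrix Prod.swap Prod.swap * Y.submatrix (Prod.swap : l × m → m × l) Prod.swap :=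
    fun X Y => (Matrix.submatrix_mul_equiv X Y _ (Equiv.prodComm l m) _).symm
  rw [e4, e4]
  rfl

end PartialTrace

end CompactQuantumGroup

namespace CompactQuantumGroup

section Conjugate

variable {A : Type u} [CStarAlgebra A]
variable {k l m n : Type*} [Fintype k] [Fintype l] [Fintype m] [Fintype n]
  [DecidableEq k] [DecidableEq l] [DecidableEq m] [DecidableEq n]

/-! ### Quantum traces of intertwiners -/

theorem trace_mul_ptrRight (M : Matrix m m ℂ) (P : Matrix l l ℂ)
    (X : Matrix (m × l) (m × l) ℂ) :
    (Mᵀ * ptrRight P X).trace = ((Matrix.kronecker M P)ᵀ * X).trace := by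
  have e : ∀ i j p q, Matrix.kronecker M P (i, p) (j, q) = M i j * P p q := fun _ _ _ _ => rfl
  simp only [Matrix.trace, Matrix.diag_apply, Matrix.mul_apply, ptrRight, Matrix.of_apply,
    Matrix.transpose_apply, Fintype.sum_prod_type, e, Finset.mul_sum, smul_eq_mul, mul_assoc]
  refine Finset.sum_congr rfl fun j _ => ?_
  symm
  rw [Finset.sum_comm]
  refine Finset.sum_congr rfl fun i _ => ?_
  rw [Finset.sum_comm]

theorem trace_mul_ptrLeft (M : Matrix m m ℂ) (P : Matrix l l ℂ)
    (X : Matrix (m × l) (m × l) ℂ) :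
    (Pᵀ * ptrLeft M X).trace = ((Matrix.kronecker M P)ᵀ * X).trace := by
  have e : ∀ i j p q, Matrix.kronecker M P (i, p) (j, q) = M i j * P p q := fun _ _ _ _ => rfl
  simp only [Matrix.trace, Matrix.diag_apply, Matrix.mul_apply, ptrLeft, Matrix.of_apply,
    Matrix.transpose_apply, Fintype.sum_prod_type, e, Finset.mul_sum, smul_eq_mul]
  symm
  rw [Finset.sum_comm]
  refine Finset.sum_congr rfl fun q _ => ?_
  rw [Finset.sum_comm]
  symm
  rw [Finset.sum_comm]
  refine Finset.sum_congr rfl fun i _ => ?_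
  rw [Finset.sum_comm]
  refine Finset.sum_congr rfl fun j _ => Finset.sum_congr rfl fun p _ => ?_
  ring

theorem eq_zero_of_trace_eq_zero {D : Matrix n n ℂ} (hD : D.PosDef) {W : Matrix m n ℂ}
    (h : (W * D * Wᴴ).trace = 0) : W = 0 := by
  have e : W * D * Wᴴ = (W * CFC.sqrt D) * (W * CFC.sqrt D)ᴴ := by
    rw [Matrix.conjTranspose_mul, sqrt_conjTranspose hD]
    conv_lhs => rw [← sqrt_mul_sqrt hD]
    simp only [Matrix.mul_assoc]
  rw [e, Matrix.trace_mul_conjTranspose_self_eq_zero_iff] at h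
  calc W = W * CFC.sqrt D * (CFC.sqrt D)⁻¹ := by
        rw [Matrix.mul_assoc, sqrt_mul_inv hD, Matrix.mul_one]
    _ = 0 := by rw [h, Matrix.zero_mul]

/-- The rows of an operator with values in `H_m ⊗ H_l`, indexed by `H_m`. -/
def rows (v : Matrix (m × l) n ℂ) : Matrix m (n × l) ℂ :=
  Matrix.of fun i q => v (i, q.2) q.1

/-- Writes the partial trace as a congruence, from which positivity and definiteness can be read
off. -/
theorem ptrRight_conj (N : Matrix n n ℂ) (M : Matrix l l ℂ) (v : Matrix (m × l) n ℂ) :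
    ptrRight M (v * N * vᴴ) = rows v * Matrix.kronecker N M * (rows v)ᴴ := by
  have e : ∀ i j p q, Matrix.kronecker N M (i, p) (j, q) = N i j * M p q := fun _ _ _ _ => rfl
  ext i j
  simp only [ptrRight, rows, Matrix.of_apply, Matrix.mul_apply, Matrix.conjTranspose_apply,
    Fintype.sum_prod_type, e, Finset.sum_mul, smul_eq_mul, Finset.mul_sum]
  rw [Finset.sum_comm]
  refine (Finset.sum_congr rfl fun q _ => Finset.sum_comm).trans ?_
  rw [Finset.sum_comm]
  refine Finset.sum_congr rfl fun b _ => Finset.sum_congr rfl fun q _ => ?_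
  rw [Finset.sum_comm]
  refine Finset.sum_congr rfl fun a _ => Finset.sum_congr rfl fun p _ => ?_
  ring

variable {G : CompactQuantumGroup A} {α : Matrix n n A} {β : Matrix m m A} {γ : Matrix l l A}

theorem mem_hom_self_iff_left {T : Matrix n n A} (hT : T ∈ unitary (Matrix n n A))
    {X : Matrix n n ℂ} : X ∈ Hom T T ↔ T * scalar A X * Tᴴ = scalar A X := by
  have h1 : Tᴴ * T = 1 := (Unitary.mem_iff.1 hT).1
  have h2 : T * Tᴴ = 1 := (Unitary.mem_iff.1 hT).2
  simp only [Hom, Set.mem_ofPred_eq]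
  refine ⟨fun h => by rw [h, Matrix.mul_assoc, h2, Matrix.mul_one], fun h => ?_⟩
  conv_rhs => rw [← h, Matrix.mul_assoc, h1, Matrix.mul_one]

theorem mem_hom_self_iff_right {T : Matrix n n A} (hT : T ∈ unitary (Matrix n n A))
    {X : Matrix n n ℂ} : X ∈ Hom T T ↔ Tᴴ * scalar A X * T = scalar A X := by
  have h1 : Tᴴ * T = 1 := (Unitary.mem_iff.1 hT).1
  have h2 : T * Tᴴ = 1 := (Unitary.mem_iff.1 hT).2
  simp only [Hom, Set.mem_ofPred_eq]
  refine ⟨fun h => by rw [Matrix.mul_assoc, ← h, ← Matrix.mul_assoc, h1, Matrix.one_mul],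
    fun h => ?_⟩
  conv_lhs => rw [← h, ← Matrix.mul_assoc, ← Matrix.mul_assoc, h2, Matrix.one_mul]

theorem tensor_conjTranspose (β : Matrix m m A) (γ : Matrix l l A) :
    (tensor β γ)ᴴ = tensor 1 γᴴ * tensor βᴴ 1 := by
  rw [tensor_eq_mul, Matrix.conjTranspose_mul, tensor_one_left_conjTranspose,
    tensor_one_right_conjTranspose]

theorem tensor_transpose (β : Matrix m m A) (γ : Matrix l l A) :
    (tensor β γ)ᵀ = tensor βᵀ 1 * tensor 1 γᵀ := by
  rw [← tensor_eq_mul]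
  rfl

theorem tensor_map_star (β : Matrix m m A) (γ : Matrix l l A) :
    (tensor β γ).map star = tensor 1 (γ.map star) * tensor (β.map star) 1 := by
  ext ⟨i, p⟩ ⟨j, q⟩
  simp [tensor, Matrix.mul_apply, Fintype.sum_prod_type, Matrix.one_apply]

/-- In T X T^* = X with T = (β ⊗ 1)(1 ⊗ γ), the factor γ is the inner one. The weight P absorbs it,
so the partial trace is a self-intertwiner of β. -/
theorem exists_ptrRight_eq (hβ : G.IsIrrep β) (hγ : γ ∈ unitary (Matrix l l A))
    {P : Matrix l l ℂ} (hP : IsModular γ P) {X : Matrix (m × l) (m × l) ℂ}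
    (hX : X ∈ Hom (tensor β γ) (tensor β γ)) : ∃ c : ℂ, ptrRight P X = c • 1 := by
  refine hβ.2.2 _ ((mem_hom_self_iff_left hβ.1.2).2 ?_)
  have h := (mem_hom_self_iff_left (tensor_mem_unitary hβ.1.2 hγ)).1 hX
  rw [tensor_conjTranspose, tensor_eq_mul β γ] at h
  conv_rhs => rw [scalar_ptrRight, ← h]
  rw [← ptrRight_inner (w := γ) (w' := γᴴ) hP.left, ← ptrRight_outer]
  simp only [Matrix.mul_assoc]

/-- Here T^* X T = X is used instead, in which β is the inner factor; accordingly the invariant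
weight is Q⁻¹ rather than Q. -/
theorem exists_ptrLeft_eq (hβ : β ∈ unitary (Matrix m m A)) (hγ : G.IsIrrep γ)
    {Q : Matrix m m ℂ} (hQ : IsModular β Q) {X : Matrix (m × l) (m × l) ℂ}
    (hX : X ∈ Hom (tensor β γ) (tensor β γ)) : ∃ c : ℂ, ptrLeft Q⁻¹ X = c • 1 := by
  refine hγ.2.2 _ ((mem_hom_self_iff_right hγ.1.2).2 ?_)
  have h := (mem_hom_self_iff_right (tensor_mem_unitary hβ hγ.1.2)).1 hX
  rw [tensor_conjTranspose, tensor_eq_mul β γ] at h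
  conv_rhs => rw [scalar_ptrLeft, ← h]
  rw [← ptrLeft_inner (w := βᴴ) (w' := β) hQ.right, ← ptrLeft_outer]
  simp only [Matrix.mul_assoc]

theorem mul_conjTranspose_mem_hom (hα : α ∈ unitary (Matrix n n A))
    (hβ : β ∈ unitary (Matrix m m A)) (hγ : γ ∈ unitary (Matrix l l A))
    {v : Matrix (m × l) n ℂ} (hv : v ∈ Hom α (tensor β γ)) :
    v * vᴴ ∈ Hom (tensor β γ) (tensor β γ) :=
  mul_mem_hom hv (conjTranspose_mem_hom hα (tensor_mem_unitary hβ hγ) hv)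

theorem map_star_eq_conjTranspose_transpose (X : Matrix m n ℂ) : X.map star = Xᴴᵀ := rfl

theorem conjTranspose_map_star_complex (X : Matrix m n ℂ) : (X.map star)ᴴ = Xᵀ := by
  ext; simp

theorem transpose_mul_map_star {U : Matrix m m A} {R : Matrix m n ℂ} (hR : Rᴴ ∈ Hom U α) :
    Uᵀ * scalar A (R.map star) = scalar A (R.map star) * αᵀ := by
  have h := congrArg Matrix.transpose hR
  rw [transpose_mul_scalar, transpose_scalar_mul] at h
  exact h.symm

theorem mul_map_star_transpose {U : Matrix m m A} {R : Matrix m n ℂ} (hR : R ∈ Hom α U) :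
    scalar A Rᵀ * Uᵀ = αᵀ * scalar A Rᵀ := by
  have h := congrArg Matrix.transpose hR
  rwa [transpose_mul_scalar, transpose_scalar_mul] at h

/-- If `α ⊆ β ⊗ γ` and the contragredients of `α` and `γ` are unitarizable, then so is that of the
irreducible representation `β`. -/
theorem exists_isModular (hα : α ∈ unitary (Matrix n n A)) (hβ : G.IsIrrep β)
    (hγ : γ ∈ unitary (Matrix l l A)) {Q : Matrix n n ℂ} (hQ : IsModular α Q) {P : Matrix l l ℂ}
    (hP : IsModular γ P) {v : Matrix (m × l) n ℂ} (hv : v ∈ Hom α (tensor β γ)) (hv0 : v ≠ 0) :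
    ∃ K, IsModular β K := by
  have := hβ.2.1
  have hT := tensor_mem_unitary hβ.1.2 hγ
  -- `βᵀ K β^c = K` with `K` positive definite
  set K := ptrRight 1 (v.map star * Q * (v.map star)ᴴ) with hK
  have hKl : βᵀ * scalar A K * β.map star = scalar A K := by
    set Z := v.map star * Q * (v.map star)ᴴ with hZ
    have e : (tensor β γ)ᵀ * scalar A Z * (tensor β γ).map star = scalar A Z := by
      have h1 := transpose_mul_map_star (conjTranspose_mem_hom hα hT hv)
      have h2 : scalar A (v.map star)ᴴ * (tensor β γ).map star
          = α.map star * scalar A (v.map star)ᴴ := by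
        have := map_star_mem_hom (conjTranspose_mem_hom hα hT hv)
        exact this.symm
      rw [hZ, scalar_mul, scalar_mul, ← Matrix.mul_assoc, ← Matrix.mul_assoc, h1,
        Matrix.mul_assoc, h2]
      rw [← Matrix.mul_assoc, Matrix.mul_assoc (scalar A _) αᵀ, Matrix.mul_assoc (scalar A _),
        hQ.left]
    rw [tensor_transpose, tensor_map_star] at e
    have hin : (γᵀ)ᵀ * scalar A 1 * (γ.map star)ᵀ = scalar A 1 := by
      rw [Matrix.transpose_transpose, scalar_one, Matrix.mul_one]
      exact (Unitary.mem_iff.1 hγ).2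
    conv_rhs => rw [hK, scalar_ptrRight, ← e]
    rw [hK, ← ptrRight_inner hin, ← ptrRight_outer]
    simp only [Matrix.mul_assoc]
  -- K is a congruence of Q ⊗ 1 by the conjugate of `rows v`, so it is definite once `rows v` has a
  -- right inverse. Irreducibility of β supplies one: the P-weighted partial trace of v v^* is a
  -- scalar, nonzero since v ≠ 0.
  have hKp : K.PosDef := by
    obtain ⟨c, hc⟩ := exists_ptrRight_eq hβ hγ hP (mul_conjTranspose_mem_hom hα hβ.1.2 hγ hv)
    have h1 : rows v * Matrix.kronecker (1 : Matrix n n ℂ) P * (rows v)ᴴ = c • 1 := by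
      rw [← hc, ← ptrRight_conj, Matrix.mul_one]
    have hrows : ∀ w : Matrix (m × l) n ℂ, rows w = 0 → w = 0 := fun w hw => by
      ext ⟨i, p⟩ a
      exact congrFun (congrFun hw i) (a, p)
    have hc0 : c ≠ 0 := by
      rintro rfl
      refine hv0 (hrows v (eq_zero_of_trace_eq_zero (Matrix.PosDef.one.kronecker hP.posDef) ?_))
      refine (congrArg Matrix.trace h1).trans ?_
      rw [zero_smul, Matrix.trace_zero]
    rw [hK, ptrRight_conj]
    refine (hQ.posDef.kronecker Matrix.PosDef.one).mul_mul_conjTranspose_same ?_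
    have h2 : rows (v.map star) = (rows v).map star := rfl
    have h3 : (rows v).map star * (c⁻¹ • (Matrix.kronecker (1 : Matrix n n ℂ) P * (rows v)ᴴ)).map star = 1 := by
      rw [← map_star_mul, Matrix.mul_smul, ← Matrix.mul_assoc, h1, smul_smul,
        inv_mul_cancel₀ hc0, one_smul]
      exact Matrix.map_one _ (by simp) (by simp)
    intro x y hxy
    have := congrArg (fun z => Matrix.vecMul z
      ((c⁻¹ • (Matrix.kronecker (1 : Matrix n n ℂ) P * (rows v)ᴴ)).map star)) hxy
    simpa only [h2, Matrix.vecMul_vecMul, h3, Matrix.vecMul_one] using this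
  -- `β^c K' βᵀ = K'`; by irreducibility `K'` is a multiple of `K⁻¹`
  set R := frob Q P v with hR
  have hRm : R ∈ Hom (conjBy P γ) (tensor (conjBy Q α) β) := (frob_mem_hom_iff hQ hP).2 hv
  have hαc := (isModular_iff hQ.posDef).1 hQ
  set K' := ptrLeft 1 (R.map star * Pᵀ * (R.map star)ᴴ) with hK'
  -- K alone makes K^{1/2} β^c K^{-1/2} an isometry. The coisometry relation comes from the
  -- Frobenius partner R : γ̄ → ᾱ ⊗ β, where β is the second factor and the unitary ᾱ can be traced
  -- out with weight 1.
  have hK'r : β.map star * scalar A K' * βᵀ = scalar A K' := by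
    set Z := R.map star * Pᵀ * (R.map star)ᴴ with hZ
    set γ' := conjBy P γ with hγ'
    have e0 : γ'.map star * scalar A Pᵀ * γ'ᵀ = scalar A Pᵀ := by
      set S := CFC.sqrt P with hS
      have hSt : S.map star = Sᵀ := by
        rw [map_star_eq_conjTranspose_transpose, sqrt_conjTranspose hP.posDef]
      have hSt' : S⁻¹.map star = S⁻¹ᵀ := by
        rw [map_star_eq_conjTranspose_transpose, inv_sqrt_conjTranspose hP.posDef]
      have h1 : γ'.map star = scalar A Sᵀ * γ * scalar A S⁻¹ᵀ := by
        rw [hγ', conjBy, map_star_mul_scalar, map_star_scalar_mul, contragredient,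
          map_star_map_star, hSt, hSt']
      have h2 : γ'ᵀ = scalar A S⁻¹ᵀ * (γᴴ * scalar A Sᵀ) := by
        rw [hγ', conjBy, transpose_mul_scalar, transpose_scalar_mul]
        rfl
      have h3 : scalar A S⁻¹ᵀ * scalar A Pᵀ * scalar A S⁻¹ᵀ = 1 := by
        rw [← scalar_mul, ← scalar_mul, ← Matrix.transpose_mul, ← Matrix.transpose_mul,
          ← sqrt_mul_sqrt hP.posDef, ← hS, Matrix.mul_assoc, sqrt_mul_inv hP.posDef,
          Matrix.mul_one, inv_mul_sqrt hP.posDef, Matrix.transpose_one, scalar_one]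
      have h4 : γ * γᴴ = 1 := (Unitary.mem_iff.1 hγ).2
      calc γ'.map star * scalar A Pᵀ * γ'ᵀ = scalar A Sᵀ * γ *
            (scalar A S⁻¹ᵀ * scalar A Pᵀ * scalar A S⁻¹ᵀ) * (γᴴ * scalar A Sᵀ) := by
            rw [h1, h2]
            simp only [Matrix.mul_assoc]
        _ = scalar A Sᵀ * (γ * γᴴ) * scalar A Sᵀ := by
          rw [h3, Matrix.mul_one]
          simp only [Matrix.mul_assoc]
        _ = _ := by
          rw [h4, Matrix.mul_one, ← scalar_mul, ← Matrix.transpose_mul, hS,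
            sqrt_mul_sqrt hP.posDef]
    have e : (tensor (conjBy Q α) β).map star * scalar A Z * (tensor (conjBy Q α) β)ᵀ
        = scalar A Z := by
      have h1 : (tensor (conjBy Q α) β).map star * scalar A (R.map star)
          = scalar A (R.map star) * γ'.map star := map_star_mem_hom hRm
      have h2 : scalar A (R.map star)ᴴ * (tensor (conjBy Q α) β)ᵀ
          = γ'ᵀ * scalar A (R.map star)ᴴ := by
        have := mul_map_star_transpose hRm
        rwa [← conjTranspose_map_star_complex] at this
      rw [hZ, scalar_mul, scalar_mul, ← Matrix.mul_assoc, ← Matrix.mul_assoc, h1,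
        Matrix.mul_assoc, h2]
      rw [← Matrix.mul_assoc, Matrix.mul_assoc (scalar A _) (γ'.map star),
        Matrix.mul_assoc (scalar A _), e0]
    rw [tensor_transpose, tensor_map_star] at e
    have hin : ((conjBy Q α).map star)ᵀ * scalar A 1 * ((conjBy Q α)ᵀ)ᵀ = scalar A 1 := by
      rw [Matrix.transpose_transpose, scalar_one, Matrix.mul_one]
      exact (Unitary.mem_iff.1 hαc).1
    conv_rhs => rw [hK', scalar_ptrLeft, ← e]
    rw [hK', ← ptrLeft_inner hin, ← ptrLeft_outer]
    simp only [Matrix.mul_assoc]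
  have hK'0 : K' ≠ 0 := by
    intro h0
    have h1 := trace_mul_ptrLeft 1 1 (R.map star * Pᵀ * (R.map star)ᴴ)
    rw [← hK', h0, Matrix.mul_zero, Matrix.trace_zero, Matrix.kronecker, Matrix.one_kronecker_one,
      Matrix.transpose_one, Matrix.one_mul] at h1
    have h2 := eq_zero_of_trace_eq_zero hP.posDef.transpose h1.symm
    have h3 : R = 0 := by
      rw [← map_star_map_star R, h2]
      exact Matrix.map_zero _ (star_zero _)
    refine hv0 (frob_injective hQ.posDef hP.posDef (h3.trans frob_zero.symm))
  obtain ⟨c, hc⟩ := hβ.eq_smul_one_of_mem_hom_contragredient (X := K' * K) (by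
    simp only [Hom, Set.mem_ofPred_eq, contragredient]
    rw [scalar_mul]
    conv_lhs => rw [← hKl]
    conv_rhs => rw [← hK'r]
    simp only [Matrix.mul_assoc])
  have hK'K : K' = c • K⁻¹ := by
    calc K' = K' * K * K⁻¹ := by rw [Matrix.mul_assoc, posDef_mul_inv hKp, Matrix.mul_one]
      _ = _ := by rw [hc, Matrix.smul_mul, Matrix.one_mul]
  have hc0 : c ≠ 0 := by
    rintro rfl
    exact hK'0 (by rw [hK'K, zero_smul])
  refine ⟨K, hKp, hKl, ?_⟩
  rw [hK'K, scalar_smul, Matrix.mul_smul, Matrix.smul_mul] at hK'r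
  exact smul_right_injective _ hc0 hK'r

end Conjugate

end CompactQuantumGroup

/-- The extreme points of a simplex spanned by linearly independent vectors. -/
theorem extremePoints_simplex {ι E : Type*} [Fintype ι] [DecidableEq ι] [AddCommGroup E]
    [Module ℂ E] [Module ℝ E] [IsScalarTower ℝ ℂ E] {f : ι → E} (hf : LinearIndependent ℂ f)
    {s : ℝ} (hs : 0 < s) :
    {x | ∃ t : ι → ℝ, (∀ j, 0 ≤ t j) ∧ ∑ j, t j = s ∧ x = ∑ j, (t j : ℂ) • f j}.extremePoints ℝ
      = Set.range fun j => (s : ℂ) • f j := by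
  have hsm : ∀ (r : ℝ) (x : E), (r : ℂ) • x = r • x := fun r x => algebraMap_smul ℂ r x
  set S := {x | ∃ t : ι → ℝ, (∀ j, 0 ≤ t j) ∧ ∑ j, t j = s ∧ x = ∑ j, (t j : ℂ) • f j} with hS
  have hmem : ∀ j, (s : ℂ) • f j ∈ S := fun j => by
    refine ⟨Pi.single j s, fun i => ?_, by simp, ?_⟩
    · by_cases h : i = j
      · subst h; simpa using hs.le
      · simp [h]
    · rw [Fintype.sum_eq_single j]
      · simp
      · intro i hi
        simp [hi]
  have hconv : Convex ℝ S := by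
    rintro x ⟨t, ht, ht1, rfl⟩ y ⟨t', ht', ht1', rfl⟩ a b ha hb hab
    refine ⟨fun j => a * t j + b * t' j, fun j => ?_, ?_, ?_⟩
    · have := ht j; have := ht' j; positivity
    · rw [Finset.sum_add_distrib, ← Finset.mul_sum, ← Finset.mul_sum, ht1, ht1', ← add_mul, hab,
        one_mul]
    · rw [Finset.smul_sum, Finset.smul_sum, ← Finset.sum_add_distrib]
      refine Finset.sum_congr rfl fun j _ => ?_
      rw [hsm, hsm, hsm, add_smul, mul_smul, mul_smul]
  refine Set.Subset.antisymm ?_ ?_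
  · have h : S = convexHull ℝ (Set.range fun j => (s : ℂ) • f j) := by
      refine Set.Subset.antisymm ?_ (convexHull_min (by rintro _ ⟨j, rfl⟩; exact hmem j) hconv)
      rintro x ⟨t, ht, ht1, rfl⟩
      have e : ∑ j, (t j : ℂ) • f j = ∑ j, (t j / s) • ((s : ℂ) • f j) := by
        refine Finset.sum_congr rfl fun j _ => ?_
        rw [hsm, hsm, smul_smul, div_mul_cancel₀ _ hs.ne']
      rw [e]
      refine (convex_convexHull ℝ _).sum_mem (fun j _ => div_nonneg (ht j) hs.le) ?_
        fun j _ => subset_convexHull ℝ _ ⟨j, rfl⟩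
      rw [← Finset.sum_div, ht1, div_self hs.ne']
    rw [h]
    exact extremePoints_convexHull_subset
  · rintro _ ⟨j, rfl⟩
    rw [mem_extremePoints_iff_left]
    refine ⟨hmem j, ?_⟩
    rintro _ ⟨t, ht, ht1, rfl⟩ _ ⟨t', ht', -, rfl⟩ ⟨a, b, ha, hb, -, hab⟩
    -- By linear independence the i-th coefficients satisfy a t_i + b t'_i = 0 with a, b > 0, and
    -- both summands are nonnegative.
    have h0 : ∀ i, i ≠ j → t i = 0 := fun i hi => by
      have e : ∑ k, (((a * t k + b * t' k - (if k = j then s else 0) : ℝ)) : ℂ) • f k = 0 := by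
        simp only [hsm, sub_smul, add_smul, mul_smul, Finset.sum_sub_distrib,
          Finset.sum_add_distrib, ite_smul, zero_smul, Finset.sum_ite_eq', Finset.mem_univ,
          if_true]
        simp only [hsm, Finset.smul_sum] at hab
        rw [hab, sub_self]
      have := Fintype.linearIndependent_iff.1 hf _ e i
      rw [if_neg hi, sub_zero] at this
      have h1 : a * t i + b * t' i = 0 := by exact_mod_cast this
      have h2 := mul_nonneg ha.le (ht i)
      have h3 := mul_nonneg hb.le (ht' i)
      have h4 : a * t i = 0 := by linarith
      exact (mul_eq_zero.1 h4).resolve_left ha.ne'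
    rw [Fintype.sum_eq_single j fun i hi => h0 i hi] at ht1
    rw [Fintype.sum_eq_single j fun i hi => by rw [h0 i hi]; simp, ht1]

/-- Every idempotent matrix splits. -/
theorem exists_splitting {m : Type*} [Fintype m] [DecidableEq m] {p : Matrix m m ℂ}
    (hp : p * p = p) : ∃ (d : ℕ) (t : Matrix m (Fin d) ℂ) (t' : Matrix (Fin d) m ℂ),
      t' * t = 1 ∧ t * t' = p := by
  set f := Matrix.toLin' p with hf
  have hff : ∀ x, f (f x) = f x := fun x => by
    rw [hf, ← Matrix.toLin'_mul_apply, hp]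
  let b := Module.finBasis ℂ (LinearMap.range f)
  refine ⟨_, LinearMap.toMatrix b (Pi.basisFun ℂ m) (LinearMap.range f).subtype,
    LinearMap.toMatrix (Pi.basisFun ℂ m) b f.rangeRestrict, ?_, ?_⟩
  · rw [← LinearMap.toMatrix_comp, ← LinearMap.toMatrix_id b]
    congr 1
    ext ⟨x, y, rfl⟩
    simp [hff]
  · rw [← LinearMap.toMatrix_comp]
    have : (LinearMap.range f).subtype ∘ₗ f.rangeRestrict = f := rfl
    rw [this, hf, LinearMap.toMatrix_eq_toMatrix', LinearMap.toMatrix'_toLin']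

namespace CompactQuantumGroup

/-! ### Quantum dimensions and normalization of the Clebsch–Gordan maps -/

section Dimension

variable {A : Type u} [CStarAlgebra A]
variable {k l m n : Type*} [Fintype k] [Fintype l] [Fintype m] [Fintype n]
  [DecidableEq k] [DecidableEq l] [DecidableEq m] [DecidableEq n]
variable {G : CompactQuantumGroup A} {α : Matrix n n A} {β : Matrix m m A} {γ : Matrix l l A}

theorem tensor_right_comm_scalar (w : Matrix m m A) (X : Matrix n n ℂ) :
    tensor w 1 * tensor 1 (scalar A X) = tensor 1 (scalar A X) * tensor w 1 := by
  ext ⟨i, k⟩ ⟨j, l⟩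
  simp [tensor, scalar, Matrix.mul_apply, Fintype.sum_prod_type, Matrix.one_apply,
    Algebra.commutes]

theorem scalar_kronecker (X : Matrix n n ℂ) (Y : Matrix m m ℂ) :
    scalar A (Matrix.kronecker X Y) = tensor (scalar A X) 1 * tensor 1 (scalar A Y) := by
  rw [← tensor_eq_mul]
  ext ⟨i, k⟩ ⟨j, l⟩
  simp [tensor, scalar, Matrix.kronecker]

/-- v^c intertwines the transposes of α and β ⊗ γ, hence also their inverses. These are the
contragredients conjugated by Q_α and by Q ⊗ P, which gives a second intertwiner of contragredients
besides v^c. -/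
theorem modular_mem_hom (hα : IsModular α (G.qMatrix α)) (hαu : α ∈ unitary (Matrix n n A))
    {Q : Matrix m m ℂ} (hβ : IsModular β Q) (hβu : β ∈ unitary (Matrix m m A))
    {P : Matrix l l ℂ} (hγ : IsModular γ P) (hγu : γ ∈ unitary (Matrix l l A))
    {v : Matrix (m × l) n ℂ} (hv : v ∈ Hom α (tensor β γ)) :
    Matrix.kronecker Q⁻¹ P⁻¹ * v.map star * G.qMatrix α
      ∈ Hom (contragredient α) (contragredient (tensor β γ)) := by
  set D := G.qMatrix α
  have h1 := transpose_mul_map_star (conjTranspose_mem_hom hαu (tensor_mem_unitary hβu hγu) hv)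
  have h2 : tensor 1 (dual P γ) * tensor (dual Q β) 1 * (tensor β γ)ᵀ = 1 := by
    rw [tensor_transpose, Matrix.mul_assoc, ← Matrix.mul_assoc (tensor (dual Q β) 1),
      ← tensor_one_right_mul, hβ.dual_mul_transpose, tensor_one_one, Matrix.one_mul,
      ← tensor_one_left_mul, hγ.dual_mul_transpose, tensor_one_one]
  have h3 : scalar A (v.map star) * dual D α
      = tensor 1 (dual P γ) * tensor (dual Q β) 1 * scalar A (v.map star) := by
    calc scalar A (v.map star) * dual D α
        = tensor 1 (dual P γ) * tensor (dual Q β) 1 * (tensor β γ)ᵀ * scalar A (v.map star)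
          * dual D α := by rw [h2, Matrix.one_mul]
      _ = tensor 1 (dual P γ) * tensor (dual Q β) 1 * scalar A (v.map star) * (αᵀ * dual D α) := by
        rw [Matrix.mul_assoc _ (tensor β γ)ᵀ, h1]
        simp only [Matrix.mul_assoc]
      _ = _ := by rw [hα.transpose_mul_dual, Matrix.mul_one]
  have h4 : tensor 1 (dual P γ) * tensor (dual Q β) 1
      = scalar A (Matrix.kronecker Q P) * (contragredient (tensor β γ)
        * scalar A (Matrix.kronecker Q⁻¹ P⁻¹)) := by
    rw [contragredient, tensor_map_star, scalar_kronecker, scalar_kronecker, dual, dual,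
      tensor_one_left_mul, tensor_one_left_mul, tensor_one_right_mul, tensor_one_right_mul]
    change _ = _ * (tensor 1 (contragredient γ) * tensor (contragredient β) 1 * _)
    rw [← tensor_one_comm_scalar (scalar A P⁻¹), ← tensor_one_comm_scalar (scalar A P)]
    simp only [Matrix.mul_assoc]
    rw [← Matrix.mul_assoc (tensor 1 (scalar A P⁻¹)) (tensor (scalar A Q) 1),
      tensor_one_comm_scalar, Matrix.mul_assoc,
      ← Matrix.mul_assoc (tensor 1 (contragredient γ)) (tensor (scalar A Q) 1),
      tensor_one_comm_scalar, Matrix.mul_assoc,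
      ← Matrix.mul_assoc (tensor 1 (scalar A P⁻¹)) (tensor (contragredient β) 1),
      ← tensor_right_comm_scalar, Matrix.mul_assoc]
  have h5 : scalar A (Matrix.kronecker Q⁻¹ P⁻¹) * scalar A (Matrix.kronecker Q P) = 1 := by
    rw [← scalar_mul]
    unfold Matrix.kronecker
    rw [← Matrix.mul_kronecker_mul, posDef_inv_mul hβ.posDef, posDef_inv_mul hγ.posDef,
      Matrix.one_kronecker_one, scalar_one]
  have h6 : scalar A D⁻¹ * scalar A D = 1 := by
    rw [← scalar_mul, posDef_inv_mul hα.posDef, scalar_one]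
  simp only [Hom, Set.mem_ofPred_eq]
  rw [scalar_mul, scalar_mul]
  rw [h4, dual] at h3
  have h7 := congrArg (fun M => scalar A (Matrix.kronecker Q⁻¹ P⁻¹) * M * scalar A D) h3
  simp only [Matrix.mul_assoc, h6, Matrix.mul_one] at h7
  rw [← Matrix.mul_assoc _ (scalar A (Matrix.kronecker Q P)), h5, Matrix.one_mul] at h7
  simp only [Matrix.mul_assoc]
  exact h7.symm

/-- The quantum dimension is compatible with intertwiners `α → β ⊗ γ`. -/
theorem ptrRight_mul_conjTranspose (hα : G.IsIrrep α) (hβ : G.IsIrrep β) (hγ : G.IsIrrep γ)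
    (hQα : G.IsQMatrix α (G.qMatrix α)) (hQβ : G.IsQMatrix β (G.qMatrix β))
    (hQγ : G.IsQMatrix γ (G.qMatrix γ)) {v : Matrix (m × l) n ℂ}
    (hv : IsIsometricIntertwiner α (tensor β γ) v)
    (hmul : ∀ w ∈ Hom α (tensor β γ), ∃ c : ℂ, w = c • v) :
    ptrRight (G.qMatrix γ) (v * vᴴ) = (G.qDim α / G.qDim β) • 1 := by
  have := hα.2.1
  have := hβ.2.1
  have hX := mul_conjTranspose_mem_hom hα.1.2 hβ.1.2 hγ.1.2 hv.1
  obtain ⟨x, hx⟩ := exists_ptrRight_eq hβ hγ.1.2 hQγ.isModular hX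
  obtain ⟨y, hy⟩ := exists_ptrLeft_eq hβ.1.2 hγ hQβ.isModular hX
  have tα := trace_qMatrix hQα
  have tβ := trace_qMatrix hQβ
  have tγ := trace_qMatrix hQγ
  have hw := modular_mem_hom hQα.isModular hα.1.2 hQβ.isModular hβ.1.2 hQγ.isModular hγ.1.2 hv.1
  have pα := hQα.posDef
  have pβ := hQβ.posDef
  have pγ := hQγ.posDef
  simp only [qDim]
  set P := G.qMatrix γ
  set Q := G.qMatrix β
  set D := G.qMatrix α
  -- Multiplicity one compares the two intertwiners α^c → (β ⊗ γ)^c.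
  obtain ⟨c', hc'⟩ := hmul _ (mem_hom_of_map_star hw)
  obtain ⟨c, hc⟩ : ∃ c : ℂ, Matrix.kronecker Q⁻¹ P⁻¹ * v.map star * D = c • v.map star := by
    refine ⟨star c', ?_⟩
    rw [← map_star_map_star (_ * D), hc']
    ext; simp
  have hvv : vᵀ * v.map star = 1 := by
    have : vᵀ = vᴴ.map star := by ext; simp
    rw [this, ← map_star_mul, hv.2]
    exact Matrix.map_one _ (by simp) (by simp)
  have hPQ : Matrix.kronecker Q P * Matrix.kronecker Q⁻¹ P⁻¹ = 1 := by
    unfold Matrix.kronecker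
    rw [← Matrix.mul_kronecker_mul, posDef_mul_inv pβ, posDef_mul_inv pγ,
      Matrix.one_kronecker_one]
  have e1 : D = c • (vᵀ * (Matrix.kronecker Q P * v.map star)) := by
    calc D = vᵀ * (Matrix.kronecker Q P * Matrix.kronecker Q⁻¹ P⁻¹ * v.map star * D) := by
          rw [hPQ, Matrix.one_mul, ← Matrix.mul_assoc, hvv, Matrix.one_mul]
      _ = vᵀ * (Matrix.kronecker Q P * (Matrix.kronecker Q⁻¹ P⁻¹ * v.map star * D)) := by
          simp only [Matrix.mul_assoc]
      _ = _ := by rw [hc, Matrix.mul_smul, Matrix.mul_smul]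
  have e2 : vᵀ * (Matrix.kronecker Q⁻¹ P⁻¹ * v.map star) = c • D⁻¹ := by
    calc vᵀ * (Matrix.kronecker Q⁻¹ P⁻¹ * v.map star)
        = vᵀ * (Matrix.kronecker Q⁻¹ P⁻¹ * v.map star * D * D⁻¹) := by
          rw [Matrix.mul_assoc _ D, posDef_mul_inv pα, Matrix.mul_one]
      _ = _ := by
        rw [hc, Matrix.smul_mul, Matrix.mul_smul, ← Matrix.mul_assoc, hvv, Matrix.one_mul]
  have htr : ∀ K : Matrix (m × l) (m × l) ℂ,
      (vᵀ * (K * v.map star)).trace = (Kᵀ * (v * vᴴ)).trace := fun K => by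
    have : v.map star = vᴴᵀ := rfl
    rw [← Matrix.mul_assoc Kᵀ, Matrix.trace_mul_comm (Kᵀ * v), ← Matrix.trace_transpose (vᴴ * _),
      Matrix.transpose_mul, Matrix.transpose_mul, Matrix.transpose_transpose, Matrix.mul_assoc,
      this]
  have f1 : (vᵀ * (Matrix.kronecker Q P * v.map star)).trace = x * Q.trace := by
    rw [htr, ← trace_mul_ptrRight, hx, Matrix.mul_smul, Matrix.mul_one, Matrix.trace_smul,
      Matrix.trace_transpose, smul_eq_mul]
  -- The left partial trace is the scalar y, so P⁻¹ may be replaced by P at no cost, Tr P⁻¹ being Tr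
  -- P; then the right partial trace is the scalar x and Tr Q⁻¹ = Tr Q.
  have f2 : (vᵀ * (Matrix.kronecker Q⁻¹ P⁻¹ * v.map star)).trace = x * Q.trace := by
    rw [htr, ← trace_mul_ptrLeft, hy, Matrix.mul_smul, Matrix.mul_one, Matrix.trace_smul,
      Matrix.trace_transpose, ← tγ, ← Matrix.trace_transpose P, ← Matrix.trace_smul,
      ← Matrix.mul_one Pᵀ, ← Matrix.mul_smul, ← hy, trace_mul_ptrLeft, ← trace_mul_ptrRight, hx,
      Matrix.mul_smul, Matrix.mul_one, Matrix.trace_smul, Matrix.trace_transpose, ← tβ,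
      smul_eq_mul]
  have g1 : D.trace = c * (x * Q.trace) := by
    rw [← f1, ← smul_eq_mul, ← Matrix.trace_smul, ← e1]
  have g2 : x * Q.trace = c * D.trace := by
    rw [← f2, e2, Matrix.trace_smul, ← tα, smul_eq_mul]
  have hD := pα.trace_pos
  have hQ := pβ.trace_pos
  have hpos : 0 ≤ x * Q.trace := by
    rw [← f1]
    have := ((pβ.kronecker pγ).posSemidef.conjTranspose_mul_mul_same (v.map star)).trace_nonneg
    rw [conjTranspose_map_star_complex, Matrix.mul_assoc] at this
    exact this
  -- Eliminating c shows that x Tr Q and Tr D have equal squares; positivity selects the sign.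
  have g3 : x * Q.trace = D.trace := by
    have h1 : (x * Q.trace - D.trace) * (x * Q.trace + D.trace) = 0 := by
      linear_combination (x * Q.trace) * g2 - D.trace * g1
    have h2 : x * Q.trace + D.trace ≠ 0 := (add_pos_of_nonneg_of_pos hpos hD).ne'
    exact sub_eq_zero.1 ((mul_eq_zero.1 h1).resolve_right h2)
  rw [hx, ← g3, mul_div_assoc, div_self hQ.ne', mul_one]

theorem cgMap_one (v : Matrix (m × l) n ℂ) :
    G.cgMap γ v 1 = ptrRight (G.qMatrix γ) (v * vᴴ) := by
  ext i j
  simp only [cgMap, LinearMap.coe_mk, AddHom.coe_mk, Matrix.of_apply, qTrace, Matrix.mul_one,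
    Matrix.trace, Matrix.diag_apply, Matrix.mul_apply (M := (G.qMatrix γ)ᵀ), ptrRight,
    Matrix.transpose_apply, smul_eq_mul]
  rw [Finset.sum_comm]

theorem trace_cgMap (hγ : G.qMatrix γ = 1) {v : Matrix (m × l) n ℂ} (hv : vᴴ * v = 1)
    (X : Matrix n n ℂ) : (G.cgMap γ v X).trace = X.trace := by
  have e : (G.cgMap γ v X).trace = (v * X * vᴴ).trace := by
    simp [cgMap, qTrace, hγ, Matrix.trace, Fintype.sum_prod_type]
  rw [e, Matrix.trace_mul_comm, ← Matrix.mul_assoc, hv, Matrix.one_mul]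

end Dimension

/-! ### Retracts as subrepresentations, and transport along equivalences -/

section Subrepresentations

variable {A : Type u} [CStarAlgebra A] {G : CompactQuantumGroup A}
variable {l m n : Type*} [Fintype l] [Fintype m] [Fintype n]
  [DecidableEq l] [DecidableEq m] [DecidableEq n]

theorem map_mul_algHom {B : Type u} [CStarAlgebra B] (f : A →ₐ[ℂ] B) (M : Matrix l m A)
    (N : Matrix m n A) : (M * N).map f = M.map f * N.map f :=
  Matrix.map_mul

theorem map_scalar_algHom {B : Type u} [CStarAlgebra B] (f : A →ₐ[ℂ] B) (X : Matrix m n ℂ) :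
    (scalar A X).map f = X.map (algebraMap ℂ B) :=
  map_scalar f X

/-- As p = t t' commutes with U, it can be moved through U and absorbed by t or t'. The inverse of
the compression is the compression of U^*; `t` and `t'` need not be adjoint to each other. -/
theorem isRep_compression {U : Matrix m m A} (hU : G.IsUnitaryRep U) {p : Matrix m m ℂ}
    (hp : p ∈ Hom U U) {t : Matrix m n ℂ} {t' : Matrix n m ℂ} (h1 : t' * t = 1)
    (h2 : t * t' = p) : G.IsRep (scalar A t' * U * scalar A t) := by
  have hp' : U * scalar A p = scalar A p * U := hp
  have u1 : U * Uᴴ = 1 := (Unitary.mem_iff.1 hU.2).2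
  have u2 : Uᴴ * U = 1 := (Unitary.mem_iff.1 hU.2).1
  have s2 : scalar A t * scalar A t' = scalar A p := by rw [← scalar_mul, h2]
  have s3 : scalar A p * scalar A t = scalar A t := by
    rw [← scalar_mul, ← h2, Matrix.mul_assoc, h1, Matrix.mul_one]
  have s1 : scalar A t' * scalar A t = 1 := by rw [← scalar_mul, h1, scalar_one]
  have s4 : scalar A t' * scalar A p = scalar A t' := by
    rw [← scalar_mul, ← h2, ← Matrix.mul_assoc, h1, Matrix.one_mul]
  constructor
  · refine ⟨⟨_, scalar A t' * Uᴴ * scalar A t, ?_, ?_⟩, rfl⟩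
    · calc scalar A t' * U * scalar A t * (scalar A t' * Uᴴ * scalar A t)
          = scalar A t' * (U * (scalar A t * scalar A t')) * Uᴴ * scalar A t := by
            simp only [Matrix.mul_assoc]
        _ = scalar A t' * scalar A p * (U * Uᴴ) * scalar A t := by
            rw [s2, hp']
            simp only [Matrix.mul_assoc]
        _ = 1 := by rw [u1, s4, Matrix.mul_one, s1]
    · calc scalar A t' * Uᴴ * scalar A t * (scalar A t' * U * scalar A t)
          = scalar A t' * Uᴴ * ((scalar A t * scalar A t') * U) * scalar A t := by
            simp only [Matrix.mul_assoc]
        _ = scalar A t' * (Uᴴ * U) * (scalar A p * scalar A t) := by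
            rw [s2, ← hp']
            simp only [Matrix.mul_assoc]
        _ = 1 := by rw [u2, s3, Matrix.mul_one, s1]
  · rw [comul_apply_iff]
    have hc := comul_apply_iff.1 hU.1.2
    have e : ∀ (f : A →ₐ[ℂ] MinTensor A A), (scalar A t' * U * scalar A t).map f
        = t'.map (algebraMap ℂ (MinTensor A A)) * U.map f
          * t.map (algebraMap ℂ (MinTensor A A)) := fun f => by
      rw [map_mul_algHom, map_mul_algHom, map_scalar_algHom, map_scalar_algHom]
    have e' := e (G.comul : A →ₐ[ℂ] MinTensor A A)
    refine e'.trans ?_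
    rw [e, e]
    refine (congrArg (fun M => t'.map (algebraMap ℂ (MinTensor A A)) * M
      * t.map (algebraMap ℂ (MinTensor A A))) hc).trans ?_
    have q1 : t.map (algebraMap ℂ (MinTensor A A)) * t'.map (algebraMap ℂ (MinTensor A A))
        * U.map (rightLeg A)
        = U.map (rightLeg A) * t.map (algebraMap ℂ (MinTensor A A))
          * t'.map (algebraMap ℂ (MinTensor A A)) := by
      have := congrArg (fun M => M.map (rightLeg A)) hp'
      simp only [← s2, map_mul_algHom, map_scalar_algHom] at this
      rw [← Matrix.mul_assoc] at this
      exact this.symm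
    have q2 : t'.map (algebraMap ℂ (MinTensor A A)) * t.map (algebraMap ℂ (MinTensor A A))
        = 1 := by
      have := congrArg (fun M => M.map (rightLeg A)) s1
      simp only [map_mul_algHom, map_scalar_algHom] at this
      rw [this]
      exact Matrix.map_one _ (map_zero _) (map_one _)
    calc _ = t'.map (algebraMap ℂ (MinTensor A A)) * U.map (leftLeg A) * (U.map (rightLeg A)
          * t.map (algebraMap ℂ (MinTensor A A)) * (t'.map (algebraMap ℂ (MinTensor A A))
          * t.map (algebraMap ℂ (MinTensor A A)))) := by
          rw [q2, Matrix.mul_one]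
          simp only [Matrix.mul_assoc]
      _ = t'.map (algebraMap ℂ (MinTensor A A)) * U.map (leftLeg A) *
          (t.map (algebraMap ℂ (MinTensor A A)) * t'.map (algebraMap ℂ (MinTensor A A))
          * U.map (rightLeg A)) * t.map (algebraMap ℂ (MinTensor A A)) := by
          rw [q1]
          simp only [Matrix.mul_assoc]
      _ = _ := by simp only [Matrix.mul_assoc]

/-- A representation which is a retract of a unitary representation is a subrepresentation. -/
theorem isSubrep_of_retract {U : Matrix m m A} (hU : G.IsUnitaryRep U) {σ : Matrix n n A}
    {s : Matrix m n ℂ} {s' : Matrix n m ℂ} (hs : s ∈ Hom σ U) (hs' : s' ∈ Hom U σ)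
    (h : s' * s = 1) : G.IsSubrep σ U := by
  -- The complement is the compression of U to the range of the idempotent self-intertwiner 1 - s
  -- s'.
  have hpp : (1 - s * s') * (1 - s * s') = 1 - s * s' := by
    have : s * s' * (s * s') = s * s' := by
      rw [Matrix.mul_assoc, ← Matrix.mul_assoc s', h, Matrix.one_mul]
    rw [Matrix.sub_mul, Matrix.one_mul, Matrix.mul_sub, Matrix.mul_one, this, sub_self, sub_zero]
  obtain ⟨d, t, t', h1, h2⟩ := exists_splitting hpp
  have hp : 1 - s * s' ∈ Hom U U := by
    have h3 := mul_mem_hom hs hs'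
    have h4 := one_mem_hom U
    have : 1 - s * s' = 1 + (-1 : ℂ) • (s * s') := by rw [neg_one_smul, sub_eq_add_neg]
    simp only [Hom, Set.mem_ofPred_eq] at h3 h4 ⊢
    rw [this, scalar_add, Matrix.mul_add, Matrix.add_mul, h4, scalar_smul, Matrix.mul_smul, h3,
      Matrix.smul_mul]
  have h3 : s' * t = 0 := by
    calc s' * t = s' * (t * t') * t := by
          rw [Matrix.mul_assoc, Matrix.mul_assoc t, h1, Matrix.mul_one]
      _ = 0 := by
        rw [h2, Matrix.mul_sub, ← Matrix.mul_assoc, h, Matrix.one_mul, Matrix.mul_one, sub_self,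
          Matrix.zero_mul]
  have h4 : t' * s = 0 := by
    calc t' * s = t' * (t * t') * s := by
          rw [← Matrix.mul_assoc t', h1, Matrix.one_mul]
      _ = 0 := by
        rw [h2, Matrix.mul_assoc, Matrix.sub_mul, Matrix.mul_assoc, h, Matrix.one_mul,
          Matrix.mul_one, sub_self, Matrix.mul_zero]
  refine ⟨d, _, isRep_compression hU hp h1 h2, Matrix.fromCols s t, ?_, Matrix.fromRows s' t',
    ?_, ?_⟩
  · have es : scalar A (Matrix.fromCols s t) = Matrix.fromCols (scalar A s) (scalar A t) := by
      ext i (j | j) <;> rfl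
    simp only [Hom, Set.mem_ofPred_eq] at hs hp ⊢
    rw [es, Matrix.mul_fromCols, Matrix.fromCols_mul_fromBlocks, hs]
    congr 1
    · simp
    · rw [Matrix.mul_zero, zero_add, ← Matrix.mul_assoc, ← Matrix.mul_assoc, ← scalar_mul, h2,
        ← hp, Matrix.mul_assoc, ← scalar_mul, ← h2, Matrix.mul_assoc, h1, Matrix.mul_one]
  · rw [Matrix.fromRows_mul_fromCols, h, h1, h3, h4, Matrix.fromBlocks_one]
  · rw [Matrix.fromCols_mul_fromRows, h2]
    abel

/-- A matrix which unitarizes the contragredient can be transported along an equivalence. -/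
theorem IsModular.of_equivalent {γ : Matrix l l A} {δ : Matrix n n A} {Q : Matrix l l ℂ}
    (hγ : G.IsIrrep γ) (hδ : G.IsIrrep δ) (hQ : IsModular γ Q) (h : Equivalent δ γ) :
    ∃ K, IsModular δ K := by
  have := hδ.2.1
  obtain ⟨T, hT, T', h1, -⟩ := h
  have hT0 : T ≠ 0 := by
    rintro rfl
    rw [Matrix.mul_zero] at h1
    exact zero_ne_one h1
  obtain ⟨c, hc, e1, e2⟩ := hδ.equivalent_of_ne_zero hγ hT hT0
  have hT' := conjTranspose_mem_hom hδ.1.2 hγ.1.2 hT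
  have a1 := mul_map_star_transpose hT
  have a2 : γ.map star * scalar A (T.map star) = scalar A (T.map star) * δ.map star :=
    map_star_mem_hom hT
  have a3 : δ.map star * scalar A Tᵀ = scalar A Tᵀ * γ.map star := by
    have : Tᵀ = Tᴴ.map star := by ext; simp
    rw [this]
    exact map_star_mem_hom hT'
  have a4 := transpose_mul_map_star hT'
  have tt : T.map star * Tᵀ = c • 1 := by
    have := congrArg Matrix.transpose e2
    rw [Matrix.transpose_mul, Matrix.transpose_smul, Matrix.transpose_one] at this
    exact this
  have tt' : Tᵀ * T.map star = c • 1 := by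
    have := congrArg Matrix.transpose e1
    rw [Matrix.transpose_mul, Matrix.transpose_smul, Matrix.transpose_one] at this
    exact this
  -- By Schur T is √c times a unitary, so the transported matrix has an inverse of the same shape,
  -- and both relations for γ carry over to δ.
  have hinv : (Tᵀ * Q * T.map star)⁻¹ = (c⁻¹ * c⁻¹) • (Tᵀ * Q⁻¹ * T.map star) := by
    refine Matrix.inv_eq_right_inv ?_
    calc Tᵀ * Q * T.map star * ((c⁻¹ * c⁻¹) • (Tᵀ * Q⁻¹ * T.map star))
        = (c⁻¹ * c⁻¹) • (Tᵀ * Q * (T.map star * Tᵀ) * Q⁻¹ * T.map star) := by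
          rw [Matrix.mul_smul]
          simp only [Matrix.mul_assoc]
      _ = (c⁻¹ * c⁻¹ * c) • (Tᵀ * (Q * Q⁻¹) * T.map star) := by
          rw [tt, Matrix.mul_smul, Matrix.mul_one, Matrix.smul_mul, Matrix.smul_mul, smul_smul]
          simp only [Matrix.mul_assoc]
      _ = 1 := by
          rw [posDef_mul_inv hQ.posDef, Matrix.mul_one, tt', smul_smul, mul_assoc, mul_assoc,
            inv_mul_cancel_left₀ hc.ne', inv_mul_cancel₀ hc.ne', one_smul]
  refine ⟨Tᵀ * Q * T.map star, ?_, ?_, ?_⟩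
  · have e : Tᵀ = (T.map star)ᴴ := (conjTranspose_map_star_complex T).symm
    rw [e]
    refine hQ.posDef.conjTranspose_mul_mul_same ?_
    intro x y hxy
    have := congrArg (fun z => c⁻¹ • Matrix.mulVec Tᵀ z) hxy
    simpa only [Matrix.mulVec_mulVec, tt', Matrix.smul_mulVec, Matrix.one_mulVec, smul_smul,
      inv_mul_cancel₀ hc.ne', one_smul] using this
  · rw [scalar_mul, scalar_mul, ← Matrix.mul_assoc, ← Matrix.mul_assoc, ← a1, Matrix.mul_assoc,
      ← a2, ← Matrix.mul_assoc, Matrix.mul_assoc (scalar A Tᵀ), Matrix.mul_assoc (scalar A Tᵀ),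
      hQ.left]
  · rw [hinv, scalar_smul, Matrix.mul_smul, Matrix.smul_mul, scalar_mul, scalar_mul,
      ← Matrix.mul_assoc, ← Matrix.mul_assoc, a3, Matrix.mul_assoc _ (scalar A (T.map star))]
    congr 1
    rw [← a4, ← Matrix.mul_assoc, Matrix.mul_assoc (scalar A Tᵀ), Matrix.mul_assoc (scalar A Tᵀ),
      hQ.right]

end Subrepresentations

end CompactQuantumGroup

namespace CompactQuantumGroup

/-! ### Irreducible constituents of ᾱ ⊗ β -/

section ClebschGordan

variable {A : Type u} [CStarAlgebra A] {G : CompactQuantumGroup A}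
variable {l m n : Type*} [Fintype l] [Fintype m] [Fintype n]
  [DecidableEq l] [DecidableEq m] [DecidableEq n]

theorem IsIrrep.exists_isometric {σ : Matrix n n A} {w : Matrix m m A} (hσ : G.IsIrrep σ)
    (hw : w ∈ unitary (Matrix m m A)) {X : Matrix m n ℂ} (hX : X ∈ Hom σ w) (h0 : X ≠ 0) :
    ∃ v, IsIsometricIntertwiner σ w v := by
  obtain ⟨c, hc, h⟩ := hσ.exists_conjTranspose_mul_self hw hX h0
  obtain ⟨r, rfl⟩ : ∃ r : ℝ, (r : ℂ) = c :=
    ⟨_, (Complex.eq_re_of_ofReal_le (r := 0) (by simpa using hc.le)).symm⟩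
  have hr : 0 < r := by exact_mod_cast hc
  refine ⟨(((√r)⁻¹ : ℝ) : ℂ) • X, smul_mem_hom _ hX, ?_⟩
  rw [Matrix.conjTranspose_smul, Matrix.smul_mul, Matrix.mul_smul, h, smul_smul, smul_smul]
  have : star (((√r)⁻¹ : ℝ) : ℂ) * (((√r)⁻¹ : ℝ) : ℂ) * (r : ℂ) = 1 := by
    have h1 : (√r)⁻¹ * (√r)⁻¹ * r = 1 := by
      have h2 : √r ≠ 0 := (Real.sqrt_pos.2 hr).ne'
      nth_rewrite 3 [← Real.mul_self_sqrt hr.le]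
      field_simp
    rw [Complex.star_def, Complex.conj_ofReal]
    exact_mod_cast h1
  rw [this, one_smul]

theorem IsIsometricIntertwiner.ne_zero [Nonempty n] {σ : Matrix n n A} {w : Matrix m m A}
    {v : Matrix m n ℂ} (h : IsIsometricIntertwiner σ w v) : v ≠ 0 := by
  rintro rfl
  have := h.2
  rw [Matrix.mul_zero] at this
  exact zero_ne_one this

/-- A subrepresentation of an invertible representation is nonzero. -/
theorem IsSubrep.ne_zero [Nontrivial A] [Nonempty n] {σ : Matrix n n A} {U : Matrix m m A}
    (hU : IsUnit U) (h : G.IsSubrep σ U) : σ ≠ 0 := by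
  rintro rfl
  obtain ⟨d, w, -, X, hX, Y, h1, -⟩ := h
  obtain ⟨V, hV⟩ := hU.exists_left_inv
  have i : n := Classical.arbitrary n
  have h3 : (1 : Matrix (n ⊕ Fin d) (n ⊕ Fin d) A)
      = scalar A Y * V * scalar A X * Matrix.fromBlocks 0 0 0 w := by
    calc (1 : Matrix (n ⊕ Fin d) (n ⊕ Fin d) A) = scalar A Y * (V * U) * scalar A X := by
          rw [hV, Matrix.mul_one, ← scalar_mul, h1, scalar_one]
      _ = scalar A Y * V * (U * scalar A X) := by simp only [Matrix.mul_assoc]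
      _ = _ := by rw [show U * scalar A X = _ from hX, Matrix.mul_assoc _ (scalar A X)]
  have h4 := congrFun (congrFun h3 (Sum.inl i)) (Sum.inl i)
  rw [Matrix.mul_apply, Fintype.sum_sum_type] at h4
  simp at h4

theorem equivalent_contragredient_conj {σ : Matrix n n A} (h : G.IsQMatrix σ (G.qMatrix σ)) :
    Equivalent (contragredient σ) (G.conj σ) :=
  equivalent_conjBy h.posDef σ

/-- The conjugate is equivalent to the contragredient, and the contragredient is an involution that
respects equivalence. -/
theorem equivalent_conj_iff {σ : Matrix n n A} {τ : Matrix m m A}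
    (hσ : G.IsQMatrix σ (G.qMatrix σ)) (hτ : G.IsQMatrix τ (G.qMatrix τ)) :
    Equivalent (G.conj σ) (G.conj τ) ↔ Equivalent σ τ := by
  have h1 := equivalent_contragredient_conj hσ
  have h2 := equivalent_contragredient_conj hτ
  refine ⟨fun h => ?_, fun h => (h1.symm.trans h.contragredient).trans h2⟩
  have := ((h1.trans h).trans h2.symm).contragredient
  rwa [contragredient_contragredient, contragredient_contragredient] at this

theorem isSubrep_conj_iff [Nontrivial A] {ι : Type*} [Fintype ι] [DecidableEq ι] {k : ι → Type*}
    [∀ j, Fintype (k j)] [∀ j, DecidableEq (k j)] {U : Matrix m m A} (hU : G.IsUnitaryRep U)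
    {γ : ∀ j, Matrix (k j) (k j) A} (hγ : ∀ j, G.IsIrrep (γ j))
    (hQ : ∀ j, G.IsQMatrix (γ j) (G.qMatrix (γ j)))
    (hdec : Equivalent U (Matrix.blockDiagonal' fun j => G.conj (γ j))) {δ : Matrix n n A}
    (hδ : G.IsIrrep δ) : G.IsSubrep (G.conj δ) U ↔ ∃ j, Equivalent δ (γ j) := by
  have := hδ.2.1
  obtain ⟨X, Y, hX, hY, hYX, hXY, -⟩ := exists_components hdec
  constructor
  · intro h
    -- Excludes that δ̄ is the default value 0: a zero block cannot occur in an invertible matrix.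
    have hQδ := isQMatrix_of_conj_ne_zero (h.ne_zero hU.1.1)
    obtain ⟨d, w, -, Z, hZ, W, h1, -⟩ := h
    set z : Matrix m n ℂ := Z.submatrix id Sum.inl with hz
    have hzm : z ∈ Hom (G.conj δ) U := by
      simp only [Hom, Set.mem_ofPred_eq] at hZ ⊢
      ext p q
      have := congrFun (congrFun hZ p) (Sum.inl q)
      rw [Matrix.mul_apply (M := scalar A Z), Fintype.sum_sum_type] at this
      simpa [Matrix.mul_apply, scalar, hz] using this
    have hz0 : z ≠ 0 := by
      intro h0
      have i : n := Classical.arbitrary n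
      have := congrFun (congrFun h1 (Sum.inl i)) (Sum.inl i)
      rw [Matrix.mul_apply, Matrix.one_apply_eq] at this
      have e : ∀ p, Z p (Sum.inl i) = 0 := fun p => congrFun (congrFun h0 p) i
      simp [e] at this
    obtain ⟨j, hj⟩ : ∃ j, X j * z ≠ 0 := by
      by_contra! hall
      refine hz0 ?_
      rw [← Matrix.one_mul z, ← hYX, Matrix.sum_mul]
      exact Finset.sum_eq_zero fun j _ => by rw [Matrix.mul_assoc, hall, Matrix.mul_zero]
    exact ⟨j, (equivalent_conj_iff hQδ (hQ j)).1
      ((hδ.conj hQδ).equivalent ((hγ j).conj (hQ j)) (mul_mem_hom (hX j) hzm) hj)⟩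
  · rintro ⟨j, hj⟩
    -- Existence of Q_δ has to be established before the conjugate of δ can be compared with that of
    -- γ_j.
    obtain ⟨K, hK⟩ := IsModular.of_equivalent (hγ j) hδ (hQ j).isModular hj
    have hQδ := isQMatrix_qMatrix (hδ.exists_isQMatrix hK)
    obtain ⟨T, hT, T', h1, h2⟩ := (equivalent_conj_iff hQδ (hQ j)).2 hj
    refine isSubrep_of_retract hU (mul_mem_hom (hY j) hT)
      (mul_mem_hom (inv_mem_hom hT h1 h2) (hX j)) ?_
    rw [Matrix.mul_assoc, ← Matrix.mul_assoc (X j), hXY, Matrix.one_mul, h1]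

end ClebschGordan

/-! ### The cone of covariant completely positive maps -/

section Main

variable {A : Type u} [CStarAlgebra A] {G : CompactQuantumGroup A}
  {a N : ℕ} {m : Type*} [Fintype m] [DecidableEq m] {c : Fin N → ℕ}
  {α : Matrix (Fin a) (Fin a) A} {β : Matrix m m A}
  {γ : ∀ j : Fin N, Matrix (Fin (c j)) (Fin (c j)) A}

/-- Maps whose twisted Choi matrices are the positive operators `R j (R j)^*` of a
multiplicity-free decomposition of `ᾱ ⊗ β` are a basis of the covariant maps and generate the cone of
the completely positive ones. -/
theorem cpCov_eq {Q : Matrix (Fin a) (Fin a) ℂ} (hQ : IsModular α Q)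
    (hβ : β ∈ unitary (Matrix m m A)) {ι : Type*} [Fintype ι] [DecidableEq ι] {k : ι → Type*}
    [∀ j, Fintype (k j)] [∀ j, DecidableEq (k j)] [∀ j, Nonempty (k j)]
    {σ : ∀ j, Matrix (k j) (k j) A} (hσ : ∀ j, G.IsIrrep (σ j))
    (hne : ∀ i j, Equivalent (σ i) (σ j) → i = j)
    (hdec : Equivalent (tensor (conjBy Q α) β) (Matrix.blockDiagonal' σ))
    {R : ∀ j, Matrix (Fin a × m) (k j) ℂ} (hR : ∀ j, R j ∈ Hom (σ j) (tensor (conjBy Q α) β))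
    (h0 : ∀ j, R j ≠ 0) {Φ : ι → (Matrix (Fin a) (Fin a) ℂ →ₗ[ℂ] Matrix m m ℂ)}
    (hΦ : ∀ j, twistedChoi Q (Φ j) = R j * (R j)ᴴ) :
    (LinearIndependent ℂ Φ ∧ Submodule.span ℂ (Set.range Φ) = Cov α β) ∧
      CPCov α β = {Ψ | ∃ t : ι → ℝ, (∀ j, 0 ≤ t j) ∧ Ψ = ∑ j, (t j : ℂ) • Φ j} := by
  have hU := tensor_mem_unitary ((isModular_iff hQ.posDef).1 hQ) hβ
  obtain ⟨r, hr0, hr, horth, hsum⟩ := exists_orthogonal hU hσ hne hdec hR h0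
  have hchoi : ∀ t : ι → ℂ, twistedChoi Q (∑ j, t j • Φ j) = ∑ j, t j • (R j * (R j)ᴴ) :=
    fun t => by simp only [map_sum, map_smul, hΦ]
  have hcov : ∀ j, Φ j ∈ Cov α β := fun j => by
    rw [mem_cov_iff_twistedChoi hQ hβ, hΦ]
    exact mul_mem_hom (hR j) (conjTranspose_mem_hom (hσ j).1.2 hU (hR j))
  -- Expand the twisted Choi matrix in End(ᾱ ⊗ β) and pull the expansion back by injectivity.
  have hspan : ∀ Ψ ∈ Cov α β, ∃ z : ι → ℂ, Ψ = ∑ j, z j • Φ j := fun Ψ hΨ => by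
    obtain ⟨z, hz⟩ := exists_eq_sum_of_mem_hom hU hσ hne hR hsum
      ((mem_cov_iff_twistedChoi hQ hβ).1 hΨ)
    exact ⟨z, twistedChoi_injective hQ.posDef (hz.trans (hchoi z).symm)⟩
  refine ⟨⟨?_, le_antisymm ?_ ?_⟩, Set.Subset.antisymm ?_ ?_⟩
  · refine LinearIndependent.of_comp (twistedChoi Q) ?_
    have e : (twistedChoi Q : _ → _) ∘ Φ = fun j => R j * (R j)ᴴ := funext hΦ
    rw [e]
    exact linearIndependent_mul_conjTranspose hr0 hr horth
  · rw [Submodule.span_le]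
    rintro _ ⟨j, rfl⟩
    exact hcov j
  · intro Ψ hΨ
    obtain ⟨z, rfl⟩ := hspan Ψ hΨ
    exact Submodule.sum_mem _ fun j _ => Submodule.smul_mem _ _ (Submodule.subset_span ⟨j, rfl⟩)
  · rintro Ψ ⟨hΨ, hcp⟩
    obtain ⟨z, rfl⟩ := hspan Ψ hΨ
    rw [isCP_iff_twistedChoi hQ.posDef, hchoi] at hcp
    have hz := nonneg_of_posSemidef_sum hr0 hr horth hcp
    refine ⟨fun j => (z j).re, fun j => (Complex.nonneg_iff.1 (hz j)).1, ?_⟩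
    refine Finset.sum_congr rfl fun j _ => ?_
    rw [← Complex.eq_re_of_ofReal_le (r := 0) (by simpa using hz j)]
  · rintro _ ⟨t, ht, rfl⟩
    refine ⟨Submodule.sum_mem _ fun j _ => Submodule.smul_mem _ _ (hcov j), ?_⟩
    rw [isCP_iff_twistedChoi hQ.posDef, hchoi fun j => (t j : ℂ)]
    refine Matrix.posSemidef_sum _ fun j _ =>
      (Matrix.posSemidef_self_mul_conjTranspose (R j)).smul ?_
    exact_mod_cast ht j

end Main

end CompactQuantumGroup

/-! ### The theorem -/

theorem mainTheorem1 {A : Type u} [CStarAlgebra A] [Nontrivial A] (G : CompactQuantumGroup A)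
    {a b N : ℕ} {c : Fin N → ℕ}
    (α : Matrix (Fin a) (Fin a) A) (β : Matrix (Fin b) (Fin b) A)
    (γ : ∀ j : Fin N, Matrix (Fin (c j)) (Fin (c j)) A)
    (hα : G.IsIrrep α) (hβ : G.IsIrrep β) (hγ : ∀ j, G.IsIrrep (γ j))
    (hdec : G.IsMultiplicityFreeDecomposition
      (CompactQuantumGroup.tensor (G.conj α) β) (fun j => G.conj (γ j))) :
    -- the irreducible `δ` with `δ̄ ⊆ ᾱ ⊗ β` are, up to equivalence, exactly the `γ_j`
    (∀ (d : ℕ) (δ : Matrix (Fin d) (Fin d) A), G.IsIrrep δ →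
      (G.IsSubrep (G.conj δ) (CompactQuantumGroup.tensor (G.conj α) β) ↔
        ∃ j, CompactQuantumGroup.Equivalent δ (γ j))) ∧
    -- the Clebsch–Gordan maps exist
    (∀ j, ∃ v, CompactQuantumGroup.IsIsometricIntertwiner α
      (CompactQuantumGroup.tensor β (γ j)) v) ∧
    -- and for any choice of the isometric intertwiners
    ∀ v : ∀ j : Fin N, Matrix (Fin b × Fin (c j)) (Fin a) ℂ,
      (∀ j, CompactQuantumGroup.IsIsometricIntertwiner α
        (CompactQuantumGroup.tensor β (γ j)) (v j)) →
      (LinearIndependent ℂ (fun j => G.cgMap (γ j) (v j)) ∧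
        Submodule.span ℂ (Set.range fun j => G.cgMap (γ j) (v j)) =
          CompactQuantumGroup.Cov α β) ∧
      CompactQuantumGroup.CPCov α β =
        {Φ | ∃ t : Fin N → ℝ, (∀ j, 0 ≤ t j) ∧
          Φ = ∑ j, (t j : ℂ) • G.cgMap (γ j) (v j)} ∧
      (CompactQuantumGroup.UCPCov α β).extremePoints ℝ =
        Set.range (fun j => (G.qDim β / G.qDim α) • G.cgMap (γ j) (v j)) ∧
      (G.IsKac → (CompactQuantumGroup.CPTPCov α β).extremePoints ℝ =
        Set.range (fun j => G.cgMap (γ j) (v j))) := by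
  have ha := hα.2.1
  have hb := hβ.2.1
  -- ᾱ ⊗ β is invertible of nonzero size over a nontrivial algebra, so ᾱ is not the default value 0
  -- and Q_α exists.
  have hconjα : G.conj α ≠ 0 := by
    intro h0
    have h1 := hdec.isRep.1
    have h2 : CompactQuantumGroup.tensor (G.conj α) β = 0 := by
      ext ⟨i, k⟩ ⟨j, l⟩
      simp [CompactQuantumGroup.tensor, h0]
    rw [h2] at h1
    exact not_isUnit_zero h1
  have hQα := CompactQuantumGroup.isQMatrix_of_conj_ne_zero hconjα
  have hQγ : ∀ j, G.IsQMatrix (γ j) (G.qMatrix (γ j)) := fun j =>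
    CompactQuantumGroup.isQMatrix_of_conj_ne_zero (hdec.isIrrep j).ne_zero
  have hc : ∀ j, Nonempty (Fin (c j)) := fun j => (hγ j).2.1
  have hUu : CompactQuantumGroup.tensor (G.conj α) β ∈ unitary _ :=
    CompactQuantumGroup.tensor_mem_unitary hQα.isUnitaryRep.2 hβ.1.2
  have hU : G.IsUnitaryRep (CompactQuantumGroup.tensor (G.conj α) β) := ⟨hdec.isRep, hUu⟩
  have hT : ∀ j, CompactQuantumGroup.tensor β (γ j) ∈ unitary _ := fun j =>
    CompactQuantumGroup.tensor_mem_unitary hβ.1.2 (hγ j).1.2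
  have hfrob : ∀ j (v : Matrix (Fin b × Fin (c j)) (Fin a) ℂ),
      CompactQuantumGroup.frob (G.qMatrix α) (G.qMatrix (γ j)) v ∈ CompactQuantumGroup.Hom
        (G.conj (γ j)) (CompactQuantumGroup.tensor (G.conj α) β) ↔
      v ∈ CompactQuantumGroup.Hom α (CompactQuantumGroup.tensor β (γ j)) := fun j v =>
    CompactQuantumGroup.frob_mem_hom_iff hQα.isModular (hQγ j).isModular
  obtain ⟨X, Y, hX, hY, hYX, hXY, -⟩ := CompactQuantumGroup.exists_components hdec.equivalent
  -- Pull the inclusion of the j-th conjugate into ᾱ ⊗ β back along Frobenius reciprocity and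
  -- normalize it.
  have hex : ∀ j, ∃ v, CompactQuantumGroup.IsIsometricIntertwiner α
      (CompactQuantumGroup.tensor β (γ j)) v := fun j => by
    obtain ⟨v, hv⟩ := CompactQuantumGroup.exists_frob_eq hQα.posDef (hQγ j).posDef (Y j)
    refine hα.exists_isometric (hT j) ((hfrob j v).1 (hv ▸ hY j)) ?_
    rintro rfl
    rw [CompactQuantumGroup.frob_zero] at hv
    have := hXY j
    rw [← hv, Matrix.mul_zero] at this
    exact zero_ne_one this
  -- For N = 0 the resolution of the identity of ᾱ ⊗ β would be an empty sum. One index is needed to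
  -- construct Q_β.
  obtain ⟨j₀⟩ : Nonempty (Fin N) := by
    by_contra h
    rw [not_nonempty_iff] at h
    rw [Finset.univ_eq_empty, Finset.sum_empty] at hYX
    exact zero_ne_one hYX
  have hQβ : G.IsQMatrix β (G.qMatrix β) := by
    obtain ⟨v, hv⟩ := hex j₀
    obtain ⟨K, hK⟩ := CompactQuantumGroup.exists_isModular hα.1.2 hβ (hγ j₀).1.2 hQα.isModular
      (hQγ j₀).isModular hv.1 hv.ne_zero
    exact CompactQuantumGroup.isQMatrix_qMatrix (hβ.exists_isQMatrix hK)
  refine ⟨fun d δ hδ => CompactQuantumGroup.isSubrep_conj_iff hU hγ hQγ hdec.equivalent hδ, hex,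
    fun v hv => ?_⟩
  have hR := fun j => (hfrob j (v j)).2 (hv j).1
  have hR0 : ∀ j, CompactQuantumGroup.frob (G.qMatrix α) (G.qMatrix (γ j)) (v j) ≠ 0 :=
    fun j h => (hv j).ne_zero (CompactQuantumGroup.frob_injective hQα.posDef (hQγ j).posDef
      (h.trans CompactQuantumGroup.frob_zero.symm))
  obtain ⟨hbasis, hcp⟩ := CompactQuantumGroup.cpCov_eq hQα.isModular hβ.1.2 hdec.isIrrep
    hdec.inequivalent hdec.equivalent hR hR0 (Φ := fun j => G.cgMap (γ j) (v j))
    fun j => CompactQuantumGroup.twistedChoi_cgMap (hQγ j).posDef hQα.posDef (v j)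
  -- Frobenius reciprocity carries multiplicity one of the conjugate of γ_j in ᾱ ⊗ β over to α in β
  -- ⊗ γ_j.
  have hmul : ∀ j, ∀ w ∈ CompactQuantumGroup.Hom α (CompactQuantumGroup.tensor β (γ j)),
      ∃ z : ℂ, w = z • v j := fun j w hw => by
    obtain ⟨r, -, -, -, hsum⟩ := CompactQuantumGroup.exists_orthogonal hUu hdec.isIrrep
      hdec.inequivalent hdec.equivalent hR hR0
    obtain ⟨z, hz⟩ := CompactQuantumGroup.exists_eq_smul_of_mem_hom hUu hdec.isIrrep
      hdec.inequivalent hR hsum ((hfrob j w).2 hw)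
    refine ⟨z, CompactQuantumGroup.frob_injective hQα.posDef (hQγ j).posDef ?_⟩
    rw [hz, CompactQuantumGroup.frob_smul]
  have hone : ∀ j, G.cgMap (γ j) (v j) 1 = (G.qDim α / G.qDim β) • 1 := fun j => by
    rw [CompactQuantumGroup.cgMap_one]
    exact CompactQuantumGroup.ptrRight_mul_conjTranspose hα hβ (hγ j) hQα hQβ (hQγ j) (hv j)
      (hmul j)
  have hdα : 0 < G.qDim α := hQα.posDef.trace_pos
  have hdβ : 0 < G.qDim β := hQβ.posDef.trace_pos
  obtain ⟨s, hs⟩ : ∃ s : ℝ, (s : ℂ) = G.qDim β / G.qDim α :=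
    ⟨_, (Complex.eq_re_of_ofReal_le (r := 0)
      (by simpa using (div_pos hdβ hdα).le)).symm⟩
  have hs0 : 0 < s := by
    have := div_pos hdβ hdα
    rw [← hs] at this
    exact_mod_cast this
  have hs' : G.qDim α / G.qDim β = ((s⁻¹ : ℝ) : ℂ) := by
    rw [Complex.ofReal_inv, hs, inv_div]
  refine ⟨hbasis, hcp, ?_, fun hkac => ?_⟩
  · rw [← hs, ← extremePoints_simplex hbasis.1 hs0]
    congr 1
    ext Φ
    simp only [CompactQuantumGroup.UCPCov, hcp, Set.mem_ofPred_eq]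
    -- Every Φ_j(1) is the same scalar s⁻¹ = d_α/d_β, so unitality only fixes the sum of the
    -- coefficients and the unital maps form a simplex of size s.
    have key : ∀ t : Fin N → ℝ, (∑ j, (t j : ℂ) • G.cgMap (γ j) (v j)) 1 = 1 ↔
        ∑ j, t j = s := fun t => by
      have e : (∑ j, (t j : ℂ) • G.cgMap (γ j) (v j)) 1
          = (((∑ j, t j) * s⁻¹ : ℝ) : ℂ) • (1 : Matrix (Fin b) (Fin b) ℂ) := by
        rw [LinearMap.sum_apply]
        simp only [LinearMap.smul_apply, hone, hs', smul_smul]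
        rw [← Finset.sum_smul, ← Finset.sum_mul]
        push_cast
        rfl
      rw [e, ← div_eq_mul_inv]
      constructor
      · intro h
        rw [← one_smul ℂ (1 : Matrix (Fin b) (Fin b) ℂ), smul_smul, mul_one] at h
        have := CompactQuantumGroup.smul_one_injective h
        exact (div_eq_one_iff_eq hs0.ne').1 (by exact_mod_cast this)
      · intro h
        rw [h, div_self hs0.ne', Complex.ofReal_one, one_smul]
    constructor
    · rintro ⟨⟨t, ht, rfl⟩, h1⟩
      exact ⟨t, ht, (key t).1 h1, rfl⟩
    · rintro ⟨t, ht, h1, rfl⟩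
      exact ⟨⟨t, ht, rfl⟩, (key t).2 h1⟩
  · have h := extremePoints_simplex hbasis.1 one_pos
    simp only [Complex.ofReal_one, one_smul] at h
    rw [← h]
    congr 1
    ext Φ
    simp only [CompactQuantumGroup.CPTPCov, hcp, Set.mem_ofPred_eq]
    have e : ∀ (t : Fin N → ℝ) X, ((∑ j, (t j : ℂ) • G.cgMap (γ j) (v j)) X).trace
        = ((∑ j, t j : ℝ) : ℂ) * X.trace := fun t X => by
      rw [LinearMap.sum_apply, Matrix.trace_sum]
      simp only [LinearMap.smul_apply, Matrix.trace_smul, smul_eq_mul,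
        CompactQuantumGroup.trace_cgMap (hkac _ _ (hγ _).1) (hv _).2]
      rw [← Finset.sum_mul]
      push_cast
      rfl
    constructor
    · rintro ⟨⟨t, ht, rfl⟩, h1⟩
      refine ⟨t, ht, ?_, rfl⟩
      have h2 := h1 1
      rw [e] at h2
      have h3 : (1 : Matrix (Fin a) (Fin a) ℂ).trace ≠ 0 := Matrix.PosDef.one.trace_pos.ne'
      exact_mod_cast mul_right_cancel₀ h3 (h2.trans (one_mul _).symm)
    · rintro ⟨t, ht, h1, rfl⟩
      refine ⟨⟨t, ht, rfl⟩, fun X => ?_⟩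
      rw [e, h1, Complex.ofReal_one, one_mul]
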